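/- Let $L_1, L_2 > 0$, let $\Omega = (0,L_1)\times(0,L_2)$, let $\boldsymbol\Gamma = \{x=0\}\cup\{y=0\}$ be the union of the left and bottom sides of $\overline\Omega$, and let $m \ge 0$ be an integer. Let $\lambda = \lambda(x,y)$ be a real function on $\Omega$ that satisfies the positive $m$-condition: there are positive constants $c_0, c_1$ with $c_0 \le \lambda \le c_1$ in $\Omega$; moreover $\nabla\lambda \in L^\infty(\Omega)$ if $m \in \{0,1\}$, and $\lambda \in H^{\max(3,m)}(\Omega)$ if $m \ge 2$. Put $T\theta = \lambda\,\theta_x + \theta_y$ (in the sense of distributions, with $\lambda\theta_x := \partial_x(\lambda\theta) - \lambda_x\theta$), and let $$\mathcal X^m_{\boldsymbol\Gamma}(\Omega) = \{\theta \in H^m(\Omega) : T\theta \in H^m(\Omega),\ \partial^\alpha\theta|_{\boldsymbol\Gamma} = 0 \text{ for all } |\alpha| \le m\},$$ with the norm $(\|\theta\|_{H^m(\Omega)}^2 + \|T\theta\|_{H^m(\Omega)}^2)^{1/2}$. Here $u|_{\boldsymbol\Gamma} = 0$ means that the traces of $u$ at $x=0$ and at $y=0$ vanish, where the trace at $x=0$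 is the value at $x=0$ of the representative of $u$ in $\mathcal C([0,L_1]; H^{-1}(0,L_2))$, and the trace at $y=0$ is the value at $y=0$ of the representative of $u$ in $\mathcal C([0,L_2]; H^{-1}(0,L_1))$. Let $\mathcal V_{\boldsymbol\Gamma}(\Omega)$ be the set of all $\theta \in \mathcal C^\infty(\overline\Omega)$ that vanish in a neighborhood of $\boldsymbol\Gamma$. Then $\mathcal V_{\boldsymbol\Gamma}(\Omega)\cap\mathcal X^m_{\boldsymbol\Gamma}(\Omega)$ is dense in $\mathcal X^m_{\boldsymbol\Gamma}(\Omega)$. -/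

import Mathlib

open MeasureTheory Set
open scoped ContDiff

namespace RectDensity

/-- The open rectangle `Ω = (0, L₁) × (0, L₂)`. -/
def rect (L₁ L₂ : ℝ) : Set (ℝ × ℝ) := Ioo 0 L₁ ×ˢ Ioo 0 L₂

/-- The closed rectangle. -/
def closedRect (L₁ L₂ : ℝ) : Set (ℝ × ℝ) := Icc 0 L₁ ×ˢ Icc 0 L₂

/-- The part `Γ = {x = 0} ∪ {y = 0}` of the boundary of the rectangle. -/
def Gam (L₁ L₂ : ℝ) : Set (ℝ × ℝ) :=
  {p | p ∈ closedRect L₁ L₂ ∧ (p.1 = 0 ∨ p.2 = 0)}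

/-- Classical partial derivative in the first variable. -/
noncomputable def dx (f : ℝ × ℝ → ℝ) : ℝ × ℝ → ℝ := fun p => fderiv ℝ f p (1, 0)

/-- Classical partial derivative in the second variable. -/
noncomputable def dy (f : ℝ × ℝ → ℝ) : ℝ × ℝ → ℝ := fun p => fderiv ℝ f p (0, 1)

/-- The classical mixed derivative `∂_x^a ∂_y^b f`. -/
noncomputable def partialD (a b : ℕ) (f : ℝ × ℝ → ℝ) : ℝ × ℝ → ℝ := dx^[a] (dy^[b] f)

/-- Test functions: `φ ∈ C_c^∞(Ω)`. -/
def IsTest (L₁ L₂ : ℝ) (φ : ℝ × ℝ → ℝ) : Prop :=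
  ContDiff ℝ ∞ φ ∧ HasCompactSupport φ ∧ tsupport φ ⊆ rect L₁ L₂

/-- `g = ∂_x^a ∂_y^b u` in the weak (distributional) sense on `Ω`. -/
def HasWeakDeriv (L₁ L₂ : ℝ) (a b : ℕ) (u g : ℝ × ℝ → ℝ) : Prop :=
  LocallyIntegrableOn u (rect L₁ L₂) ∧ LocallyIntegrableOn g (rect L₁ L₂) ∧
    ∀ φ, IsTest L₁ L₂ φ →
      ∫ p in rect L₁ L₂, u p * partialD a b φ p
        = (-1) ^ (a + b) * ∫ p in rect L₁ L₂, g p * φ p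

open Classical in
/-- The weak derivative `∂_x^a ∂_y^b u` on `Ω`, determined up to null sets; it is used only where
it exists (the value is `0` otherwise). -/
noncomputable def weakDeriv (L₁ L₂ : ℝ) (a b : ℕ) (u : ℝ × ℝ → ℝ) : ℝ × ℝ → ℝ :=
  if h : ∃ g, HasWeakDeriv L₁ L₂ a b u g then h.choose else 0

/-- The Sobolev space `H^m(Ω)`: all weak derivatives of order at most `m` exist and are
square integrable. -/
def MemH (L₁ L₂ : ℝ) (m : ℕ) (u : ℝ × ℝ → ℝ) : Prop :=
  ∀ a b : ℕ, a + b ≤ m → ∃ g, HasWeakDeriv L₁ L₂ a b u g ∧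
    MemLp g 2 (volume.restrict (rect L₁ L₂))

/-- The norm of `H^m(Ω)`: the square root of `∑_{|α| ≤ m} ‖∂^α u‖²_{L²(Ω)}`. -/
noncomputable def hNorm (L₁ L₂ : ℝ) (m : ℕ) (u : ℝ × ℝ → ℝ) : ENNReal :=
  (∑ α ∈ (Finset.range (m + 1) ×ˢ Finset.range (m + 1)).filter (fun α => α.1 + α.2 ≤ m),
    (eLpNorm (weakDeriv L₁ L₂ α.1 α.2 u) 2 (volume.restrict (rect L₁ L₂))) ^ 2) ^ (1 / 2 : ℝ)

/-- The positive `m`-condition on the coefficient `lam`: it is bounded above and below by positive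
constants; its weak gradient is in `L^∞(Ω)` if `m ≤ 1`, and it is in `H^{max(3, m)}(Ω)`
if `m ≥ 2`. -/
def PositiveCondition (L₁ L₂ : ℝ) (m : ℕ) (lam : ℝ × ℝ → ℝ) : Prop :=
  (∃ c₀ c₁ : ℝ, 0 < c₀ ∧ 0 < c₁ ∧
    ∀ᵐ p ∂(volume.restrict (rect L₁ L₂)), c₀ ≤ lam p ∧ lam p ≤ c₁) ∧
  (m ≤ 1 → ∀ a b : ℕ, a + b = 1 → ∃ g, HasWeakDeriv L₁ L₂ a b lam g ∧
    MemLp g (⊤ : ENNReal) (volume.restrict (rect L₁ L₂))) ∧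
  (2 ≤ m → MemH L₁ L₂ (max 3 m) lam)

/-- `g = T u = lam * u_x + u_y` in the sense of distributions on `Ω`. The product `lam * u_x` of a
coefficient with bounded gradient and a distributional derivative of `u` acts on a test function
`φ` by `-∫ u ∂_x(lam φ)`, where `∂_x(lam φ) = lam_x φ + lam φ_x`. When `u_x` is itself a
function, this is the usual pointwise product. -/
def IsT (L₁ L₂ : ℝ) (lam u g : ℝ × ℝ → ℝ) : Prop :=
  LocallyIntegrableOn u (rect L₁ L₂) ∧ LocallyIntegrableOn g (rect L₁ L₂) ∧
    ∀ φ, IsTest L₁ L₂ φ →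
      ∫ p in rect L₁ L₂, g p * φ p
        = -(∫ p in rect L₁ L₂, u p * (weakDeriv L₁ L₂ 1 0 lam p * φ p + lam p * dx φ p))
          - ∫ p in rect L₁ L₂, u p * dy φ p

open Classical in
/-- The function `T u = lam * u_x + u_y`, determined up to null sets; it is used only where
it exists (the value is `0` otherwise). -/
noncomputable def opT (L₁ L₂ : ℝ) (lam u : ℝ × ℝ → ℝ) : ℝ × ℝ → ℝ :=
  if h : ∃ g, IsT L₁ L₂ lam u g then h.choose else 0

/-- Test functions on the interval `(0, R)`. -/
def IsTest1 (R : ℝ) (ψ : ℝ → ℝ) : Prop :=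
  ContDiff ℝ ∞ ψ ∧ HasCompactSupport ψ ∧ tsupport ψ ⊆ Ioo 0 R

/-- The norm of `H¹_0(0, R)`, on test functions. -/
noncomputable def h1Norm (R : ℝ) (ψ : ℝ → ℝ) : ℝ :=
  Real.sqrt (∫ t in Ioo 0 R, (ψ t ^ 2 + deriv ψ t ^ 2))

/-- Let `u` be a function of `(s, t) ∈ (0, S) × (0, R)`. Then `τ` is the trace of `u` at `s = 0`:
the curve `s ↦ u(s, ·)` agrees for almost every `s` with a curve `W` that is continuous
from `[0, S]` to `H⁻¹(0, R)`, the dual space of `H¹_0(0, R)`, and `W 0 = τ`.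

An element of `H⁻¹(0, R)` is given by its values on `C_c^∞(0, R)`, which is dense in `H¹_0(0, R)`.
For `u ∈ L²`, almost every `W s` is the bounded linear functional `ψ ↦ ∫ u(s, t) ψ(t) dt`, hence
by continuity every `W s` is linear and bounded for the norm of `H¹_0`. -/
def HasTraceAtZero (S R : ℝ) (u : ℝ → ℝ → ℝ) (τ : (ℝ → ℝ) → ℝ) : Prop :=
  ∃ W : ℝ → (ℝ → ℝ) → ℝ,
    (∀ᵐ s ∂(volume.restrict (Ioo 0 S)), ∀ ψ, IsTest1 R ψ →
      W s ψ = ∫ t in Ioo 0 R, u s t * ψ t) ∧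
    (∀ s₀ ∈ Icc 0 S, ∀ ε > 0, ∃ δ > 0, ∀ s ∈ Icc 0 S, |s - s₀| < δ →
      ∀ ψ, IsTest1 R ψ → |W s ψ - W s₀ ψ| ≤ ε * h1Norm R ψ) ∧
    ∀ ψ, IsTest1 R ψ → W 0 ψ = τ ψ

/-- `u|_Γ = 0`: the trace of `u` at `x = 0` and the trace of `u` at `y = 0` vanish. -/
def VanishesOnGam (L₁ L₂ : ℝ) (u : ℝ × ℝ → ℝ) : Prop :=
  HasTraceAtZero L₁ L₂ (fun x y => u (x, y)) 0 ∧ HasTraceAtZero L₂ L₁ (fun y x => u (x, y)) 0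

/-- The space `X^m_Γ(Ω)` of all `θ ∈ H^m(Ω)` with `T θ ∈ H^m(Ω)` and `∂^α θ|_Γ = 0` for all
`|α| ≤ m`. -/
def XGam (L₁ L₂ : ℝ) (m : ℕ) (lam : ℝ × ℝ → ℝ) : Set (ℝ × ℝ → ℝ) :=
  {θ | MemH L₁ L₂ m θ ∧ (∃ g, IsT L₁ L₂ lam θ g ∧ MemH L₁ L₂ m g) ∧
    ∀ a b : ℕ, a + b ≤ m → VanishesOnGam L₁ L₂ (weakDeriv L₁ L₂ a b θ)}

/-- The norm of `X^m_Γ(Ω)`: the square root of `‖θ‖²_{H^m(Ω)} + ‖T θ‖²_{H^m(Ω)}`. -/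
noncomputable def xNorm (L₁ L₂ : ℝ) (m : ℕ) (lam θ : ℝ × ℝ → ℝ) : ENNReal :=
  (hNorm L₁ L₂ m θ ^ 2 + hNorm L₁ L₂ m (opT L₁ L₂ lam θ) ^ 2) ^ (1 / 2 : ℝ)

/-- The space `V_Γ(Ω)` of the functions that are smooth on the closed rectangle and vanish in a
neighbourhood of `Γ`. -/
def VGam (L₁ L₂ : ℝ) : Set (ℝ × ℝ → ℝ) :=
  {v | ContDiffOn ℝ ∞ v (closedRect L₁ L₂) ∧
    ∃ U : Set (ℝ × ℝ), IsOpen U ∧ Gam L₁ L₂ ⊆ U ∧ ∀ p ∈ U ∩ closedRect L₁ L₂, v p = 0}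

end RectDensity

namespace RectDensity

open Filter
open scoped Topology ENNReal

/-! The approximants are mollifications of the extension of `θ` by zero, with a kernel `ker ε`
supported in `[ε, 3ε]²`. At a point of `Ω` such a mollification only uses values of `θ` to the lower
left. It therefore vanishes as soon as one coordinate is at most `ε` (`moll_eq_zero`), which puts it
in `VGam`, and it never looks across the right and top sides, where nothing is prescribed. Two
things remain: the extension by zero must create no singular terms on `Γ`, and mollification must be
compatible with `T` up to order `m`.

The first is `wd_extend`. If `w` has zero traces, `w` and `f` are in `L²`, `a` and `b` are bounded
and Lipschitz, and `∂_x(a w) + ∂_y(b w) = f` in `Ω`, then the equation may be tested with functions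
that do not vanish on `Γ`. A cutoff along an edge produces averages of `w` over thin strips, and
these tend to `0` because the curve of traces is continuous into `H⁻¹` and starts at `0`
(`HasTraceAtZero.tendsto_strip`). Since `H⁻¹` is dual to `H¹_0`, this needs weights that vanish near
the ends of the edge, so the corner is separate: there a gradient of size `1/k` lives on a square of
side `2k`, is bounded in `L²`, and square integrability of `w` suffices (`tendsto_integral_corner`).
Consequently mollification commutes with the derivatives up to order `m` on all of `Ω`
(`dd_moll_of_vanishes`), and convergence in `H^m` is convergence of mollifications in `L²`.

For `T θ` the difficulty is that `w = ∂^α θ` with `|α| = m` need not be differentiable. Still, `T w`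
is `∂^α (T θ)` minus a sum of products `∂^β λ ∂^γ θ` with `|β|, |γ| ≥ 1` and `|β| + |γ| ≤ m + 1`
(`wt_of_jet`), and this is in `L²`. The Friedrichs lemma `tendsto_comm` then applies: the Lipschitz
bound for `λ` gains the factor `ε` that a derivative of the kernel loses, so `T` of the mollified
`w` converges to `T w` (`tendsto_transport_moll`). The same Leibniz expansion for the mollified
function (`hasWeakDeriv_of_wt`) leads back to `∂^α T`.

The products are controlled in `L²` by `exists_eLpNorm_mul_le`. Besides `H² ⊂ L^∞`, it uses an
anisotropic estimate (`eLpNorm_mul_sq_le`): if `f_x` and `d_y` are in `L²`, then `f` is dominated by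
a function of `y` and `d` by a function of `x`, so `f d` is in `L²` by Fubini. -/

/-! ### Directional derivatives and test functions -/

/-- The derivative of `f` in the direction `e`. -/
noncomputable def dd (e : ℝ × ℝ) (f : ℝ × ℝ → ℝ) : ℝ × ℝ → ℝ := fun p => fderiv ℝ f p e

lemma dx_eq_dd (f : ℝ × ℝ → ℝ) : dx f = dd (1, 0) f := rfl

lemma dy_eq_dd (f : ℝ × ℝ → ℝ) : dy f = dd (0, 1) f := rfl

/-- Smooth functions with compact support in `U`. -/
def TestOn (U : Set (ℝ × ℝ)) (φ : ℝ × ℝ → ℝ) : Prop :=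
  ContDiff ℝ ∞ φ ∧ HasCompactSupport φ ∧ tsupport φ ⊆ U

lemma isOpen_rect (L₁ L₂ : ℝ) : IsOpen (rect L₁ L₂) := isOpen_Ioo.prod isOpen_Ioo

lemma measurableSet_rect (L₁ L₂ : ℝ) : MeasurableSet (rect L₁ L₂) :=
  (isOpen_rect L₁ L₂).measurableSet

lemma rect_subset_closedRect (L₁ L₂ : ℝ) : rect L₁ L₂ ⊆ closedRect L₁ L₂ :=
  prod_mono Ioo_subset_Icc_self Ioo_subset_Icc_self

lemma isCompact_closedRect (L₁ L₂ : ℝ) : IsCompact (closedRect L₁ L₂) :=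
  isCompact_Icc.prod isCompact_Icc

instance isFiniteMeasure_restrict_rect (L₁ L₂ : ℝ) :
    IsFiniteMeasure (volume.restrict (rect L₁ L₂)) :=
  ⟨by
    rw [Measure.restrict_apply_univ]
    exact (measure_mono (rect_subset_closedRect L₁ L₂)).trans_lt
      (isCompact_closedRect L₁ L₂).measure_lt_top⟩

lemma contDiff_dd {f : ℝ × ℝ → ℝ} (hf : ContDiff ℝ ∞ f) (e : ℝ × ℝ) : ContDiff ℝ ∞ (dd e f) :=
  (hf.fderiv_right (m := ∞) (by simp)).clm_apply contDiff_const

lemma differentiable_of_smooth {f : ℝ × ℝ → ℝ} (hf : ContDiff ℝ ∞ f) : Differentiable ℝ f :=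
  hf.differentiable (by simp)

lemma dd_mul {f g : ℝ × ℝ → ℝ} {p : ℝ × ℝ} (hf : DifferentiableAt ℝ f p)
    (hg : DifferentiableAt ℝ g p) (e : ℝ × ℝ) :
    dd e (fun q => f q * g q) p = f p * dd e g p + dd e f p * g p := by
  simp only [dd]
  rw [fderiv_fun_mul hf hg]
  simp [mul_comm]

lemma dd_comm {f : ℝ × ℝ → ℝ} (hf : ContDiff ℝ ∞ f) (e e' : ℝ × ℝ) :
    dd e (dd e' f) = dd e' (dd e f) := by
  funext p
  have hs : IsSymmSndFDerivAt ℝ f p := (hf.contDiffAt).isSymmSndFDerivAt (by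
    simp only [minSmoothness_of_isRCLikeNormedField]; exact WithTop.coe_le_coe.2 (le_top : (2 : ℕ∞) ≤ ⊤))
  have hd : DifferentiableAt ℝ (fderiv ℝ f) p :=
    ((hf.fderiv_right (m := ∞) (by simp)).differentiable (by simp)) p
  have key : ∀ v w : ℝ × ℝ, dd v (dd w f) p = fderiv ℝ (fderiv ℝ f) p v w := by
    intro v w
    change fderiv ℝ (fun q => fderiv ℝ f q w) p v = _
    rw [fderiv_clm_apply hd (differentiableAt_const w)]
    simp
  rw [key, key]
  exact hs e e'

lemma tsupport_dd_subset (e : ℝ × ℝ) (f : ℝ × ℝ → ℝ) : tsupport (dd e f) ⊆ tsupport f :=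
  tsupport_fderiv_apply_subset ℝ e

lemma TestOn.dd {U : Set (ℝ × ℝ)} {φ : ℝ × ℝ → ℝ} (h : TestOn U φ) (e : ℝ × ℝ) :
    TestOn U (dd e φ) :=
  ⟨contDiff_dd h.1 e, h.2.1.mono' ((subset_tsupport _).trans (tsupport_dd_subset e φ)),
    (tsupport_dd_subset e φ).trans h.2.2⟩

lemma TestOn.smooth_mul {U : Set (ℝ × ℝ)} {φ f : ℝ × ℝ → ℝ} (h : TestOn U φ)
    (hf : ContDiff ℝ ∞ f) : TestOn U (fun p => f p * φ p) :=
  ⟨hf.mul h.1, h.2.1.mul_left, (tsupport_mul_subset_right).trans h.2.2⟩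

lemma TestOn.continuous {U : Set (ℝ × ℝ)} {φ : ℝ × ℝ → ℝ} (h : TestOn U φ) : Continuous φ :=
  h.1.continuous

lemma TestOn.eq_zero_of_notMem {U : Set (ℝ × ℝ)} {φ : ℝ × ℝ → ℝ} (h : TestOn U φ) {p : ℝ × ℝ}
    (hp : p ∉ U) : φ p = 0 :=
  image_eq_zero_of_notMem_tsupport (fun h' => hp (h.2.2 h'))

lemma TestOn.memLp {U : Set (ℝ × ℝ)} {φ : ℝ × ℝ → ℝ} (h : TestOn U φ) (q : ℝ≥0∞)
    (S : Set (ℝ × ℝ)) : MemLp φ q (volume.restrict S) :=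
  (h.continuous.memLp_of_hasCompactSupport h.2.1).restrict S

lemma memLp_mul_of_top {μ : Measure (ℝ × ℝ)} {u f : ℝ × ℝ → ℝ} (hu : MemLp u 2 μ)
    (hf : MemLp f ∞ μ) : MemLp (fun p => f p * u p) 2 μ :=
  hu.mul hf

lemma _root_.MeasureTheory.MemLp.mul_test {S U : Set (ℝ × ℝ)} {u φ : ℝ × ℝ → ℝ} (hu : MemLp u 2 (volume.restrict S))
    (h : TestOn U φ) : MemLp (fun p => u p * φ p) 2 (volume.restrict S) := by
  simpa only [mul_comm] using memLp_mul_of_top hu (h.memLp ∞ S)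

lemma integrable_mul_of_L2 {μ : Measure (ℝ × ℝ)} {u v : ℝ × ℝ → ℝ} (hu : MemLp u 2 μ)
    (hv : MemLp v 2 μ) : Integrable (fun p => u p * v p) μ :=
  hu.integrable_mul hv

lemma integrable_of_L2 {L₁ L₂ : ℝ} {u : ℝ × ℝ → ℝ}
    (hu : MemLp u 2 (volume.restrict (rect L₁ L₂))) :
    Integrable u (volume.restrict (rect L₁ L₂)) :=
  hu.integrable (by norm_num)

lemma locallyIntegrableOn_of_L2 {L₁ L₂ : ℝ} {u : ℝ × ℝ → ℝ}
    (hu : MemLp u 2 (volume.restrict (rect L₁ L₂))) : LocallyIntegrableOn u (rect L₁ L₂) :=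
  IntegrableOn.locallyIntegrableOn (integrable_of_L2 hu)

lemma memLp_of_continuous {L₁ L₂ : ℝ} {f : ℝ × ℝ → ℝ} (hf : Continuous f) (q : ℝ≥0∞) :
    MemLp f q (volume.restrict (rect L₁ L₂)) := by
  obtain ⟨C, hC⟩ := (isCompact_closedRect L₁ L₂).exists_bound_of_continuousOn hf.continuousOn
  refine MemLp.of_bound hf.aestronglyMeasurable C ?_
  filter_upwards [ae_restrict_mem (measurableSet_rect L₁ L₂)] with p hp
  exact hC p (rect_subset_closedRect _ _ hp)

/-- Both integrands vanish off the rectangle together with the test function, so the integrals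
extend to the plane, where integration by parts has no boundary term. -/
lemma integral_mul_dd {L₁ L₂ : ℝ} {f φ : ℝ × ℝ → ℝ} (hf : ContDiff ℝ ∞ f)
    (hφ : TestOn (rect L₁ L₂) φ) (e : ℝ × ℝ) :
    ∫ p in rect L₁ L₂, f p * dd e φ p = -∫ p in rect L₁ L₂, dd e f p * φ p := by
  have h0 : ∀ {g ψ : ℝ × ℝ → ℝ}, TestOn (rect L₁ L₂) ψ →
      ∫ p in rect L₁ L₂, g p * ψ p = ∫ p, g p * ψ p := fun {g ψ} hψ =>
    setIntegral_eq_integral_of_forall_compl_eq_zero fun p hp => by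
      rw [hψ.eq_zero_of_notMem hp, mul_zero]
  have hi : ∀ {g ψ : ℝ × ℝ → ℝ}, Continuous g → TestOn (rect L₁ L₂) ψ →
      Integrable (fun p => g p * ψ p) := fun {g ψ} hg hψ =>
    (hg.mul hψ.continuous).integrable_of_hasCompactSupport hψ.2.1.mul_left
  rw [h0 (hφ.dd e), h0 hφ]
  exact integral_mul_fderiv_eq_neg_fderiv_mul_of_integrable
    (hi (contDiff_dd hf e).continuous hφ) (hi hf.continuous (hφ.dd e)) (hi hf.continuous hφ)
    (fun p _ => differentiable_of_smooth hf p) (fun p _ => differentiable_of_smooth hφ.1 p)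

/-! ### Weak directional derivatives -/

/-- `g` is the weak derivative of `u` in the direction `e` on the rectangle. -/
def WD (L₁ L₂ : ℝ) (e : ℝ × ℝ) (u g : ℝ × ℝ → ℝ) : Prop :=
  ∀ φ, TestOn (rect L₁ L₂) φ →
    ∫ p in rect L₁ L₂, u p * dd e φ p = -∫ p in rect L₁ L₂, g p * φ p

lemma WD_of_smooth {L₁ L₂ : ℝ} {f : ℝ × ℝ → ℝ} (hf : ContDiff ℝ ∞ f) (e : ℝ × ℝ) :
    WD L₁ L₂ e f (dd e f) := fun _ hφ => integral_mul_dd hf hφ e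

lemma setIntegral_congr_of_ae {L₁ L₂ : ℝ} {u v : ℝ × ℝ → ℝ}
    (h : u =ᵐ[volume.restrict (rect L₁ L₂)] v) (ψ : ℝ × ℝ → ℝ) :
    ∫ p in rect L₁ L₂, u p * ψ p = ∫ p in rect L₁ L₂, v p * ψ p := by
  refine integral_congr_ae ?_
  filter_upwards [h] with p hp
  rw [hp]

/-- The fundamental lemma of the calculus of variations. It is what makes the choices in `weakDeriv`
and `opT` harmless. -/
lemma ae_eq_of_forall_test {L₁ L₂ : ℝ} {u v : ℝ × ℝ → ℝ}
    (hu : LocallyIntegrableOn u (rect L₁ L₂)) (hv : LocallyIntegrableOn v (rect L₁ L₂))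
    (h : ∀ φ, TestOn (rect L₁ L₂) φ →
      ∫ p in rect L₁ L₂, u p * φ p = ∫ p in rect L₁ L₂, v p * φ p) :
    u =ᵐ[volume.restrict (rect L₁ L₂)] v := by
  have hi : ∀ {w φ : ℝ × ℝ → ℝ}, LocallyIntegrableOn w (rect L₁ L₂) →
      TestOn (rect L₁ L₂) φ → Integrable (fun p => w p * φ p) := by
    intro w φ hw hφ
    have h1 : IntegrableOn w (tsupport φ) := hw.integrableOn_compact_subset hφ.2.2 hφ.2.1
    obtain ⟨C, hC⟩ := hφ.2.1.exists_bound_of_continuous hφ.continuous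
    have h2 : IntegrableOn (fun p => w p * φ p) (tsupport φ) := by
      refine Integrable.mul_bdd (c := C) h1 hφ.continuous.aestronglyMeasurable
        (Eventually.of_forall hC)
    rw [integrableOn_iff_integrable_of_support_subset] at h2
    · exact h2
    · intro p hp
      exact subset_tsupport _ (fun h0 => hp (by simp [h0]))
  have h0 := (isOpen_rect L₁ L₂).ae_eq_zero_of_integral_contDiff_smul_eq_zero
    (μ := volume) (f := fun p => u p - v p) (hu.sub hv) (by
      intro φ h1 h2 h3
      have hφ : TestOn (rect L₁ L₂) φ := ⟨h1, h2, h3⟩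
      have hz : ∀ w : ℝ × ℝ → ℝ, ∫ p in rect L₁ L₂, w p * φ p = ∫ p, w p * φ p := fun w =>
        setIntegral_eq_integral_of_forall_compl_eq_zero fun p hp => by
          rw [hφ.eq_zero_of_notMem hp, mul_zero]
      have := h φ hφ
      rw [hz, hz] at this
      simp only [smul_eq_mul]
      rw [show (fun p => φ p * (u p - v p)) = fun p => u p * φ p - v p * φ p by
        funext p; ring, integral_sub (hi hu hφ) (hi hv hφ), this, sub_self])
  rw [EventuallyEq, ae_restrict_iff' (measurableSet_rect L₁ L₂)]
  filter_upwards [h0] with p hp hm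
  exact sub_eq_zero.1 (hp hm)

lemma contDiff_iterate_dy {φ : ℝ × ℝ → ℝ} (h : ContDiff ℝ ∞ φ) (a : ℕ) :
    ContDiff ℝ ∞ (dy^[a] φ) := by
  induction a with
  | zero => exact h
  | succ a ih => rw [Function.iterate_succ_apply']; exact contDiff_dd ih _

lemma iterate_dy_dx {φ : ℝ × ℝ → ℝ} (h : ContDiff ℝ ∞ φ) (b : ℕ) :
    dy^[b] (dx φ) = dx (dy^[b] φ) := by
  induction b with
  | zero => rfl
  | succ b ih =>
    rw [Function.iterate_succ_apply', Function.iterate_succ_apply', ih]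
    exact dd_comm (contDiff_iterate_dy h b) _ _

lemma partialD_dx {φ : ℝ × ℝ → ℝ} (h : ContDiff ℝ ∞ φ) (a b : ℕ) :
    partialD a b (dx φ) = partialD (a + 1) b φ := by
  rw [partialD, partialD, iterate_dy_dx h, Function.iterate_succ_apply]

lemma partialD_dy (φ : ℝ × ℝ → ℝ) (a b : ℕ) :
    partialD a b (dy φ) = partialD a (b + 1) φ := rfl

/-- Derivatives of higher order are reached one direction at a time. `partialD` differentiates in
`y` before `x`, so a further `y` is definitional, while a further `x` is moved inside by commuting
classical derivatives of the test function. -/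
lemma HasWeakDeriv.comp_wd {L₁ L₂ : ℝ} {a b : ℕ} {u g k : ℝ × ℝ → ℝ}
    (h : HasWeakDeriv L₁ L₂ a b u g) (hk : LocallyIntegrableOn k (rect L₁ L₂)) :
    (WD L₁ L₂ (1, 0) g k → HasWeakDeriv L₁ L₂ (a + 1) b u k) ∧
      (WD L₁ L₂ (0, 1) g k → HasWeakDeriv L₁ L₂ a (b + 1) u k) := by
  refine ⟨fun hw => ⟨h.1, hk, fun φ hφ => ?_⟩, fun hw => ⟨h.1, hk, fun φ hφ => ?_⟩⟩
  · rw [← partialD_dx hφ.1, dx_eq_dd, h.2.2 _ (TestOn.dd hφ _), hw φ hφ]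
    ring
  · rw [← partialD_dy, dy_eq_dd, h.2.2 _ (TestOn.dd hφ _), hw φ hφ]
    ring

/-- A derivative of a test function is again one. The equation of order `a + b` tested with it and
the equation of order `a + b + 1` therefore have the same left side; comparing the right sides
leaves only signs. -/
lemma HasWeakDeriv.wd_of_succ {L₁ L₂ : ℝ} {a b : ℕ} {u g k : ℝ × ℝ → ℝ}
    (h : HasWeakDeriv L₁ L₂ a b u g) :
    (HasWeakDeriv L₁ L₂ (a + 1) b u k → WD L₁ L₂ (1, 0) g k) ∧
      (HasWeakDeriv L₁ L₂ a (b + 1) u k → WD L₁ L₂ (0, 1) g k) := by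
  have h1 : ((-1 : ℝ) ^ (a + b)) * (-1) ^ (a + b) = 1 := by
    rw [← mul_pow]; norm_num
  refine ⟨fun hw φ hφ => ?_, fun hw φ hφ => ?_⟩
  · have h2 := h.2.2 _ (TestOn.dd hφ (1, 0))
    have h3 := hw.2.2 φ hφ
    rw [← dx_eq_dd, partialD_dx hφ.1, h3] at h2
    rw [← dx_eq_dd]
    linear_combination (-(-1 : ℝ) ^ (a + b)) * h2 - (∫ p in rect L₁ L₂, g p * dx φ p) * h1
      - (∫ p in rect L₁ L₂, k p * φ p) * h1
  · have h2 := h.2.2 _ (TestOn.dd hφ (0, 1))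
    have h3 := hw.2.2 φ hφ
    rw [← dy_eq_dd, partialD_dy, h3] at h2
    rw [← dy_eq_dd]
    linear_combination (-(-1 : ℝ) ^ (a + b)) * h2 - (∫ p in rect L₁ L₂, g p * dy φ p) * h1
      - (∫ p in rect L₁ L₂, k p * φ p) * h1

lemma HasWeakDeriv.ae_unique {L₁ L₂ : ℝ} {a b : ℕ} {u g k : ℝ × ℝ → ℝ}
    (h : HasWeakDeriv L₁ L₂ a b u g) (h' : HasWeakDeriv L₁ L₂ a b u k) :
    g =ᵐ[volume.restrict (rect L₁ L₂)] k := by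
  refine ae_eq_of_forall_test h.2.1 h'.2.1 fun φ hφ => ?_
  have h2 := (h.2.2 φ hφ).symm.trans (h'.2.2 φ hφ)
  exact mul_left_cancel₀ (pow_ne_zero _ (by norm_num)) h2

lemma locallyIntegrableOn_congr {L₁ L₂ : ℝ} {u v : ℝ × ℝ → ℝ}
    (huv : u =ᵐ[volume.restrict (rect L₁ L₂)] v) (h : LocallyIntegrableOn u (rect L₁ L₂)) :
    LocallyIntegrableOn v (rect L₁ L₂) := by
  intro p hp
  obtain ⟨s, hs, hi⟩ := h p hp
  refine ⟨s ∩ rect L₁ L₂, inter_mem hs self_mem_nhdsWithin, ?_⟩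
  exact (hi.mono_set inter_subset_left).congr
    (ae_mono (Measure.restrict_mono inter_subset_right le_rfl) huv)

lemma HasWeakDeriv.congr {L₁ L₂ : ℝ} {a b : ℕ} {u v g k : ℝ × ℝ → ℝ}
    (h : HasWeakDeriv L₁ L₂ a b u g) (huv : u =ᵐ[volume.restrict (rect L₁ L₂)] v)
    (hgk : g =ᵐ[volume.restrict (rect L₁ L₂)] k) : HasWeakDeriv L₁ L₂ a b v k :=
  ⟨locallyIntegrableOn_congr huv h.1, locallyIntegrableOn_congr hgk h.2.1, fun φ hφ => by
    rw [← setIntegral_congr_of_ae huv, ← setIntegral_congr_of_ae hgk]; exact h.2.2 φ hφ⟩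

lemma hasWeakDeriv_weakDeriv {L₁ L₂ : ℝ} {a b : ℕ} {u : ℝ × ℝ → ℝ}
    (h : ∃ g, HasWeakDeriv L₁ L₂ a b u g) : HasWeakDeriv L₁ L₂ a b u (weakDeriv L₁ L₂ a b u) := by
  rw [weakDeriv, dif_pos h]
  exact h.choose_spec

lemma HasWeakDeriv.ae_eq_weakDeriv {L₁ L₂ : ℝ} {a b : ℕ} {u g : ℝ × ℝ → ℝ}
    (h : HasWeakDeriv L₁ L₂ a b u g) :
    weakDeriv L₁ L₂ a b u =ᵐ[volume.restrict (rect L₁ L₂)] g :=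
  (hasWeakDeriv_weakDeriv ⟨g, h⟩).ae_unique h

lemma hasWeakDeriv_zero {L₁ L₂ : ℝ} {u : ℝ × ℝ → ℝ} (h : LocallyIntegrableOn u (rect L₁ L₂)) :
    HasWeakDeriv L₁ L₂ 0 0 u u :=
  ⟨h, h, fun φ _ => by simp [partialD]⟩

/-! ### Families of successive weak derivatives -/

/-- `D a b`, for `a + b ≤ N`, is a family of square integrable functions such that
`D (a + 1) b` and `D a (b + 1)` are the weak derivatives of `D a b`. -/
structure IsJet (L₁ L₂ : ℝ) (N : ℕ) (D : ℕ → ℕ → ℝ × ℝ → ℝ) : Prop where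
  memLp : ∀ a b, a + b ≤ N → MemLp (D a b) 2 (volume.restrict (rect L₁ L₂))
  wd_x : ∀ a b, a + b < N → WD L₁ L₂ (1, 0) (D a b) (D (a + 1) b)
  wd_y : ∀ a b, a + b < N → WD L₁ L₂ (0, 1) (D a b) (D a (b + 1))

lemma MemH.ae_eq_self {L₁ L₂ : ℝ} {m : ℕ} {u : ℝ × ℝ → ℝ} (h : MemH L₁ L₂ m u) :
    weakDeriv L₁ L₂ 0 0 u =ᵐ[volume.restrict (rect L₁ L₂)] u := by
  obtain ⟨g, hg, -⟩ := h 0 0 (by simp)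
  exact (hasWeakDeriv_zero hg.1).ae_eq_weakDeriv

/-- `MemH` asks for each derivative separately. The estimates below use a chain in which each member
is a weak derivative of the previous one, and the chosen representatives form such a chain. -/
lemma MemH.isJet {L₁ L₂ : ℝ} {m : ℕ} {u : ℝ × ℝ → ℝ} (h : MemH L₁ L₂ m u) :
    IsJet L₁ L₂ m (fun a b => weakDeriv L₁ L₂ a b u) := by
  have h1 : ∀ a b, a + b ≤ m → HasWeakDeriv L₁ L₂ a b u (weakDeriv L₁ L₂ a b u) :=
    fun a b hab => hasWeakDeriv_weakDeriv ⟨_, (h a b hab).choose_spec.1⟩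
  refine ⟨fun a b hab => ?_, fun a b hab => ?_, fun a b hab => ?_⟩
  · obtain ⟨g, hg, hg2⟩ := h a b hab
    exact hg2.ae_eq hg.ae_eq_weakDeriv.symm
  · exact (h1 a b hab.le).wd_of_succ.1 (h1 (a + 1) b (by omega))
  · exact (h1 a b hab.le).wd_of_succ.2 (h1 a (b + 1) (by omega))

/-- The weak derivatives of order at most `m` from a chain that starts with the derivatives in the
first variable. -/
lemma hasWeakDeriv_of_chain {L₁ L₂ : ℝ} {m : ℕ} {D : ℕ → ℕ → ℝ × ℝ → ℝ}
    (hL : ∀ a b, a + b ≤ m → MemLp (D a b) 2 (volume.restrict (rect L₁ L₂)))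
    (hx : ∀ a, a < m → WD L₁ L₂ (1, 0) (D a 0) (D (a + 1) 0))
    (hy : ∀ a b, a + b < m → WD L₁ L₂ (0, 1) (D a b) (D a (b + 1))) :
    ∀ a b, a + b ≤ m → HasWeakDeriv L₁ L₂ a b (D 0 0) (D a b) := by
  have h0 : ∀ a, a ≤ m → HasWeakDeriv L₁ L₂ a 0 (D 0 0) (D a 0) := by
    intro a
    induction a with
    | zero => exact fun _ => hasWeakDeriv_zero (locallyIntegrableOn_of_L2 (hL 0 0 (by simp)))
    | succ a ih =>
      intro ha
      exact ((ih (by omega)).comp_wd (locallyIntegrableOn_of_L2 (hL _ _ (by omega)))).1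
        (hx a (by omega))
  intro a b
  induction b with
  | zero => exact h0 a
  | succ b ih =>
    intro ha
    exact ((ih (by omega)).comp_wd (locallyIntegrableOn_of_L2 (hL _ _ (by omega)))).2
      (hy a b (by omega))

lemma IsJet.hasWeakDeriv {L₁ L₂ : ℝ} {m : ℕ} {D : ℕ → ℕ → ℝ × ℝ → ℝ} (h : IsJet L₁ L₂ m D)
    {a b : ℕ} (hab : a + b ≤ m) : HasWeakDeriv L₁ L₂ a b (D 0 0) (D a b) :=
  hasWeakDeriv_of_chain h.memLp (fun a ha => h.wd_x a 0 (by omega)) h.wd_y a b hab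

lemma WD.add {L₁ L₂ : ℝ} {e : ℝ × ℝ} {u v g k : ℝ × ℝ → ℝ} (h : WD L₁ L₂ e u g)
    (h' : WD L₁ L₂ e v k) (hu : Integrable u (volume.restrict (rect L₁ L₂)))
    (hv : Integrable v (volume.restrict (rect L₁ L₂)))
    (hg : Integrable g (volume.restrict (rect L₁ L₂)))
    (hk : Integrable k (volume.restrict (rect L₁ L₂))) :
    WD L₁ L₂ e (fun p => u p + v p) (fun p => g p + k p) := by
  intro φ hφ
  have hi : ∀ {w ψ : ℝ × ℝ → ℝ}, Integrable w (volume.restrict (rect L₁ L₂)) →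
      TestOn (rect L₁ L₂) ψ →
      Integrable (fun p => w p * ψ p) (volume.restrict (rect L₁ L₂)) := by
    intro w ψ hw hψ
    obtain ⟨C, hC⟩ := hψ.2.1.exists_bound_of_continuous hψ.continuous
    exact hw.mul_bdd (c := C) hψ.continuous.aestronglyMeasurable (Eventually.of_forall hC)
  simp only [add_mul]
  rw [integral_add (hi hu (hφ.dd e)) (hi hv (hφ.dd e)), integral_add (hi hg hφ) (hi hk hφ),
    h φ hφ, h' φ hφ]
  ring

lemma WD.const_mul {L₁ L₂ : ℝ} {e : ℝ × ℝ} {u g : ℝ × ℝ → ℝ} (h : WD L₁ L₂ e u g) (c : ℝ) :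
    WD L₁ L₂ e (fun p => c * u p) (fun p => c * g p) := by
  intro φ hφ
  simp only [mul_assoc]
  rw [integral_const_mul, integral_const_mul, h φ hφ]
  ring

lemma WD.sub {L₁ L₂ : ℝ} {e : ℝ × ℝ} {u v g k : ℝ × ℝ → ℝ} (h : WD L₁ L₂ e u g)
    (h' : WD L₁ L₂ e v k) (hu : Integrable u (volume.restrict (rect L₁ L₂)))
    (hv : Integrable v (volume.restrict (rect L₁ L₂)))
    (hg : Integrable g (volume.restrict (rect L₁ L₂)))
    (hk : Integrable k (volume.restrict (rect L₁ L₂))) :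
    WD L₁ L₂ e (fun p => u p - v p) (fun p => g p - k p) := by
  simpa [sub_eq_add_neg] using h.add (h'.const_mul (-1)) hu (hv.const_mul (-1)) hg
    (hk.const_mul (-1))

lemma IsJet.sub {L₁ L₂ : ℝ} {m : ℕ} {D E : ℕ → ℕ → ℝ × ℝ → ℝ} (h : IsJet L₁ L₂ m D)
    (h' : IsJet L₁ L₂ m E) : IsJet L₁ L₂ m (fun a b p => D a b p - E a b p) := by
  have hi : ∀ {F : ℕ → ℕ → ℝ × ℝ → ℝ}, IsJet L₁ L₂ m F → ∀ a b, a + b ≤ m →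
      Integrable (F a b) (volume.restrict (rect L₁ L₂)) := fun hF a b hab =>
    integrable_of_L2 (hF.memLp a b hab)
  exact ⟨fun a b hab => (h.memLp a b hab).sub (h'.memLp a b hab),
    fun a b hab => (h.wd_x a b hab).sub (h'.wd_x a b hab) (hi h _ _ hab.le) (hi h' _ _ hab.le)
      (hi h _ _ (by omega)) (hi h' _ _ (by omega)),
    fun a b hab => (h.wd_y a b hab).sub (h'.wd_y a b hab) (hi h _ _ hab.le) (hi h' _ _ hab.le)
      (hi h _ _ (by omega)) (hi h' _ _ (by omega))⟩

/-! ### Convolution and Young's inequality -/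

lemma eLpNorm_two_sq {α : Type*} [MeasurableSpace α] {μ : Measure α} (f : α → ℝ) :
    eLpNorm f 2 μ ^ 2 = ∫⁻ x, ‖f x‖ₑ ^ 2 ∂μ := by
  rw [eLpNorm_eq_lintegral_rpow_enorm_toReal (by norm_num) (by norm_num)]
  rw [← ENNReal.rpow_natCast, ← ENNReal.rpow_mul]
  simp

/-- Cauchy–Schwarz for the factors `K ^ (1/2)` and `K ^ (1/2) * h`. -/
lemma sq_lintegral_mul_le {α : Type*} [MeasurableSpace α] {μ : Measure α} {K h : α → ℝ≥0∞}
    (hK : AEMeasurable K μ) (hh : AEMeasurable h μ) :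
    (∫⁻ x, K x * h x ∂μ) ^ 2 ≤ (∫⁻ x, K x ∂μ) * ∫⁻ x, K x * h x ^ 2 ∂μ := by
  have hs : ∀ y : ℝ≥0∞, (y ^ (1 / 2 : ℝ)) ^ (2 : ℝ) = y := fun y => by
    rw [← ENNReal.rpow_mul]; norm_num
  have hss : ∀ y : ℝ≥0∞, y ^ (1 / 2 : ℝ) * y ^ (1 / 2 : ℝ) = y := fun y => by
    rw [← sq, ← ENNReal.rpow_natCast]
    exact_mod_cast hs y
  have h1 := ENNReal.lintegral_mul_le_Lp_mul_Lq μ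
    (p := 2) (q := 2) ⟨by norm_num, by norm_num, by norm_num⟩
    (f := fun x => K x ^ (1 / 2 : ℝ)) (g := fun x => K x ^ (1 / 2 : ℝ) * h x)
    (hK.pow_const _) ((hK.pow_const _).mul hh)
  simp only [Pi.mul_apply, ENNReal.mul_rpow_of_nonneg _ _ (by norm_num : (0 : ℝ) ≤ 2), hs,
    ← mul_assoc, hss, ENNReal.rpow_two] at h1
  calc (∫⁻ x, K x * h x ∂μ) ^ 2
      ≤ ((∫⁻ x, K x ∂μ) ^ (1 / 2 : ℝ) * (∫⁻ x, K x * h x ^ 2 ∂μ) ^ (1 / 2 : ℝ)) ^ 2 := by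
        gcongr
    _ = _ := by
        rw [mul_pow, ← ENNReal.rpow_natCast, ← ENNReal.rpow_natCast]
        rw [show ((2 : ℕ) : ℝ) = 2 by norm_num, hs, hs]

/-- Cauchy–Schwarz with weight `k`, followed by Tonelli. The function `F` is only required to be
dominated by a convolution, so that the estimate also covers the commutator with the coefficient,
which is not itself a convolution. -/
lemma eLpNorm_le_of_young {k u F : ℝ × ℝ → ℝ} {S : Set (ℝ × ℝ)} {A : ℝ≥0∞}
    (hk : Measurable k) (hu : AEStronglyMeasurable u volume) (hA : ∫⁻ q, ‖k q‖ₑ ≤ A)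
    (hF : ∀ᵐ p ∂(volume.restrict S), ‖F p‖ₑ ≤ ∫⁻ q, ‖k (p - q)‖ₑ * ‖u q‖ₑ) :
    eLpNorm F 2 (volume.restrict S) ≤ A * eLpNorm u 2 volume := by
  have hk' : ∀ p : ℝ × ℝ, ∫⁻ q, ‖k (p - q)‖ₑ ≤ A := fun p =>
    (lintegral_sub_left_eq_self (fun q => ‖k q‖ₑ) p).le.trans hA
  have hkm : Measurable fun z : (ℝ × ℝ) × (ℝ × ℝ) => ‖k (z.1 - z.2)‖ₑ :=
    (hk.comp (measurable_fst.sub measurable_snd)).enorm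
  have h1 : eLpNorm F 2 (volume.restrict S) ^ 2 ≤ (A * eLpNorm u 2 volume) ^ 2 := by
    rw [mul_pow, eLpNorm_two_sq, eLpNorm_two_sq]
    calc ∫⁻ p in S, ‖F p‖ₑ ^ 2
        ≤ ∫⁻ p in S, A * ∫⁻ q, ‖k (p - q)‖ₑ * ‖u q‖ₑ ^ 2 := by
          refine lintegral_mono_ae ?_
          filter_upwards [hF] with p hp
          calc ‖F p‖ₑ ^ 2 ≤ (∫⁻ q, ‖k (p - q)‖ₑ * ‖u q‖ₑ) ^ 2 := by gcongr
            _ ≤ _ := sq_lintegral_mul_le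
                (hkm.comp (measurable_const.prodMk measurable_id)).aemeasurable hu.enorm
            _ ≤ _ := by gcongr; exact hk' p
      _ ≤ ∫⁻ p, A * ∫⁻ q, ‖k (p - q)‖ₑ * ‖u q‖ₑ ^ 2 := setLIntegral_le_lintegral _ _
      _ = A * ∫⁻ p, ∫⁻ q, ‖k (p - q)‖ₑ * ‖u q‖ₑ ^ 2 := by
          refine lintegral_const_mul'' _ ?_
          exact AEMeasurable.lintegral_prod_right'
            (hkm.aemeasurable.mul ((hu.enorm.pow_const 2).comp_snd (μ := volume)))
      _ = A * ∫⁻ q, ∫⁻ p, ‖k (p - q)‖ₑ * ‖u q‖ₑ ^ 2 := by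
          rw [lintegral_lintegral_swap]
          exact hkm.aemeasurable.mul ((hu.enorm.pow_const 2).comp_snd (μ := volume))
      _ ≤ A * ∫⁻ q, A * ‖u q‖ₑ ^ 2 := by
          gcongr with q
          rw [lintegral_mul_const _ (show Measurable fun p : ℝ × ℝ => ‖k (p - q)‖ₑ from
            hkm.comp (measurable_id.prodMk measurable_const))]
          gcongr
          exact (lintegral_sub_right_eq_self (fun q => ‖k q‖ₑ) q).le.trans hA
      _ = _ := by
          rw [lintegral_const_mul'' _ (hu.enorm.pow_const 2), sq, mul_assoc]
  exact (ENNReal.pow_le_pow_left_iff (two_ne_zero)).1 h1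

/-- The convolution of `u` and `k`. -/
noncomputable def cv (u k : ℝ × ℝ → ℝ) : ℝ × ℝ → ℝ := fun p => ∫ q, u q * k (p - q)

lemma cv_eq_convolution (u k : ℝ × ℝ → ℝ) :
    cv u k = convolution u k (ContinuousLinearMap.mul ℝ ℝ) volume := by
  funext p
  simp [cv, convolution]

lemma contDiff_cv {u k : ℝ × ℝ → ℝ} (hu : LocallyIntegrable u) (hk : TestOn univ k) :
    ContDiff ℝ ∞ (cv u k) := by
  rw [cv_eq_convolution]
  exact hk.2.1.contDiff_convolution_right _ hu hk.1

lemma integrable_cv {u k : ℝ × ℝ → ℝ} (hu : LocallyIntegrable u) (hk : TestOn univ k)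
    (p : ℝ × ℝ) : Integrable fun q => u q * k (p - q) :=
  hk.2.1.convolutionExists_right (ContinuousLinearMap.mul ℝ ℝ) hu hk.continuous p

lemma dd_cv {u k : ℝ × ℝ → ℝ} (hu : LocallyIntegrable u) (hk : TestOn univ k) (e : ℝ × ℝ) :
    dd e (cv u k) = cv u (dd e k) := by
  funext p
  rw [cv_eq_convolution, cv_eq_convolution, dd,
    (hk.2.1.hasFDerivAt_convolution_right (ContinuousLinearMap.mul ℝ ℝ) hu
      (hk.1.of_le (by simp)) p).fderiv]
  exact convolution_precompR_apply _ hu (hk.2.1.fderiv ℝ)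
    (hk.1.continuous_fderiv (by simp)) p e

lemma cv_sub {u v k : ℝ × ℝ → ℝ} (hu : LocallyIntegrable u) (hv : LocallyIntegrable v)
    (hk : TestOn univ k) (p : ℝ × ℝ) : cv (fun q => u q - v q) k p = cv u k p - cv v k p := by
  simp only [cv, sub_mul]
  exact integral_sub (integrable_cv hu hk p) (integrable_cv hv hk p)

lemma enorm_cv_le (u k : ℝ × ℝ → ℝ) (p : ℝ × ℝ) :
    ‖cv u k p‖ₑ ≤ ∫⁻ q, ‖k (p - q)‖ₑ * ‖u q‖ₑ := by
  refine (enorm_integral_le_lintegral_enorm _).trans_eq ?_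
  simp [enorm_mul, mul_comm]

/-! ### The one-sided mollifier -/

/-- A bump function supported in `[1, 3]²`. -/
noncomputable def bump : ContDiffBump ((2, 2) : ℝ × ℝ) := ⟨1 / 2, 1, by norm_num, by norm_num⟩

/-- A smooth probability density supported in `[1, 3]²`. -/
noncomputable def rho : ℝ × ℝ → ℝ := bump.normed volume

/-- The mollifier at scale `ε`, supported in `[ε, 3ε]²`. -/
noncomputable def ker (ε : ℝ) : ℝ × ℝ → ℝ := fun p => (ε⁻¹) ^ 2 * rho (ε⁻¹ • p)

lemma rho_testOn : TestOn univ rho :=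
  ⟨bump.contDiff_normed, bump.hasCompactSupport_normed, subset_univ _⟩

lemma rho_nonneg (p : ℝ × ℝ) : 0 ≤ rho p := bump.nonneg_normed p

lemma integral_rho : ∫ p, rho p = 1 := bump.integral_normed

lemma ker_contDiff (ε : ℝ) : ContDiff ℝ ∞ (ker ε) :=
  contDiff_const.mul (rho_testOn.1.comp (contDiff_const_smul _))

lemma ker_nonneg (ε : ℝ) (p : ℝ × ℝ) : 0 ≤ ker ε p :=
  mul_nonneg (sq_nonneg _) (rho_nonneg _)

lemma rho_support {p : ℝ × ℝ} (hp : rho p ≠ 0) : p ∈ Icc (1 : ℝ) 3 ×ˢ Icc (1 : ℝ) 3 := by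
  have h : p ∈ Metric.ball ((2, 2) : ℝ × ℝ) 1 := by
    have : p ∈ Function.support (bump.normed volume) := hp
    rwa [ContDiffBump.support_normed_eq] at this
  rw [Metric.mem_ball, Prod.dist_eq, max_lt_iff, Real.dist_eq, Real.dist_eq, abs_lt, abs_lt] at h
  exact ⟨⟨by linarith [h.1.1], by linarith [h.1.2]⟩, ⟨by linarith [h.2.1], by linarith [h.2.2]⟩⟩

lemma ker_tsupport {ε : ℝ} (hε : 0 < ε) :
    tsupport (ker ε) ⊆ Icc ε (3 * ε) ×ˢ Icc ε (3 * ε) := by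
  refine closure_minimal ?_ (isClosed_Icc.prod isClosed_Icc)
  intro p hp
  have h1 : rho (ε⁻¹ • p) ≠ 0 := fun h => hp (by simp [ker, h])
  have h2 := rho_support h1
  simp only [mem_prod, Prod.smul_fst, Prod.smul_snd, smul_eq_mul, mem_Icc] at h2 ⊢
  rw [inv_mul_eq_div, inv_mul_eq_div, le_div_iff₀ hε, div_le_iff₀ hε, le_div_iff₀ hε,
    div_le_iff₀ hε, one_mul] at h2
  exact h2

lemma ker_testOn {ε : ℝ} (hε : 0 < ε) : TestOn univ (ker ε) :=
  ⟨ker_contDiff ε, HasCompactSupport.of_support_subset_isCompact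
    (isCompact_Icc.prod isCompact_Icc) ((subset_tsupport _).trans (ker_tsupport hε)),
    subset_univ _⟩

lemma integral_scaled {ε : ℝ} (hε : 0 < ε) (f : ℝ × ℝ → ℝ) :
    ∫ p : ℝ × ℝ, (ε⁻¹) ^ 2 * f (ε⁻¹ • p) = ∫ p, f p := by
  rw [integral_const_mul, Measure.integral_comp_smul]
  simp only [Module.finrank_prod, Module.finrank_self, smul_eq_mul]
  rw [← mul_assoc, abs_of_nonneg (by positivity)]
  have : ε⁻¹ ^ 2 * (ε⁻¹ ^ (1 + 1))⁻¹ = 1 := mul_inv_cancel₀ (by positivity)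
  rw [this, one_mul]

lemma integral_ker {ε : ℝ} (hε : 0 < ε) : ∫ p, ker ε p = 1 :=
  (integral_scaled hε rho).trans integral_rho

lemma dd_ker {ε : ℝ} (e p : ℝ × ℝ) :
    dd e (ker ε) p = (ε⁻¹) ^ 2 * (ε⁻¹ * dd e rho (ε⁻¹ • p)) := by
  have h1 : HasFDerivAt (ker ε)
      ((ε⁻¹) ^ 2 • (fderiv ℝ rho (ε⁻¹ • p)).comp (ε⁻¹ • ContinuousLinearMap.id ℝ (ℝ × ℝ))) p :=
    ((differentiable_of_smooth rho_testOn.1 (ε⁻¹ • p)).hasFDerivAt.comp p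
      ((hasFDerivAt_id p).const_smul ε⁻¹)).const_mul _
  rw [dd, h1.fderiv]
  simp [dd]

lemma lintegral_enorm_eq {f : ℝ × ℝ → ℝ} (hf : Integrable f) :
    ∫⁻ p, ‖f p‖ₑ = ENNReal.ofReal (∫ p, |f p|) := by
  rw [ofReal_integral_eq_lintegral_ofReal hf.abs (Eventually.of_forall fun _ => abs_nonneg _)]
  refine lintegral_congr fun p => ?_
  rw [Real.enorm_eq_ofReal_abs]

lemma TestOn.integrable {U : Set (ℝ × ℝ)} {φ : ℝ × ℝ → ℝ} (h : TestOn U φ) : Integrable φ :=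
  h.continuous.integrable_of_hasCompactSupport h.2.1

lemma lintegral_ker {ε : ℝ} (hε : 0 < ε) : ∫⁻ p, ‖ker ε p‖ₑ = 1 := by
  rw [lintegral_enorm_eq (ker_testOn hε).integrable]
  simp_rw [abs_of_nonneg (ker_nonneg ε _)]
  rw [integral_ker hε, ENNReal.ofReal_one]

/-- One derivative of the kernel costs exactly one factor `ε⁻¹`. In the Friedrichs lemma the
oscillation of a Lipschitz coefficient over the support of the kernel pays for it. -/
lemma lintegral_dd_ker {ε : ℝ} (hε : 0 < ε) (e : ℝ × ℝ) :
    ∫⁻ p, ‖dd e (ker ε) p‖ₑ = ENNReal.ofReal (ε⁻¹ * ∫ p, |dd e rho p|) := by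
  rw [lintegral_enorm_eq ((ker_testOn hε).dd e).integrable]
  congr 1
  rw [← integral_const_mul, ← integral_scaled hε (fun p => ε⁻¹ * |dd e rho p|)]
  refine integral_congr_ae (Eventually.of_forall fun p => ?_)
  simp only [dd_ker]
  rw [abs_mul, abs_mul, abs_of_nonneg (by positivity), abs_of_nonneg (by positivity : 0 ≤ ε⁻¹)]

lemma eLpNorm_cv_ker_le {ε : ℝ} (hε : 0 < ε) {u : ℝ × ℝ → ℝ}
    (hu : AEStronglyMeasurable u volume) :
    eLpNorm (cv u (ker ε)) 2 volume ≤ eLpNorm u 2 volume := by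
  have := eLpNorm_le_of_young (S := univ) (A := 1) (ker_contDiff ε).continuous.measurable hu
    (lintegral_ker hε).le (Eventually.of_forall fun p => enorm_cv_le u (ker ε) p)
  simpa using this

lemma integral_ker_sub {ε : ℝ} (hε : 0 < ε) (p : ℝ × ℝ) : ∫ q, ker ε (p - q) = 1 := by
  rw [integral_sub_left_eq_self (fun q => ker ε q) volume p, integral_ker hε]

lemma dist_le_of_ker_ne_zero {ε : ℝ} (hε : 0 < ε) {p q : ℝ × ℝ} (h : p - q ∈ tsupport (ker ε)) :
    dist p q ≤ 3 * ε := by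
  have h1 := ker_tsupport hε h
  simp only [mem_prod, Prod.fst_sub, Prod.snd_sub, mem_Icc] at h1
  rw [Prod.dist_eq, max_le_iff, Real.dist_eq, Real.dist_eq, abs_le, abs_le]
  exact ⟨⟨by linarith [h1.1.1], h1.1.2⟩, ⟨by linarith [h1.2.1], h1.2.2⟩⟩

/-- The kernel is a probability density, so the mollified value is an average over points within
distance `3 * ε`. Besides uniform convergence, the case `η = 0` bounds the support of the
mollification. -/
lemma abs_cv_ker_sub_le {ε η : ℝ} (hε : 0 < ε) {g : ℝ × ℝ → ℝ} (hg : LocallyIntegrable g)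
    {p : ℝ × ℝ} (h : ∀ q, dist p q ≤ 3 * ε → |g q - g p| ≤ η) : |cv g (ker ε) p - g p| ≤ η := by
  have hk : Integrable fun q => ker ε (p - q) :=
    (ker_testOn hε).integrable.comp_sub_left p
  have h1 : cv g (ker ε) p - g p = ∫ q, (g q - g p) * ker ε (p - q) := by
    simp only [sub_mul]
    rw [integral_sub (integrable_cv hg (ker_testOn hε) p) (hk.const_mul _), integral_const_mul,
      integral_ker_sub hε, mul_one]
    rfl
  rw [h1, ← Real.norm_eq_abs]
  calc ‖∫ q, (g q - g p) * ker ε (p - q)‖ ≤ ∫ q, η * ker ε (p - q) := by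
        refine norm_integral_le_of_norm_le (hk.const_mul _) (Eventually.of_forall fun q => ?_)
        rw [norm_mul, Real.norm_eq_abs, Real.norm_eq_abs, abs_of_nonneg (ker_nonneg ε _)]
        by_cases h0 : ker ε (p - q) = 0
        · simp [h0]
        · exact mul_le_mul_of_nonneg_right
            (h q (dist_le_of_ker_ne_zero hε (subset_tsupport _ h0))) (ker_nonneg ε _)
    _ = η := by rw [integral_const_mul, integral_ker_sub hε, mul_one]

lemma tendsto_cv_ker_of_continuous {g : ℝ × ℝ → ℝ} (hg : Continuous g)
    (hc : HasCompactSupport g) :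
    Tendsto (fun ε => eLpNorm (fun p => cv g (ker ε) p - g p) 2 volume) (𝓝[>] 0) (𝓝 0) := by
  obtain ⟨R, hR⟩ := hc.isCompact.isBounded.subset_closedBall (0 : ℝ × ℝ)
  have hz : ∀ p, p ∉ Metric.closedBall (0 : ℝ × ℝ) R → g p = 0 := fun p hp =>
    image_eq_zero_of_notMem_tsupport fun h => hp (hR h)
  -- For `ε < 1` mollification enlarges the support by at most `3 * ε < 3`, so the error lives in a
  -- ball independent of `ε` and uniform convergence gives convergence in `L²`.
  set B := Metric.closedBall (0 : ℝ × ℝ) (R + 3) with hB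
  have hBfin : volume B ≠ ⊤ := (isCompact_closedBall _ _).measure_lt_top.ne
  rw [ENNReal.tendsto_nhds_zero]
  intro η hη
  obtain ⟨η', hη'0, hη'⟩ : ∃ η' : ℝ, 0 < η' ∧
      volume B ^ (1 / 2 : ℝ) * ENNReal.ofReal η' ≤ η := by
    have ht : Tendsto (fun t : ℝ => volume B ^ (1 / 2 : ℝ) * ENNReal.ofReal t) (𝓝[>] 0) (𝓝 0) := by
      have := (ENNReal.tendsto_ofReal (tendsto_id (α := ℝ) (x := 𝓝 0))).mono_left
        (nhdsWithin_le_nhds (s := Ioi 0))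
      simpa using ENNReal.Tendsto.const_mul this
        (Or.inr (ENNReal.rpow_ne_top_of_nonneg (by norm_num) hBfin))
    have h2 := (ENNReal.tendsto_nhds_zero.1 ht η hη).and self_mem_nhdsWithin
    obtain ⟨t, ht1, ht2⟩ := h2.exists
    exact ⟨t, ht2, ht1⟩
  obtain ⟨δ, hδ, hu⟩ := Metric.uniformContinuous_iff.1 (hc.uniformContinuous_of_continuous hg) η' hη'0
  have hev : ∀ᶠ ε in 𝓝[>] (0 : ℝ), 0 < ε ∧ ε < 1 ∧ 3 * ε < δ := by
    filter_upwards [Ioo_mem_nhdsGT (show (0 : ℝ) < min 1 (δ / 3) by positivity)] with ε hε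
    have := hε.2
    rw [lt_min_iff] at this
    exact ⟨hε.1, this.1, by linarith [this.2]⟩
  filter_upwards [hev] with ε hε
  have hb : ∀ p, |cv g (ker ε) p - g p| ≤ η' := fun p =>
    abs_cv_ker_sub_le hε.1 hg.locallyIntegrable fun q hq => by
      have := hu (show dist q p < δ by rw [dist_comm]; linarith [hε.2.2])
      exact this.le
  have hs : Function.support (fun p => cv g (ker ε) p - g p) ⊆ B := by
    intro p hp
    by_contra hpB
    have h1 : R + 3 < dist p 0 := by simpa [hB] using hpB
    refine hp ?_
    have h2 : |cv g (ker ε) p - g p| ≤ 0 :=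
      abs_cv_ker_sub_le hε.1 hg.locallyIntegrable fun q hq => by
        have h3 := dist_triangle p q 0
        rw [hz q, hz p, sub_zero, abs_zero]
        · simp only [Metric.mem_closedBall, not_le]; linarith
        · simp only [Metric.mem_closedBall, not_le]; linarith [hε.2.1]
    exact abs_nonpos_iff.1 h2
  rw [← eLpNorm_restrict_eq_of_support_subset hs]
  refine (eLpNorm_le_of_ae_bound (C := η') (Eventually.of_forall hb)).trans ?_
  refine le_trans (le_of_eq ?_) hη'
  simp

/-- Mollification converges in `L²`. -/
lemma tendsto_cv_ker {u : ℝ × ℝ → ℝ} (hu : MemLp u 2 volume) :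
    Tendsto (fun ε => eLpNorm (fun p => cv u (ker ε) p - u p) 2 volume) (𝓝[>] 0) (𝓝 0) := by
  have hul : ∀ {w : ℝ × ℝ → ℝ}, MemLp w 2 volume → LocallyIntegrable w := fun hw =>
    hw.locallyIntegrable (by norm_num)
  rw [ENNReal.tendsto_nhds_zero]
  intro η hη
  have hη3 : η / 3 ≠ 0 := by simp [hη.ne']
  obtain ⟨g, hgc, hgu, hg, hgm⟩ := hu.exists_hasCompactSupport_eLpNorm_sub_le (by norm_num) hη3
  filter_upwards [ENNReal.tendsto_nhds_zero.1 (tendsto_cv_ker_of_continuous hg hgc) (η / 3)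
    (pos_iff_ne_zero.2 hη3), self_mem_nhdsWithin] with ε h1 hε
  have hε : 0 < ε := hε
  have hm : ∀ {w : ℝ × ℝ → ℝ}, MemLp w 2 volume → AEStronglyMeasurable (cv w (ker ε)) volume :=
    fun hw => (contDiff_cv (hul hw) (ker_testOn hε)).continuous.aestronglyMeasurable
  have e1 : (fun p => cv u (ker ε) p - u p) = (cv (fun q => u q - g q) (ker ε)) +
      ((fun p => cv g (ker ε) p - g p) - (u - g)) := by
    funext p
    simp only [Pi.add_apply, Pi.sub_apply]
    rw [cv_sub (hul hu) (hul hgm) (ker_testOn hε)]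
    ring
  have hug : MemLp (fun q => u q - g q) 2 volume := hu.sub hgm
  have m1 := hm hug
  have m2 : AEStronglyMeasurable (fun p => cv g (ker ε) p - g p) volume := (hm hgm).sub hgm.1
  have m3 : AEStronglyMeasurable (u - g) volume := hu.1.sub hgm.1
  rw [e1]
  calc _ ≤ eLpNorm (cv (fun q => u q - g q) (ker ε)) 2 volume +
        (eLpNorm (fun p => cv g (ker ε) p - g p) 2 volume + eLpNorm (u - g) 2 volume) := by
        refine (eLpNorm_add_le m1 (m2.sub m3) (by norm_num)).trans ?_
        gcongr
        exact eLpNorm_sub_le m2 m3 (by norm_num)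
    _ ≤ η / 3 + (η / 3 + η / 3) := by
        gcongr
        exact (eLpNorm_cv_ker_le hε hug.1).trans hgu
    _ = η := by rw [← add_assoc, ENNReal.add_thirds]

/-! ### Mollification of functions on the rectangle -/

/-- The extension by zero of a function on the rectangle. -/
noncomputable def ext (L₁ L₂ : ℝ) (u : ℝ × ℝ → ℝ) : ℝ × ℝ → ℝ := (rect L₁ L₂).indicator u

/-- The mollification of the extension by zero. -/
noncomputable def moll (L₁ L₂ ε : ℝ) (u : ℝ × ℝ → ℝ) : ℝ × ℝ → ℝ := cv (ext L₁ L₂ u) (ker ε)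

lemma memLp_ext {L₁ L₂ : ℝ} {u : ℝ × ℝ → ℝ} (hu : MemLp u 2 (volume.restrict (rect L₁ L₂))) :
    MemLp (ext L₁ L₂ u) 2 volume :=
  (memLp_indicator_iff_restrict (measurableSet_rect L₁ L₂)).2 hu

lemma locallyIntegrable_ext {L₁ L₂ : ℝ} {u : ℝ × ℝ → ℝ}
    (hu : MemLp u 2 (volume.restrict (rect L₁ L₂))) : LocallyIntegrable (ext L₁ L₂ u) :=
  (memLp_ext hu).locallyIntegrable (by norm_num)

lemma cv_ext (L₁ L₂ : ℝ) (u k : ℝ × ℝ → ℝ) (p : ℝ × ℝ) :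
    cv (ext L₁ L₂ u) k p = ∫ q in rect L₁ L₂, u q * k (p - q) := by
  rw [cv, ← integral_indicator (measurableSet_rect L₁ L₂)]
  refine integral_congr_ae (Eventually.of_forall fun q => ?_)
  by_cases hq : q ∈ rect L₁ L₂ <;> simp [ext, hq]

lemma contDiff_moll {L₁ L₂ ε : ℝ} (hε : 0 < ε) {u : ℝ × ℝ → ℝ}
    (hu : MemLp u 2 (volume.restrict (rect L₁ L₂))) : ContDiff ℝ ∞ (moll L₁ L₂ ε u) :=
  contDiff_cv (locallyIntegrable_ext hu) (ker_testOn hε)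

lemma tendsto_moll {L₁ L₂ : ℝ} {u : ℝ × ℝ → ℝ} (hu : MemLp u 2 (volume.restrict (rect L₁ L₂))) :
    Tendsto (fun ε => eLpNorm (fun p => moll L₁ L₂ ε u p - u p) 2 (volume.restrict (rect L₁ L₂)))
      (𝓝[>] 0) (𝓝 0) := by
  refine tendsto_of_tendsto_of_tendsto_of_le_of_le tendsto_const_nhds
    (tendsto_cv_ker (memLp_ext hu)) (fun _ => zero_le) fun ε => ?_
  refine le_trans (le_of_eq (eLpNorm_congr_ae ?_))
    (eLpNorm_mono_measure (fun p => moll L₁ L₂ ε u p - ext L₁ L₂ u p)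
      (Measure.restrict_le_self (s := rect L₁ L₂)))
  filter_upwards [ae_restrict_mem (measurableSet_rect L₁ L₂)] with p hp
  rw [ext, indicator_of_mem hp]

/-- If `p - q` lies in `[ε, 3ε]²`, then `q` has a nonpositive coordinate and is outside the
rectangle. This is the purpose of centring the bump away from the origin. -/
lemma moll_eq_zero {L₁ L₂ ε : ℝ} (hε : 0 < ε) (u : ℝ × ℝ → ℝ) {p : ℝ × ℝ}
    (hp : p.1 ≤ ε ∨ p.2 ≤ ε) : moll L₁ L₂ ε u p = 0 := by
  rw [moll, cv_ext]
  refine setIntegral_eq_zero_of_forall_eq_zero fun q hq => ?_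
  rw [image_eq_zero_of_notMem_tsupport (f := ker ε), mul_zero]
  intro h
  have h1 := ker_tsupport hε h
  have h2 := hq.1.1
  have h3 := hq.2.1
  simp only [mem_prod, Prod.fst_sub, Prod.snd_sub, mem_Icc] at h1
  rcases hp with hp | hp
  · linarith [h1.1.1]
  · linarith [h1.2.1]

lemma contDiff_const_sub_comp {k : ℝ × ℝ → ℝ} (hk : ContDiff ℝ ∞ k) (p : ℝ × ℝ) :
    ContDiff ℝ ∞ fun q => k (p - q) := hk.comp (contDiff_const.sub contDiff_id)

lemma dd_const_sub_comp {k : ℝ × ℝ → ℝ} (hk : ContDiff ℝ ∞ k) (p e q : ℝ × ℝ) :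
    dd e (fun q => k (p - q)) q = -dd e k (p - q) := by
  have h1 : HasFDerivAt (fun q => k (p - q))
      ((fderiv ℝ k (p - q)).comp (-ContinuousLinearMap.id ℝ (ℝ × ℝ))) q :=
    (differentiable_of_smooth hk (p - q)).hasFDerivAt.comp q ((hasFDerivAt_id q).const_sub p)
  rw [dd, h1.fderiv]
  simp [dd]

/-- The region that contains the reflected supports of the mollifier at points of the rectangle. -/
def lowerLeft (L₁ L₂ : ℝ) : Set (ℝ × ℝ) := Iio L₁ ×ˢ Iio L₂

lemma testOn_ker_sub {ε : ℝ} (hε : 0 < ε) {U : Set (ℝ × ℝ)} {p : ℝ × ℝ}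
    (h : Icc (p.1 - 3 * ε) (p.1 - ε) ×ˢ Icc (p.2 - 3 * ε) (p.2 - ε) ⊆ U) :
    TestOn U fun q => ker ε (p - q) := by
  have h1 : tsupport (fun q => ker ε (p - q)) ⊆
      Icc (p.1 - 3 * ε) (p.1 - ε) ×ˢ Icc (p.2 - 3 * ε) (p.2 - ε) := by
    refine closure_minimal ?_ (isClosed_Icc.prod isClosed_Icc)
    intro q hq
    have h2 := ker_tsupport hε (subset_tsupport _ hq)
    simp only [mem_prod, Prod.fst_sub, Prod.snd_sub, mem_Icc] at h2 ⊢
    exact ⟨⟨by linarith [h2.1.2], by linarith [h2.1.1]⟩,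
      ⟨by linarith [h2.2.2], by linarith [h2.2.1]⟩⟩
  exact ⟨contDiff_const_sub_comp (ker_contDiff ε) p,
    HasCompactSupport.of_support_subset_isCompact (isCompact_Icc.prod isCompact_Icc)
      ((subset_tsupport _).trans h1), h1.trans h⟩

/-- The reflected kernel lives strictly to the lower left of `p`, hence away from the lines `x = L₁`
and `y = L₂`. It may however cross `Γ`, so equations in `Ω` can be tested with it only after
`wd_extend`. -/
lemma testOn_ker_sub_lowerLeft {L₁ L₂ ε : ℝ} (hε : 0 < ε) {p : ℝ × ℝ} (hp : p ∈ rect L₁ L₂) :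
    TestOn (lowerLeft L₁ L₂) fun q => ker ε (p - q) :=
  testOn_ker_sub hε fun q hq => by
    have h1 := hp.1.2
    have h2 := hp.2.2
    have h3 := hq.1.2
    have h4 := hq.2.2
    exact ⟨show q.1 < L₁ by linarith, show q.2 < L₂ by linarith⟩

lemma testOn_ker_sub_rect {L₁ L₂ ε : ℝ} (hε : 0 < ε) {p : ℝ × ℝ} (hp : p ∈ rect L₁ L₂)
    (h1 : 3 * ε < p.1) (h2 : 3 * ε < p.2) : TestOn (rect L₁ L₂) fun q => ker ε (p - q) :=
  testOn_ker_sub hε fun q hq => by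
    have h3 := hp.1.2
    have h4 := hp.2.2
    obtain ⟨⟨h5, h6⟩, h7, h8⟩ := hq
    exact ⟨⟨by linarith, by linarith⟩, ⟨by linarith, by linarith⟩⟩

/-- Where the reflected mollifier is an admissible test function, mollification commutes with the
weak derivative. -/
lemma dd_moll_eq {L₁ L₂ ε : ℝ} (hε : 0 < ε) {U : Set (ℝ × ℝ)} {e : ℝ × ℝ} {u g : ℝ × ℝ → ℝ}
    (hu : MemLp u 2 (volume.restrict (rect L₁ L₂)))
    (h : ∀ φ, TestOn U φ →
      ∫ p in rect L₁ L₂, u p * dd e φ p = -∫ p in rect L₁ L₂, g p * φ p)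
    {p : ℝ × ℝ} (hp : TestOn U fun q => ker ε (p - q)) :
    dd e (moll L₁ L₂ ε u) p = moll L₁ L₂ ε g p := by
  rw [moll, dd_cv (locallyIntegrable_ext hu) (ker_testOn hε), moll, cv_ext, cv_ext]
  have h1 := h _ hp
  simp only [dd_const_sub_comp (ker_contDiff ε), mul_neg] at h1
  rw [integral_neg, neg_inj] at h1
  exact h1

lemma WD.dd_moll {L₁ L₂ ε : ℝ} (hε : 0 < ε) {e : ℝ × ℝ} {u g : ℝ × ℝ → ℝ}
    (h : WD L₁ L₂ e u g) (hu : MemLp u 2 (volume.restrict (rect L₁ L₂))) {p : ℝ × ℝ}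
    (hp : p ∈ rect L₁ L₂) (h1 : 3 * ε < p.1) (h2 : 3 * ε < p.2) :
    dd e (moll L₁ L₂ ε u) p = moll L₁ L₂ ε g p :=
  dd_moll_eq hε hu h (testOn_ker_sub_rect hε hp h1 h2)

/-! ### Products of weakly differentiable functions -/

lemma eLpNorm_one_mul_le {μ : Measure (ℝ × ℝ)} {u v : ℝ × ℝ → ℝ} (hu : AEStronglyMeasurable u μ)
    (hv : AEStronglyMeasurable v μ) :
    ∫⁻ p, ‖u p * v p‖ₑ ∂μ ≤ eLpNorm u 2 μ * eLpNorm v 2 μ := by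
  have h : eLpNorm (u • v) 1 μ ≤ eLpNorm u 2 μ * eLpNorm v 2 μ :=
    eLpNorm_smul_le_mul_eLpNorm (p := 2) (q := 2) (r := 1) hv hu
  rw [eLpNorm_one_eq_lintegral_enorm] at h
  simpa only [Pi.smul_apply', smul_eq_mul] using h

lemma tendsto_integral_mul_of_L2 {μ : Measure (ℝ × ℝ)} {ι : Type*} {l : Filter ι}
    {U : ι → ℝ × ℝ → ℝ} {u h : ℝ × ℝ → ℝ} (hU : ∀ᶠ i in l, MemLp (U i) 2 μ) (hu : MemLp u 2 μ)
    (hh : MemLp h 2 μ) (hl : Tendsto (fun i => eLpNorm (fun p => U i p - u p) 2 μ) l (𝓝 0)) :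
    Tendsto (fun i => ∫ p, U i p * h p ∂μ) l (𝓝 (∫ p, u p * h p ∂μ)) := by
  refine tendsto_integral_of_L1 _ (integrable_mul_of_L2 hu hh).aestronglyMeasurable
    (hU.mono fun i hi => integrable_mul_of_L2 hi hh) ?_
  have h1 : Tendsto (fun i => eLpNorm (fun p => U i p - u p) 2 μ * eLpNorm h 2 μ) l (𝓝 0) := by
    simpa using ENNReal.Tendsto.mul_const hl (Or.inr hh.2.ne)
  refine tendsto_of_tendsto_of_tendsto_of_le_of_le' tendsto_const_nhds h1
    (Eventually.of_forall fun _ => zero_le) (hU.mono fun i hi => ?_)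
  refine le_trans (le_of_eq ?_) (eLpNorm_one_mul_le (hi.sub hu).1 hh.1)
  refine lintegral_congr fun p => ?_
  simp only [sub_mul]

/-- Only the distance to the left and bottom edges matters, because mollification looks to the lower
left. -/
lemma TestOn.exists_margin {L₁ L₂ : ℝ} {φ : ℝ × ℝ → ℝ} (h : TestOn (rect L₁ L₂) φ) :
    ∃ δ > 0, ∀ p, φ p ≠ 0 → p ∈ rect L₁ L₂ ∧ δ < p.1 ∧ δ < p.2 := by
  rcases (tsupport φ).eq_empty_or_nonempty with he | hne
  · refine ⟨1, one_pos, fun p hp => ?_⟩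
    have := subset_tsupport φ hp
    rw [he] at this
    exact this.elim
  · obtain ⟨q, hq, hmin⟩ := h.2.1.isCompact.exists_isMinOn hne
      (f := fun p : ℝ × ℝ => min p.1 p.2) (by fun_prop)
    have h0 : 0 < min q.1 q.2 := lt_min (h.2.2 hq).1.1 (h.2.2 hq).2.1
    refine ⟨min q.1 q.2 / 2, by positivity, fun p hp => ?_⟩
    have h1 : min q.1 q.2 ≤ min p.1 p.2 := hmin (subset_tsupport φ hp)
    have h2 := min_le_left p.1 p.2
    have h3 := min_le_right p.1 p.2
    exact ⟨h.2.2 (subset_tsupport φ hp), by linarith, by linarith⟩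

lemma eventually_three_mul_lt {δ : ℝ} (hδ : 0 < δ) :
    ∀ᶠ ε in 𝓝[>] (0 : ℝ), 0 < ε ∧ 3 * ε < δ := by
  filter_upwards [Ioo_mem_nhdsGT (show (0 : ℝ) < δ / 3 by positivity)] with ε hε
  exact ⟨hε.1, by linarith [hε.2]⟩

/-- On the support of a fixed test function the mollification stays clear of `Γ` for small `ε`, so
no traces are involved. This is how one weakly differentiable factor is replaced by smooth ones in
the product rules below. -/
lemma WD.eventually_dd_moll {L₁ L₂ : ℝ} {e : ℝ × ℝ} {f g φ : ℝ × ℝ → ℝ} (h : WD L₁ L₂ e f g)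
    (hf : MemLp f 2 (volume.restrict (rect L₁ L₂))) (hφ : TestOn (rect L₁ L₂) φ) :
    ∀ᶠ ε in 𝓝[>] (0 : ℝ), 0 < ε ∧
      ∀ p, dd e (moll L₁ L₂ ε f) p * φ p = moll L₁ L₂ ε g p * φ p := by
  obtain ⟨δ, hδ, hm⟩ := hφ.exists_margin
  filter_upwards [eventually_three_mul_lt hδ] with ε hε
  refine ⟨hε.1, fun p => ?_⟩
  by_cases hp : φ p = 0
  · simp [hp]
  · obtain ⟨h1, h2, h3⟩ := hm p hp
    rw [h.dd_moll hε.1 hf h1 (by linarith [hε.2]) (by linarith [hε.2])]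

lemma memLp_moll {L₁ L₂ ε : ℝ} (hε : 0 < ε) {f : ℝ × ℝ → ℝ}
    (hf : MemLp f 2 (volume.restrict (rect L₁ L₂))) :
    MemLp (moll L₁ L₂ ε f) 2 (volume.restrict (rect L₁ L₂)) :=
  memLp_of_continuous (contDiff_moll hε hf).continuous 2

lemma eventually_memLp_moll {L₁ L₂ : ℝ} {f : ℝ × ℝ → ℝ}
    (hf : MemLp f 2 (volume.restrict (rect L₁ L₂))) :
    ∀ᶠ ε in 𝓝[>] (0 : ℝ), MemLp (moll L₁ L₂ ε f) 2 (volume.restrict (rect L₁ L₂)) := by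
  filter_upwards [self_mem_nhdsWithin] with ε hε
  exact memLp_moll hε hf

lemma tendsto_integral_moll_mul {L₁ L₂ : ℝ} {f h : ℝ × ℝ → ℝ}
    (hf : MemLp f 2 (volume.restrict (rect L₁ L₂)))
    (hh : MemLp h 2 (volume.restrict (rect L₁ L₂))) :
    Tendsto (fun ε => ∫ p in rect L₁ L₂, moll L₁ L₂ ε f p * h p) (𝓝[>] 0)
      (𝓝 (∫ p in rect L₁ L₂, f p * h p)) :=
  tendsto_integral_mul_of_L2 (eventually_memLp_moll hf) hf hh (tendsto_moll hf)

/-- The weak derivative in the direction `e'` of `w` may be tested against the product of a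
weakly differentiable function and a test function. -/
lemma WD.mul {L₁ L₂ : ℝ} {e : ℝ × ℝ} {f g w k : ℝ × ℝ → ℝ} (hf : WD L₁ L₂ e f g)
    (hw : WD L₁ L₂ e w k) (hf2 : MemLp f 2 (volume.restrict (rect L₁ L₂)))
    (hg2 : MemLp g 2 (volume.restrict (rect L₁ L₂)))
    (hw2 : MemLp w 2 (volume.restrict (rect L₁ L₂)))
    (hk2 : MemLp k 2 (volume.restrict (rect L₁ L₂))) :
    WD L₁ L₂ e (fun p => f p * w p) (fun p => g p * w p + f p * k p) := by
  intro φ hφ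
  have t1 := tendsto_integral_moll_mul hf2 (hw2.mul_test (hφ.dd e))
  have t2 := tendsto_integral_moll_mul hg2 (hw2.mul_test hφ)
  have t3 := tendsto_integral_moll_mul hf2 (hk2.mul_test hφ)
  have heq : ∀ᶠ ε in 𝓝[>] (0 : ℝ),
      ((∫ p in rect L₁ L₂, moll L₁ L₂ ε f p * (w p * dd e φ p)) +
        ∫ p in rect L₁ L₂, moll L₁ L₂ ε g p * (w p * φ p)) =
      -∫ p in rect L₁ L₂, moll L₁ L₂ ε f p * (k p * φ p) := by
    filter_upwards [hf.eventually_dd_moll hf2 hφ] with ε hε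
    have hs := contDiff_moll hε.1 hf2
    -- With `f` mollified, its product with `φ` is itself a test function for the equation of `w`.
    have h1 := hw _ (hφ.smooth_mul hs)
    rw [← integral_add (integrable_mul_of_L2 (memLp_moll hε.1 hf2) (hw2.mul_test (hφ.dd e)))
      (integrable_mul_of_L2 (memLp_moll hε.1 hg2) (hw2.mul_test hφ))]
    refine Eq.trans (integral_congr_ae (Eventually.of_forall fun p => ?_))
      (h1.trans (congrArg Neg.neg (integral_congr_ae (Eventually.of_forall fun p => ?_))))
    · simp only []
      rw [dd_mul (differentiable_of_smooth hs p) (differentiable_of_smooth hφ.1 p), hε.2 p]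
      ring
    · simp only []
      ring
  have h2 := tendsto_nhds_unique ((t1.add t2).congr' heq) t3.neg
  have e1 : ∫ p in rect L₁ L₂, (g p * w p + f p * k p) * φ p =
      (∫ p in rect L₁ L₂, g p * (w p * φ p)) + ∫ p in rect L₁ L₂, f p * (k p * φ p) := by
    rw [← integral_add (integrable_mul_of_L2 hg2 (hw2.mul_test hφ))
      (integrable_mul_of_L2 hf2 (hk2.mul_test hφ))]
    refine integral_congr_ae (Eventually.of_forall fun p => ?_)
    simp only []
    ring
  beta_reduce
  rw [e1]
  simp only [mul_assoc]
  linarith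

/-- Weak derivatives in two directions commute when tested against the product of a weakly
differentiable function and a test function. -/
lemma WD.cross {L₁ L₂ : ℝ} {e e' : ℝ × ℝ} {f g g' u k k' φ : ℝ × ℝ → ℝ} (hf : WD L₁ L₂ e f g)
    (hf' : WD L₁ L₂ e' f g') (hu : WD L₁ L₂ e u k) (hu' : WD L₁ L₂ e' u k')
    (hf2 : MemLp f 2 (volume.restrict (rect L₁ L₂)))
    (hg2 : MemLp g 2 (volume.restrict (rect L₁ L₂)))
    (hg2' : MemLp g' 2 (volume.restrict (rect L₁ L₂)))
    (hk2 : MemLp k 2 (volume.restrict (rect L₁ L₂)))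
    (hk2' : MemLp k' 2 (volume.restrict (rect L₁ L₂)))
    (hφ : TestOn (rect L₁ L₂) φ) :
    (∫ p in rect L₁ L₂, g' p * (k p * φ p)) + ∫ p in rect L₁ L₂, f p * (k p * dd e' φ p) =
      (∫ p in rect L₁ L₂, g p * (k' p * φ p)) + ∫ p in rect L₁ L₂, f p * (k' p * dd e φ p) := by
  have t1 := tendsto_integral_moll_mul hg2' (hk2.mul_test hφ)
  have t2 := tendsto_integral_moll_mul hf2 (hk2.mul_test (hφ.dd e'))
  have t3 := tendsto_integral_moll_mul hg2 (hk2'.mul_test hφ)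
  have t4 := tendsto_integral_moll_mul hf2 (hk2'.mul_test (hφ.dd e))
  refine tendsto_nhds_unique ((t1.add t2).congr' ?_) (t3.add t4)
  filter_upwards [hf.eventually_dd_moll hf2 hφ, hf'.eventually_dd_moll hf2 hφ] with ε hε hε'
  have hs := contDiff_moll hε.1 hf2
  have hψ := hφ.smooth_mul hs
  have aux : ∀ {d : ℝ × ℝ} {G K : ℝ × ℝ → ℝ}, MemLp G 2 (volume.restrict (rect L₁ L₂)) →
      MemLp K 2 (volume.restrict (rect L₁ L₂)) →
      (∀ p, dd d (moll L₁ L₂ ε f) p * φ p = moll L₁ L₂ ε G p * φ p) →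
      (∫ p in rect L₁ L₂, moll L₁ L₂ ε G p * (K p * φ p)) +
        ∫ p in rect L₁ L₂, moll L₁ L₂ ε f p * (K p * dd d φ p) =
      ∫ p in rect L₁ L₂, K p * dd d (fun q => moll L₁ L₂ ε f q * φ q) p := by
    intro d G K hG hK hd
    rw [← integral_add (integrable_mul_of_L2 (memLp_moll hε.1 hG) (hK.mul_test hφ))
      (integrable_mul_of_L2 (memLp_moll hε.1 hf2) (hK.mul_test (hφ.dd d)))]
    refine integral_congr_ae (Eventually.of_forall fun p => ?_)
    simp only []
    rw [dd_mul (differentiable_of_smooth hs p) (differentiable_of_smooth hφ.1 p), hd p]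
    ring
  rw [aux hg2' hk2 hε'.2, aux hg2 hk2' hε.2]
  have h1 := hu _ (hψ.dd e')
  have h2 := hu' _ (hψ.dd e)
  -- Both sides equal, up to the same sign, the integral of `u` against the second derivative of one
  -- test function, in the two orders of differentiation.
  rw [dd_comm hψ.1] at h1
  linarith

/-! ### The transport operator and its commutators with derivatives -/

/-- `∫ f φ = -∫ u (l φ + lam φ_x) - ∫ u φ_y` for all test functions `φ`. -/
def WT (L₁ L₂ : ℝ) (lam l u f : ℝ × ℝ → ℝ) : Prop :=
  ∀ φ, TestOn (rect L₁ L₂) φ →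
    ∫ p in rect L₁ L₂, f p * φ p =
      -(∫ p in rect L₁ L₂, u p * (l p * φ p + lam p * dd (1, 0) φ p))
        - ∫ p in rect L₁ L₂, u p * dd (0, 1) φ p

lemma _root_.MeasureTheory.MemLp.of_top {L₁ L₂ : ℝ} {f : ℝ × ℝ → ℝ} (hf : MemLp f ⊤ (volume.restrict (rect L₁ L₂))) :
    MemLp f 2 (volume.restrict (rect L₁ L₂)) := hf.mono_exponent le_top

lemma integral_transport_split {L₁ L₂ : ℝ} {lam l u φ : ℝ × ℝ → ℝ}
    (hlam : MemLp lam 2 (volume.restrict (rect L₁ L₂)))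
    (hl : MemLp l 2 (volume.restrict (rect L₁ L₂)))
    (hu : MemLp u 2 (volume.restrict (rect L₁ L₂))) (hφ : TestOn (rect L₁ L₂) φ) :
    ∫ p in rect L₁ L₂, u p * (l p * φ p + lam p * dd (1, 0) φ p) =
      (∫ p in rect L₁ L₂, l p * (u p * φ p)) + ∫ p in rect L₁ L₂, lam p * (u p * dd (1, 0) φ p) := by
  rw [← integral_add (integrable_mul_of_L2 hl (hu.mul_test hφ))
      (integrable_mul_of_L2 hlam (hu.mul_test (hφ.dd _)))]
  refine integral_congr_ae (Eventually.of_forall fun p => ?_)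
  simp only []
  ring

/-- This is the product rule for `lam * u`: when `u` has weak first derivatives, the distributional
transport is the pointwise expression. -/
lemma WT_of_wd {L₁ L₂ : ℝ} {lam l u ux uy : ℝ × ℝ → ℝ}
    (hlam : MemLp lam ⊤ (volume.restrict (rect L₁ L₂)))
    (hl : MemLp l ⊤ (volume.restrict (rect L₁ L₂))) (hlx : WD L₁ L₂ (1, 0) lam l)
    (hu : MemLp u 2 (volume.restrict (rect L₁ L₂)))
    (hux : MemLp ux 2 (volume.restrict (rect L₁ L₂)))
    (huy : MemLp uy 2 (volume.restrict (rect L₁ L₂))) (hx : WD L₁ L₂ (1, 0) u ux)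
    (hy : WD L₁ L₂ (0, 1) u uy) : WT L₁ L₂ lam l u (fun p => lam p * ux p + uy p) := by
  intro φ hφ
  have h1 := hlx.mul hx hlam.of_top hl.of_top hu hux φ hφ
  beta_reduce at h1 ⊢
  rw [integral_transport_split hlam.of_top hl.of_top hu hφ, hy φ hφ]
  have e1 : ∫ p in rect L₁ L₂, (lam p * ux p + uy p) * φ p =
      (∫ p in rect L₁ L₂, lam p * (ux p * φ p)) + ∫ p in rect L₁ L₂, uy p * φ p := by
    rw [← integral_add (integrable_mul_of_L2 hlam.of_top (hux.mul_test hφ))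
      (integrable_mul_of_L2 huy (hφ.memLp 2 _))]
    refine integral_congr_ae (Eventually.of_forall fun p => ?_)
    simp only []
    ring
  have e2 : ∫ p in rect L₁ L₂, (l p * u p + lam p * ux p) * φ p =
      (∫ p in rect L₁ L₂, l p * (u p * φ p)) + ∫ p in rect L₁ L₂, lam p * (ux p * φ p) := by
    rw [← integral_add (integrable_mul_of_L2 hl.of_top (hu.mul_test hφ))
      (integrable_mul_of_L2 hlam.of_top (hux.mul_test hφ))]
    refine integral_congr_ae (Eventually.of_forall fun p => ?_)
    simp only []
    ring
  rw [e2] at h1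
  rw [e1]
  simp only [mul_assoc] at h1
  linarith

/-- The commutator of the transport operator and a derivative in the direction `e`. -/
lemma WT.commutator {L₁ L₂ : ℝ} {e : ℝ × ℝ} {lam l k u ux uy ue f : ℝ × ℝ → ℝ}
    (hlam : MemLp lam ⊤ (volume.restrict (rect L₁ L₂)))
    (hl : MemLp l ⊤ (volume.restrict (rect L₁ L₂)))
    (hk : MemLp k ⊤ (volume.restrict (rect L₁ L₂))) (hlx : WD L₁ L₂ (1, 0) lam l)
    (hle : WD L₁ L₂ e lam k) (hu : MemLp u 2 (volume.restrict (rect L₁ L₂)))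
    (hux : MemLp ux 2 (volume.restrict (rect L₁ L₂)))
    (huy : MemLp uy 2 (volume.restrict (rect L₁ L₂)))
    (hue : MemLp ue 2 (volume.restrict (rect L₁ L₂))) (hx : WD L₁ L₂ (1, 0) u ux)
    (hy : WD L₁ L₂ (0, 1) u uy) (he : WD L₁ L₂ e u ue) (hf : WT L₁ L₂ lam l u f)
    {φ : ℝ × ℝ → ℝ} (hφ : TestOn (rect L₁ L₂) φ) :
    -∫ p in rect L₁ L₂, f p * dd e φ p =
      (-(∫ p in rect L₁ L₂, ue p * (l p * φ p + lam p * dd (1, 0) φ p))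
        - ∫ p in rect L₁ L₂, ue p * dd (0, 1) φ p) + ∫ p in rect L₁ L₂, k p * ux p * φ p := by
  have h1 := (hf _ (hφ.dd e)).trans (WT_of_wd hlam hl hlx hu hux huy hx hy _ (hφ.dd e)).symm
  beta_reduce at h1
  have e1 : ∫ p in rect L₁ L₂, (lam p * ux p + uy p) * dd e φ p =
      (∫ p in rect L₁ L₂, lam p * (ux p * dd e φ p)) + ∫ p in rect L₁ L₂, uy p * dd e φ p := by
    rw [← integral_add (integrable_mul_of_L2 hlam.of_top (hux.mul_test (hφ.dd e)))
      (integrable_mul_of_L2 huy ((hφ.dd e).memLp 2 _))]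
    refine integral_congr_ae (Eventually.of_forall fun p => ?_)
    simp only []
    ring
  have h2 := hy _ (hφ.dd e)
  have h3 := he _ (hφ.dd (0, 1))
  rw [dd_comm hφ.1] at h2
  -- The derivative of `ux` in the direction `e` need not be a function. The two directions are
  -- therefore exchanged on the side of the test function, at the cost of first derivatives of `lam`
  -- only.
  have h4 := hlx.cross hle hx he hlam.of_top hl.of_top hk.of_top hux hue hφ
  rw [integral_transport_split hlam.of_top hl.of_top hue hφ]
  rw [h1, e1]
  simp only [mul_assoc] at h4 ⊢
  linarith

/-! ### The Leibniz expansion -/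

/-- One differentiation, by `∂_x^i ∂_y^j`, of a list of products of derivatives, where
`((β₁, β₂), (γ₁, γ₂))` stands for `∂^β lam * ∂^γ u`. -/
def diffTerms (i j : ℕ) (l : List ((ℕ × ℕ) × (ℕ × ℕ))) : List ((ℕ × ℕ) × (ℕ × ℕ)) :=
  l.flatMap fun t => [((t.1.1 + i, t.1.2 + j), t.2), (t.1, (t.2.1 + i, t.2.2 + j))]

/-- The terms of `∂_x^a (T u) - T (∂_x^a u)`. -/
def termsX : ℕ → List ((ℕ × ℕ) × (ℕ × ℕ))
  | 0 => []
  | a + 1 => ((1, 0), (a + 1, 0)) :: diffTerms 1 0 (termsX a)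

/-- The terms of `∂_x^a ∂_y^b (T u) - T (∂_x^a ∂_y^b u)`. -/
def terms (a : ℕ) : ℕ → List ((ℕ × ℕ) × (ℕ × ℕ))
  | 0 => termsX a
  | b + 1 => ((0, 1), (a + 1, b)) :: diffTerms 0 1 (terms a b)

/-- The sum of the products of derivatives in a list. -/
def sumTerms (Λ U : ℕ → ℕ → ℝ × ℝ → ℝ) : List ((ℕ × ℕ) × (ℕ × ℕ)) → ℝ × ℝ → ℝ
  | [] => fun _ => 0
  | t :: l => fun p => Λ t.1.1 t.1.2 p * U t.2.1 t.2.2 p + sumTerms Λ U l p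

/-- The bounds on the orders of the derivatives in a Leibniz expansion of order `n`. -/
def GoodTerm (n : ℕ) (t : (ℕ × ℕ) × (ℕ × ℕ)) : Prop :=
  1 ≤ t.1.1 + t.1.2 ∧ 1 ≤ t.2.1 + t.2.2 ∧ t.1.1 + t.1.2 + (t.2.1 + t.2.2) ≤ n + 1

/-- A differentiation raises the total order by one and lowers neither factor. Since both factors
have order at least one, a total of at most `n + 1` keeps each of them at order at most `n`, so a
Leibniz expansion of order `n` needs no derivative of `u` beyond order `n`. -/
lemma goodTerm_diffTerms {n i j : ℕ} (hij : i + j = 1) {l : List ((ℕ × ℕ) × (ℕ × ℕ))}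
    (h : ∀ t ∈ l, GoodTerm n t) : ∀ t ∈ diffTerms i j l, GoodTerm (n + 1) t := by
  intro t ht
  rw [diffTerms, List.mem_flatMap] at ht
  obtain ⟨s, hs, hts⟩ := ht
  have h1 := h s hs
  simp only [List.mem_cons, List.not_mem_nil, or_false] at hts
  rcases hts with rfl | rfl <;> simp only [GoodTerm] at h1 ⊢ <;> omega

lemma goodTerm_termsX (a : ℕ) : ∀ t ∈ termsX a, GoodTerm a t := by
  induction a with
  | zero => simp [termsX]
  | succ a ih =>
    intro t ht
    rw [termsX, List.mem_cons] at ht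
    rcases ht with rfl | ht
    · simp only [GoodTerm]; omega
    · exact goodTerm_diffTerms rfl ih t ht

lemma goodTerm_terms (a b : ℕ) : ∀ t ∈ terms a b, GoodTerm (a + b) t := by
  induction b with
  | zero => exact goodTerm_termsX a
  | succ b ih =>
    intro t ht
    rw [terms, List.mem_cons] at ht
    rcases ht with rfl | ht
    · simp only [GoodTerm]; omega
    · exact goodTerm_diffTerms rfl ih t ht

/-- Products of `L²` functions are integrable without any Sobolev estimate, which suffices for the
weak product rule. Square integrability of the sums is a separate matter, settled by
`exists_eLpNorm_mul_le`. -/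
lemma integrable_sumTerms {L₁ L₂ : ℝ} {N m : ℕ} {Λ U : ℕ → ℕ → ℝ × ℝ → ℝ}
    (hΛ : IsJet L₁ L₂ N Λ) (hU : IsJet L₁ L₂ m U) {l : List ((ℕ × ℕ) × (ℕ × ℕ))}
    (hl : ∀ t ∈ l, t.1.1 + t.1.2 ≤ N ∧ t.2.1 + t.2.2 ≤ m) :
    Integrable (sumTerms Λ U l) (volume.restrict (rect L₁ L₂)) := by
  induction l with
  | nil => exact integrable_zero _ _ _
  | cons t l ih =>
    have h1 := hl t (by simp)
    exact (integrable_mul_of_L2 (hΛ.memLp _ _ h1.1) (hU.memLp _ _ h1.2)).add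
      (ih fun s hs => hl s (by simp [hs]))

lemma memLp_sumTerms {L₁ L₂ : ℝ} {Λ U : ℕ → ℕ → ℝ × ℝ → ℝ} {l : List ((ℕ × ℕ) × (ℕ × ℕ))}
    (hl : ∀ t ∈ l, MemLp (fun p => Λ t.1.1 t.1.2 p * U t.2.1 t.2.2 p) 2
      (volume.restrict (rect L₁ L₂))) :
    MemLp (sumTerms Λ U l) 2 (volume.restrict (rect L₁ L₂)) := by
  induction l with
  | nil => exact MemLp.zero'
  | cons t l ih => exact (hl t (by simp)).add (ih fun s hs => hl s (by simp [hs]))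

lemma wd_sumTerms {L₁ L₂ : ℝ} {N m i j : ℕ} (hij : i + j = 1) {e : ℝ × ℝ}
    {Λ U : ℕ → ℕ → ℝ × ℝ → ℝ} (hΛ : IsJet L₁ L₂ N Λ) (hU : IsJet L₁ L₂ m U)
    (hΛe : ∀ a b, a + b < N → WD L₁ L₂ e (Λ a b) (Λ (a + i) (b + j)))
    (hUe : ∀ a b, a + b < m → WD L₁ L₂ e (U a b) (U (a + i) (b + j)))
    {l : List ((ℕ × ℕ) × (ℕ × ℕ))} (hl : ∀ t ∈ l, t.1.1 + t.1.2 < N ∧ t.2.1 + t.2.2 < m) :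
    WD L₁ L₂ e (sumTerms Λ U l) (sumTerms Λ U (diffTerms i j l)) := by
  induction l with
  | nil => intro φ _; simp [sumTerms, diffTerms]
  | cons t l ih =>
    have h1 := hl t (by simp)
    have hl' : ∀ s ∈ l, s.1.1 + s.1.2 < N ∧ s.2.1 + s.2.2 < m := fun s hs => hl s (by simp [hs])
    have hΛ1 := hΛ.memLp _ _ h1.1.le
    have hU1 := hU.memLp _ _ h1.2.le
    have hΛ2 := hΛ.memLp (t.1.1 + i) (t.1.2 + j) (by omega)
    have hU2 := hU.memLp (t.2.1 + i) (t.2.2 + j) (by omega)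
    have hd := ((hΛe _ _ h1.1).mul (hUe _ _ h1.2) hΛ1 hΛ2 hU1 hU2).add (ih hl')
      (integrable_mul_of_L2 hΛ1 hU1)
      (integrable_sumTerms hΛ hU fun s hs => ⟨(hl' s hs).1.le, (hl' s hs).2.le⟩)
      ((integrable_mul_of_L2 hΛ2 hU1).add (integrable_mul_of_L2 hΛ1 hU2))
      (integrable_sumTerms hΛ hU fun s hs => by
        rw [diffTerms, List.mem_flatMap] at hs
        obtain ⟨r, hr, hsr⟩ := hs
        have := hl' r hr
        simp only [List.mem_cons, List.not_mem_nil, or_false] at hsr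
        rcases hsr with rfl | rfl <;> simp only [] <;> omega)
    have he : sumTerms Λ U (diffTerms i j (t :: l)) = fun p =>
        (Λ (t.1.1 + i) (t.1.2 + j) p * U t.2.1 t.2.2 p +
          Λ t.1.1 t.1.2 p * U (t.2.1 + i) (t.2.2 + j) p) + sumTerms Λ U (diffTerms i j l) p := by
      funext p
      simp only [diffTerms, List.flatMap_cons, List.cons_append, List.nil_append, sumTerms]
      ring
    rw [he]
    exact hd

lemma integrable_mul_test {S U : Set (ℝ × ℝ)} {w ψ : ℝ × ℝ → ℝ}
    (hw : Integrable w (volume.restrict S)) (hψ : TestOn U ψ) :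
    Integrable (fun p => w p * ψ p) (volume.restrict S) := by
  obtain ⟨C, hC⟩ := hψ.2.1.exists_bound_of_continuous hψ.continuous
  exact hw.mul_bdd (c := C) hψ.continuous.aestronglyMeasurable (Eventually.of_forall hC)

/-- The Leibniz step: the derivative of `T u + ∑ ∂^β lam ∂^γ u`. -/
lemma WT.leibniz_step {L₁ L₂ : ℝ} {N m i j : ℕ} (hij : i + j = 1) {e : ℝ × ℝ}
    {Λ U : ℕ → ℕ → ℝ × ℝ → ℝ} (hΛ : IsJet L₁ L₂ N Λ) (hU : IsJet L₁ L₂ m U) (hN : 1 ≤ N)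
    (hΛtop : ∀ a b, a + b ≤ 1 → MemLp (Λ a b) ⊤ (volume.restrict (rect L₁ L₂)))
    (hΛe : ∀ a b, a + b < N → WD L₁ L₂ e (Λ a b) (Λ (a + i) (b + j)))
    (hUe : ∀ a b, a + b < m → WD L₁ L₂ e (U a b) (U (a + i) (b + j)))
    {l : List ((ℕ × ℕ) × (ℕ × ℕ))} (hl : ∀ t ∈ l, t.1.1 + t.1.2 < N ∧ t.2.1 + t.2.2 < m)
    {a b : ℕ} (hab : a + b < m) {F : ℝ × ℝ → ℝ} (hF : WT L₁ L₂ (Λ 0 0) (Λ 1 0) (U a b) F)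
    (hFi : Integrable F (volume.restrict (rect L₁ L₂))) {φ : ℝ × ℝ → ℝ}
    (hφ : TestOn (rect L₁ L₂) φ) :
    -∫ p in rect L₁ L₂, (F p + sumTerms Λ U l p) * dd e φ p =
      (-(∫ p in rect L₁ L₂, U (a + i) (b + j) p * (Λ 1 0 p * φ p + Λ 0 0 p * dd (1, 0) φ p))
        - ∫ p in rect L₁ L₂, U (a + i) (b + j) p * dd (0, 1) φ p) +
      ∫ p in rect L₁ L₂, sumTerms Λ U (((i, j), (a + 1, b)) :: diffTerms i j l) p * φ p := by
  have hle := hΛe 0 0 (by omega)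
  simp only [zero_add] at hle
  have h1 := hF.commutator (hΛtop 0 0 (by omega)) (hΛtop 1 0 (by omega)) (hΛtop i j hij.le)
    (hΛ.wd_x 0 0 (by omega)) hle (hU.memLp a b hab.le)
    (hU.memLp (a + 1) b (by omega)) (hU.memLp a (b + 1) (by omega))
    (hU.memLp (a + i) (b + j) (by omega)) (hU.wd_x a b hab) (hU.wd_y a b hab) (hUe a b hab) hφ
  have h2 := wd_sumTerms hij hΛ hU hΛe hUe hl φ hφ
  have hi1 : Integrable (sumTerms Λ U l) (volume.restrict (rect L₁ L₂)) :=
    integrable_sumTerms hΛ hU fun s hs => ⟨(hl s hs).1.le, (hl s hs).2.le⟩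
  have hi2 : Integrable (sumTerms Λ U (diffTerms i j l)) (volume.restrict (rect L₁ L₂)) :=
    integrable_sumTerms hΛ hU fun s hs => by
      rw [diffTerms, List.mem_flatMap] at hs
      obtain ⟨r, hr, hsr⟩ := hs
      have := hl r hr
      simp only [List.mem_cons, List.not_mem_nil, or_false] at hsr
      rcases hsr with rfl | rfl <;> simp only [] <;> omega
  have hi3 : Integrable (fun p => Λ i j p * U (a + 1) b p) (volume.restrict (rect L₁ L₂)) :=
    integrable_mul_of_L2 (hΛ.memLp i j (by omega)) (hU.memLp (a + 1) b (by omega))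
  simp only [sumTerms, add_mul]
  rw [integral_add (integrable_mul_test hFi (hφ.dd e)) (integrable_mul_test hi1 (hφ.dd e)),
    integral_add (integrable_mul_test hi3 hφ) (integrable_mul_test hi2 hφ)]
  linarith

lemma goodTerm_lt {n N m : ℕ} (hn : n < m) (hmN : m ≤ N) {t : (ℕ × ℕ) × (ℕ × ℕ)}
    (h : GoodTerm n t) : t.1.1 + t.1.2 < N ∧ t.2.1 + t.2.2 < m := by
  simp only [GoodTerm] at h
  omega

lemma goodTerm_le {n N m : ℕ} (hn : n ≤ m) (hmN : m ≤ N) {t : (ℕ × ℕ) × (ℕ × ℕ)}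
    (h : GoodTerm n t) : t.1.1 + t.1.2 ≤ N ∧ t.2.1 + t.2.2 ≤ m := by
  simp only [GoodTerm] at h
  omega

section Leibniz

variable {L₁ L₂ : ℝ} {N m : ℕ} {Λ U : ℕ → ℕ → ℝ × ℝ → ℝ}

/-- The transport of the derivatives of `u` in terms of the derivatives of the transport. -/
lemma wt_of_jet (hΛ : IsJet L₁ L₂ N Λ) (hU : IsJet L₁ L₂ m U) (hN : 1 ≤ N) (hmN : m ≤ N)
    (hΛtop : ∀ a b, a + b ≤ 1 → MemLp (Λ a b) ⊤ (volume.restrict (rect L₁ L₂)))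
    {G : ℕ → ℕ → ℝ × ℝ → ℝ} (hG : IsJet L₁ L₂ m G)
    (h0 : WT L₁ L₂ (Λ 0 0) (Λ 1 0) (U 0 0) (G 0 0)) :
    ∀ a b, a + b ≤ m →
      WT L₁ L₂ (Λ 0 0) (Λ 1 0) (U a b) (fun p => G a b p - sumTerms Λ U (terms a b) p) := by
  have hiS : ∀ a b, a + b ≤ m →
      Integrable (sumTerms Λ U (terms a b)) (volume.restrict (rect L₁ L₂)) := fun a b hab =>
    integrable_sumTerms hΛ hU fun t ht => goodTerm_le hab hmN (goodTerm_terms a b t ht)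
  have hiG : ∀ a b, a + b ≤ m → Integrable (G a b) (volume.restrict (rect L₁ L₂)) :=
    fun a b hab => integrable_of_L2 (hG.memLp a b hab)
  have step : ∀ (i j : ℕ) (e : ℝ × ℝ), i + j = 1 →
      (∀ a b, a + b < N → WD L₁ L₂ e (Λ a b) (Λ (a + i) (b + j))) →
      (∀ a b, a + b < m → WD L₁ L₂ e (U a b) (U (a + i) (b + j))) →
      (∀ a b, a + b < m → WD L₁ L₂ e (G a b) (G (a + i) (b + j))) →
      ∀ a b, a + b < m →
      terms (a + i) (b + j) = ((i, j), (a + 1, b)) :: diffTerms i j (terms a b) →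
      WT L₁ L₂ (Λ 0 0) (Λ 1 0) (U a b) (fun p => G a b p - sumTerms Λ U (terms a b) p) →
      WT L₁ L₂ (Λ 0 0) (Λ 1 0) (U (a + i) (b + j))
        (fun p => G (a + i) (b + j) p - sumTerms Λ U (terms (a + i) (b + j)) p) := by
    intro i j e hij h1 h2 h3 a b hab ht hw φ hφ
    have h4 := hw.leibniz_step hij hΛ hU hN hΛtop h1 h2
      (fun t ht => goodTerm_lt hab hmN (goodTerm_terms a b t ht)) hab
      ((hiG a b hab.le).sub (hiS a b hab.le)) hφ
    simp only [sub_add_cancel] at h4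
    rw [h3 a b hab φ hφ, neg_neg, ← ht] at h4
    simp only [sub_mul]
    rw [integral_sub (integrable_mul_test (hiG _ _ (by omega)) hφ)
      (integrable_mul_test (hiS _ _ (by omega)) hφ), h4]
    ring
  have hx : ∀ a, a ≤ m →
      WT L₁ L₂ (Λ 0 0) (Λ 1 0) (U a 0) (fun p => G a 0 p - sumTerms Λ U (terms a 0) p) := by
    intro a
    induction a with
    | zero => intro _; simpa [terms, termsX, sumTerms] using h0
    | succ a ih =>
      intro ha
      -- Differentiation in `x` is only needed at `b = 0`, because `terms` performs all derivatives
      -- in `x` before those in `y`; with this order the recursion for `terms` holds by definition.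
      exact step 1 0 (1, 0) rfl hΛ.wd_x hU.wd_x hG.wd_x a 0 (by omega) rfl (ih (by omega))
  intro a b
  induction b with
  | zero => exact hx a
  | succ b ih =>
    intro hab
    exact step 0 1 (0, 1) rfl hΛ.wd_y hU.wd_y hG.wd_y a b (by omega) rfl (ih (by omega))

/-- The derivatives of the transport of `u` in terms of the transport of its derivatives. -/
lemma hasWeakDeriv_of_wt (hΛ : IsJet L₁ L₂ N Λ) (hU : IsJet L₁ L₂ m U) (hN : 1 ≤ N) (hmN : m ≤ N)
    (hΛtop : ∀ a b, a + b ≤ 1 → MemLp (Λ a b) ⊤ (volume.restrict (rect L₁ L₂)))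
    {F : ℕ → ℕ → ℝ × ℝ → ℝ}
    (hF : ∀ a b, a + b ≤ m → WT L₁ L₂ (Λ 0 0) (Λ 1 0) (U a b) (F a b))
    (hF2 : ∀ a b, a + b ≤ m → MemLp (F a b) 2 (volume.restrict (rect L₁ L₂)))
    (hS : ∀ a b, a + b ≤ m →
      MemLp (sumTerms Λ U (terms a b)) 2 (volume.restrict (rect L₁ L₂))) :
    ∀ a b, a + b ≤ m →
      HasWeakDeriv L₁ L₂ a b (F 0 0) (fun p => F a b p + sumTerms Λ U (terms a b) p) := by
  have step : ∀ (i j : ℕ) (e : ℝ × ℝ), i + j = 1 →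
      (∀ a b, a + b < N → WD L₁ L₂ e (Λ a b) (Λ (a + i) (b + j))) →
      (∀ a b, a + b < m → WD L₁ L₂ e (U a b) (U (a + i) (b + j))) →
      ∀ a b, a + b < m →
      terms (a + i) (b + j) = ((i, j), (a + 1, b)) :: diffTerms i j (terms a b) →
      WD L₁ L₂ e (fun p => F a b p + sumTerms Λ U (terms a b) p)
        (fun p => F (a + i) (b + j) p + sumTerms Λ U (terms (a + i) (b + j)) p) := by
    intro i j e hij h1 h2 a b hab ht φ hφ
    have h4 := (hF a b hab.le).leibniz_step hij hΛ hU hN hΛtop h1 h2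
      (fun t ht => goodTerm_lt hab hmN (goodTerm_terms a b t ht)) hab
      (integrable_of_L2 (hF2 a b hab.le)) hφ
    rw [← hF _ _ (by omega) φ hφ, ← ht] at h4
    simp only [add_mul _ _ (φ _)]
    rw [integral_add (integrable_mul_test (integrable_of_L2 (hF2 _ _ (by omega))) hφ)
      (integrable_mul_test (integrable_of_L2 (hS _ _ (by omega))) hφ), ← h4, neg_neg]
  have h := hasWeakDeriv_of_chain
    (D := fun a b p => F a b p + sumTerms Λ U (terms a b) p) (m := m)
    (fun a b hab => (hF2 a b hab).add (hS a b hab))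
    (fun a ha => step 1 0 (1, 0) rfl hΛ.wd_x hU.wd_x a 0 (by omega) rfl)
    (fun a b hab => step 0 1 (0, 1) rfl hΛ.wd_y hU.wd_y a b hab rfl)
  simpa [terms, termsX, sumTerms] using h

end Leibniz

/-! ### Slices of functions on the rectangle -/

lemma restrict_rect_eq_prod (L₁ L₂ : ℝ) : (volume.restrict (rect L₁ L₂) : Measure (ℝ × ℝ)) =
    (volume.restrict (Ioo 0 L₁)).prod (volume.restrict (Ioo 0 L₂)) :=
  (Measure.prod_restrict _ _).symm

lemma measurePreserving_swap_rect (L₁ L₂ : ℝ) :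
    MeasurePreserving Prod.swap (volume.restrict (rect L₁ L₂)) (volume.restrict (rect L₂ L₁)) := by
  rw [restrict_rect_eq_prod, restrict_rect_eq_prod]
  exact Measure.measurePreserving_swap

lemma measurableEmbedding_swap : MeasurableEmbedding (Prod.swap : ℝ × ℝ → ℝ × ℝ) :=
  MeasurableEquiv.prodComm.measurableEmbedding

/-- The integral over the horizontal slice at height `y`. -/
noncomputable def sliceX (L₁ : ℝ) (h : ℝ × ℝ → ℝ≥0∞) (y : ℝ) : ℝ≥0∞ := ∫⁻ s in Ioo 0 L₁, h (s, y)

lemma aemeasurable_sliceX {L₁ L₂ : ℝ} {h : ℝ × ℝ → ℝ≥0∞}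
    (hh : AEMeasurable h (volume.restrict (rect L₁ L₂))) :
    AEMeasurable (sliceX L₁ h) (volume.restrict (Ioo 0 L₂)) := by
  rw [restrict_rect_eq_prod] at hh
  exact hh.prod_swap.lintegral_prod_right'

lemma lintegral_sliceX {L₁ L₂ : ℝ} {h : ℝ × ℝ → ℝ≥0∞}
    (hh : AEMeasurable h (volume.restrict (rect L₁ L₂))) :
    ∫⁻ y in Ioo 0 L₂, sliceX L₁ h y = ∫⁻ p in rect L₁ L₂, h p := by
  rw [restrict_rect_eq_prod] at hh ⊢
  exact (lintegral_prod_symm _ hh).symm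

lemma lintegral_sliceX_snd {L₁ L₂ : ℝ} {h : ℝ × ℝ → ℝ≥0∞}
    (hh : AEMeasurable h (volume.restrict (rect L₁ L₂))) :
    ∫⁻ p in rect L₁ L₂, sliceX L₁ h p.2 = ENNReal.ofReal L₁ * ∫⁻ p in rect L₁ L₂, h p := by
  rw [← lintegral_sliceX hh, restrict_rect_eq_prod,
    lintegral_prod _ ((aemeasurable_sliceX hh).comp_snd)]
  simp [mul_comm]

lemma ae_aemeasurable_slice {L₁ L₂ : ℝ} {h : ℝ × ℝ → ℝ≥0∞}
    (hh : AEMeasurable h (volume.restrict (rect L₁ L₂))) :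
    ∀ᵐ p ∂(volume.restrict (rect L₁ L₂)),
      AEMeasurable (fun s => h (s, p.2)) (volume.restrict (Ioo 0 L₁)) := by
  rw [restrict_rect_eq_prod] at hh ⊢
  have h1 := hh.prod_swap.aestronglyMeasurable.prodMk_left
  have h2 := Measure.quasiMeasurePreserving_snd (μ := volume.restrict (Ioo 0 L₁))
    (ν := volume.restrict (Ioo 0 L₂)) |>.ae h1
  filter_upwards [h2] with p hp
  exact hp.aemeasurable

/-- The truncated difference `f - R` has integral at most that of `E ε` for every small `ε`, hence
zero. This passes an almost everywhere bound to the limit without extracting subsequences. -/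
lemma ae_le_of_forall_ae_le_add {μ : Measure (ℝ × ℝ)} {f R : ℝ × ℝ → ℝ≥0∞}
    {E : ℝ → ℝ × ℝ → ℝ≥0∞} (hf : AEMeasurable f μ) (hR : AEMeasurable R μ)
    (h : ∀ᶠ ε in 𝓝[>] (0 : ℝ), ∀ᵐ p ∂μ, f p ≤ E ε p + R p)
    (hE : Tendsto (fun ε => ∫⁻ p, E ε p ∂μ) (𝓝[>] 0) (𝓝 0)) : ∀ᵐ p ∂μ, f p ≤ R p := by
  have h0 : ∫⁻ p, (f p - R p) ∂μ = 0 := by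
    refine le_antisymm (ge_of_tendsto hE ?_) zero_le
    filter_upwards [h] with ε hε
    refine lintegral_mono_ae ?_
    filter_upwards [hε] with p hp
    exact tsub_le_iff_right.2 hp
  filter_upwards [(lintegral_eq_zero_iff' (hf.sub hR)).1 h0] with p hp
  exact tsub_eq_zero_iff_le.1 hp

lemma enorm_le_add_lintegral_deriv {F F' : ℝ → ℝ} {a b : ℝ} (hF' : Continuous F')
    (hd : ∀ s ∈ Ioo a b, HasDerivAt F (F' s) s) {x x' : ℝ} (hx : x ∈ Ioo a b)
    (hx' : x' ∈ Ioo a b) : ‖F x‖ₑ ≤ ‖F x'‖ₑ + ∫⁻ s in Ioo a b, ‖F' s‖ₑ := by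
  have hsub : uIcc x' x ⊆ Ioo a b := ordConnected_Ioo.uIcc_subset hx' hx
  have h1 : ∫ s in x'..x, F' s = F x - F x' :=
    intervalIntegral.integral_eq_sub_of_hasDerivAt (fun s hs => hd s (hsub hs))
      (hF'.intervalIntegrable _ _)
  have h2 : ‖∫ s in x'..x, F' s‖ₑ ≤ ∫⁻ s in Ioo a b, ‖F' s‖ₑ := by
    rw [← ofReal_norm, intervalIntegral.norm_intervalIntegral_eq, ofReal_norm]
    refine (enorm_integral_le_lintegral_enorm _).trans ?_
    exact lintegral_mono_set (uIoc_subset_uIcc.trans hsub)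
  calc ‖F x‖ₑ = ‖F x' + ∫ s in x'..x, F' s‖ₑ := by rw [h1]; ring_nf
    _ ≤ _ := (enorm_add_le _ _).trans (by gcongr)

/-- The constant of the one-dimensional Sobolev inequality. -/
noncomputable def sobC (L : ℝ) : ℝ≥0∞ := ENNReal.ofReal (2 / L) * (1 + ENNReal.ofReal L)

lemma sobC_ne_top (L : ℝ) : sobC L ≠ ⊤ := by
  simp [sobC, ENNReal.mul_eq_top]

/-- Average the fundamental theorem of calculus over the base point in `(δ, L)`. The interval starts
at `δ` because mollification commutes with the derivative only away from `Γ`, and `δ ≤ L / 2` keeps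
its length at least `L / 2`, so the constant does not depend on `δ`. -/
lemma enorm_le_sobC {F F' : ℝ → ℝ} {δ L : ℝ} (hL : 0 < L) (hδ0 : 0 ≤ δ) (hδ : δ ≤ L / 2)
    (hF : Measurable F) (hF' : Continuous F')
    (hd : ∀ s ∈ Ioo δ L, HasDerivAt F (F' s) s) {x : ℝ} (hx : x ∈ Ioo δ L) :
    ‖F x‖ₑ ≤ sobC L * ∫⁻ s in Ioo 0 L, (‖F s‖ₑ + ‖F' s‖ₑ) := by
  have hsub : Ioo δ L ⊆ Ioo 0 L := Ioo_subset_Ioo_left hδ0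
  have h1 : ∫⁻ _ in Ioo δ L, ‖F x‖ₑ ≤
      ∫⁻ s in Ioo δ L, (‖F s‖ₑ + ∫⁻ s in Ioo δ L, ‖F' s‖ₑ) := by
    refine setLIntegral_mono' measurableSet_Ioo fun s hs => ?_
    exact enorm_le_add_lintegral_deriv hF' hd hx hs
  rw [lintegral_add_left hF.enorm, lintegral_const, lintegral_const,
    Measure.restrict_apply_univ, Real.volume_Ioo] at h1
  have h2 : ‖F x‖ₑ * ENNReal.ofReal (L / 2) ≤
      (1 + ENNReal.ofReal L) * ∫⁻ s in Ioo 0 L, (‖F s‖ₑ + ‖F' s‖ₑ) := by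
    calc ‖F x‖ₑ * ENNReal.ofReal (L / 2) ≤ ‖F x‖ₑ * ENNReal.ofReal (L - δ) := by
          gcongr; linarith
      _ ≤ _ := h1
      _ ≤ (∫⁻ s in Ioo 0 L, (‖F s‖ₑ + ‖F' s‖ₑ)) +
          (∫⁻ s in Ioo 0 L, (‖F s‖ₑ + ‖F' s‖ₑ)) * ENNReal.ofReal L := by
          refine add_le_add ?_ (mul_le_mul' ?_ (ENNReal.ofReal_le_ofReal (by linarith)))
          · exact (lintegral_mono_set hsub).trans (lintegral_mono fun s => le_self_add)
          · exact (lintegral_mono_set hsub).trans (lintegral_mono fun s => le_add_self)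
      _ = _ := by ring
  calc ‖F x‖ₑ = ENNReal.ofReal (2 / L) * (‖F x‖ₑ * ENNReal.ofReal (L / 2)) := by
        rw [mul_comm, mul_assoc, ← ENNReal.ofReal_mul (by positivity)]
        rw [show L / 2 * (2 / L) = 1 by field_simp]
        simp
    _ ≤ _ := by rw [sobC, mul_assoc]; gcongr

lemma lintegral_enorm_le_L2 {L₁ L₂ : ℝ} {f : ℝ × ℝ → ℝ}
    (hf : AEStronglyMeasurable f (volume.restrict (rect L₁ L₂))) :
    ∫⁻ p in rect L₁ L₂, ‖f p‖ₑ ≤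
      eLpNorm f 2 (volume.restrict (rect L₁ L₂)) * volume (rect L₁ L₂) ^ (1 / 2 : ℝ) := by
  have := eLpNorm_le_eLpNorm_mul_rpow_measure_univ (p := 1) (q := 2) (by norm_num) hf
  rw [eLpNorm_one_eq_lintegral_enorm, Measure.restrict_apply_univ] at this
  convert this using 3
  norm_num

lemma volume_rect_ne_top (L₁ L₂ : ℝ) : volume (rect L₁ L₂) ≠ ⊤ :=
  ((measure_mono (rect_subset_closedRect L₁ L₂)).trans_lt
      (isCompact_closedRect L₁ L₂).measure_lt_top).ne

lemma tendsto_lintegral_moll_sub {L₁ L₂ : ℝ} {f : ℝ × ℝ → ℝ}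
    (hf : MemLp f 2 (volume.restrict (rect L₁ L₂))) :
    Tendsto (fun ε => ∫⁻ p in rect L₁ L₂, ‖moll L₁ L₂ ε f p - f p‖ₑ) (𝓝[>] 0) (𝓝 0) := by
  have h1 : Tendsto (fun ε => eLpNorm (fun p => moll L₁ L₂ ε f p - f p) 2
      (volume.restrict (rect L₁ L₂)) * volume (rect L₁ L₂) ^ (1 / 2 : ℝ)) (𝓝[>] 0) (𝓝 0) := by
    simpa using ENNReal.Tendsto.mul_const (tendsto_moll hf) (Or.inr
      (ENNReal.rpow_ne_top_of_nonneg (by norm_num) (volume_rect_ne_top L₁ L₂)))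
  refine tendsto_of_tendsto_of_tendsto_of_le_of_le' tendsto_const_nhds h1
    (Eventually.of_forall fun _ => zero_le) ?_
  filter_upwards [eventually_memLp_moll hf] with ε hε
  exact lintegral_enorm_le_L2 (hε.sub hf).1

lemma hasDerivAt_slice_x {F : ℝ × ℝ → ℝ} (hF : ContDiff ℝ ∞ F) (s y : ℝ) :
    HasDerivAt (fun s => F (s, y)) (dd (1, 0) F (s, y)) s :=
  (differentiable_of_smooth hF (s, y)).hasFDerivAt.comp_hasDerivAt s
    ((hasDerivAt_id s).prodMk (hasDerivAt_const s y))

/-- A function with a weak derivative in the first variable is bounded, almost everywhere, in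
terms of the integrals over horizontal slices. -/
lemma WD.ae_enorm_le_sliceX {L₁ L₂ : ℝ} (hL₁ : 0 < L₁) {f g : ℝ × ℝ → ℝ}
    (h : WD L₁ L₂ (1, 0) f g) (hf : MemLp f 2 (volume.restrict (rect L₁ L₂)))
    (hg : MemLp g 2 (volume.restrict (rect L₁ L₂))) :
    ∀ᵐ p ∂(volume.restrict (rect L₁ L₂)),
      ‖f p‖ₑ ≤ sobC L₁ * sliceX L₁ (fun q => ‖f q‖ₑ + ‖g q‖ₑ) p.2 := by
  -- No trace condition is available here. The bound is proved at distance more than `δ` from the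
  -- left and bottom edges, with a right side independent of `δ`, and the rectangle is exhausted by
  -- countably many `δ`.
  have key : ∀ δ, 0 < δ → δ ≤ L₁ / 2 → ∀ᵐ p ∂(volume.restrict (rect L₁ L₂ ∩ Ioi δ ×ˢ Ioi δ)),
      ‖f p‖ₑ ≤ sobC L₁ * sliceX L₁ (fun q => ‖f q‖ₑ + ‖g q‖ₑ) p.2 := by
    intro δ hδ hδL
    have hle : volume.restrict (rect L₁ L₂ ∩ Ioi δ ×ˢ Ioi δ) ≤ volume.restrict (rect L₁ L₂) :=
      Measure.restrict_mono inter_subset_left le_rfl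
    have hmR : ∀ {u v : ℝ × ℝ → ℝ}, MemLp u 2 (volume.restrict (rect L₁ L₂)) →
        MemLp v 2 (volume.restrict (rect L₁ L₂)) →
        AEMeasurable (fun p : ℝ × ℝ => sobC L₁ * sliceX L₁ (fun q => ‖u q‖ₑ + ‖v q‖ₑ) p.2)
          (volume.restrict (rect L₁ L₂)) := by
      intro u v hu hv
      have h1 := aemeasurable_sliceX (hu.1.enorm.add hv.1.enorm)
      rw [restrict_rect_eq_prod]
      exact (h1.comp_snd).const_mul _
    -- `E` collects the mollification errors of `f` and `g`, at the point and along its slice; its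
    -- integral tends to zero.
    refine ae_le_of_forall_ae_le_add (E := fun ε p => ‖moll L₁ L₂ ε f p - f p‖ₑ +
      sobC L₁ * sliceX L₁ (fun q => ‖moll L₁ L₂ ε f q - f q‖ₑ + ‖moll L₁ L₂ ε g q - g q‖ₑ) p.2)
      (hf.1.enorm.mono_measure hle) ((hmR hf hg).mono_measure hle) ?_ ?_
    · filter_upwards [eventually_three_mul_lt hδ] with ε hε
      filter_upwards [ae_restrict_mem ((measurableSet_rect L₁ L₂).inter
        (measurableSet_Ioi.prod measurableSet_Ioi)),
        ae_mono hle (ae_aemeasurable_slice (hf.1.enorm.add hg.1.enorm))] with p hp hpm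
      have hsm := contDiff_moll (L₁ := L₁) (L₂ := L₂) hε.1 hf
      have hsg := contDiff_moll (L₁ := L₁) (L₂ := L₂) hε.1 hg
      have hδ1 : δ < p.1 := hp.2.1
      have hδ2 : δ < p.2 := hp.2.2
      have h1 : ‖moll L₁ L₂ ε f p‖ₑ ≤ sobC L₁ *
          ∫⁻ s in Ioo 0 L₁, (‖moll L₁ L₂ ε f (s, p.2)‖ₑ + ‖moll L₁ L₂ ε g (s, p.2)‖ₑ) := by
        refine enorm_le_sobC (F := fun s => moll L₁ L₂ ε f (s, p.2))
          (F' := fun s => moll L₁ L₂ ε g (s, p.2)) (δ := δ) hL₁ hδ.le hδL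
          (hsm.continuous.measurable.comp (measurable_id.prodMk measurable_const))
          (hsg.continuous.comp (continuous_id.prodMk continuous_const)) (fun s hs => ?_)
          (x := p.1) ⟨hδ1, hp.1.1.2⟩
        rw [← h.dd_moll hε.1 hf (p := (s, p.2)) ⟨⟨hδ.trans hs.1, hs.2⟩, hp.1.2⟩
          (by have := hs.1; simp only []; linarith [hε.2]) (by simp only []; linarith [hε.2])]
        exact hasDerivAt_slice_x hsm s p.2
      have h2 : ∫⁻ s in Ioo 0 L₁, (‖moll L₁ L₂ ε f (s, p.2)‖ₑ + ‖moll L₁ L₂ ε g (s, p.2)‖ₑ) ≤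
          ∫⁻ s in Ioo 0 L₁, ((‖moll L₁ L₂ ε f (s, p.2) - f (s, p.2)‖ₑ +
            ‖moll L₁ L₂ ε g (s, p.2) - g (s, p.2)‖ₑ) + (‖f (s, p.2)‖ₑ + ‖g (s, p.2)‖ₑ)) := by
        refine lintegral_mono fun s => ?_
        have hab : ∀ a b : ℝ, ‖a‖ₑ ≤ ‖a - b‖ₑ + ‖b‖ₑ := fun a b => by
          simpa using enorm_add_le (a - b) b
        calc _ ≤ (‖moll L₁ L₂ ε f (s, p.2) - f (s, p.2)‖ₑ + ‖f (s, p.2)‖ₑ) +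
            (‖moll L₁ L₂ ε g (s, p.2) - g (s, p.2)‖ₑ + ‖g (s, p.2)‖ₑ) := by
              gcongr <;> exact hab _ _
          _ = _ := by ring
      have h3 : ‖f p‖ₑ ≤ ‖moll L₁ L₂ ε f p - f p‖ₑ + ‖moll L₁ L₂ ε f p‖ₑ := by
        rw [← enorm_neg (moll L₁ L₂ ε f p - f p)]
        simpa using enorm_add_le (-(moll L₁ L₂ ε f p - f p)) (moll L₁ L₂ ε f p)
      have hpm' : AEMeasurable (fun s => ‖f (s, p.2)‖ₑ + ‖g (s, p.2)‖ₑ)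
        (volume.restrict (Ioo 0 L₁)) := hpm
      rw [lintegral_add_right' _ hpm'] at h2
      refine (h3.trans (add_le_add le_rfl (h1.trans (mul_le_mul' le_rfl h2)))).trans (le_of_eq ?_)
      simp only [sliceX]
      ring
    · have hlim : Tendsto (fun ε => (∫⁻ p in rect L₁ L₂, ‖moll L₁ L₂ ε f p - f p‖ₑ) +
          sobC L₁ * (ENNReal.ofReal L₁ * ((∫⁻ p in rect L₁ L₂, ‖moll L₁ L₂ ε f p - f p‖ₑ) +
            ∫⁻ p in rect L₁ L₂, ‖moll L₁ L₂ ε g p - g p‖ₑ))) (𝓝[>] 0) (𝓝 0) := by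
        have t1 := tendsto_lintegral_moll_sub hf
        have t2 := tendsto_lintegral_moll_sub hg
        simpa using t1.add (ENNReal.Tendsto.const_mul (ENNReal.Tendsto.const_mul (t1.add t2)
          (Or.inr ENNReal.ofReal_ne_top)) (Or.inr (sobC_ne_top L₁)))
      refine tendsto_of_tendsto_of_tendsto_of_le_of_le' tendsto_const_nhds hlim
        (Eventually.of_forall fun _ => zero_le) ?_
      filter_upwards [eventually_memLp_moll hf, eventually_memLp_moll hg] with ε hεf hεg
      have hmf : AEMeasurable (fun p => ‖moll L₁ L₂ ε f p - f p‖ₑ)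
        (volume.restrict (rect L₁ L₂)) := (hεf.sub hf).1.enorm
      have hmg : AEMeasurable (fun p => ‖moll L₁ L₂ ε g p - g p‖ₑ)
        (volume.restrict (rect L₁ L₂)) := (hεg.sub hg).1.enorm
      have hmfg : AEMeasurable (fun p => ‖moll L₁ L₂ ε f p - f p‖ₑ + ‖moll L₁ L₂ ε g p - g p‖ₑ)
        (volume.restrict (rect L₁ L₂)) := hmf.add hmg
      refine (lintegral_mono' hle le_rfl).trans (le_of_eq ?_)
      rw [lintegral_add_left' hmf, lintegral_const_mul'' _ (by
          have h1 := aemeasurable_sliceX hmfg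
          rw [restrict_rect_eq_prod]
          exact h1.comp_snd), lintegral_sliceX_snd hmfg, lintegral_add_left' hmf]
  have hall : ∀ n : ℕ, ∀ᵐ p ∂(volume.restrict (rect L₁ L₂)),
      p ∈ Ioi (L₁ / 2 / (n + 1)) ×ˢ Ioi (L₁ / 2 / (n + 1)) →
      ‖f p‖ₑ ≤ sobC L₁ * sliceX L₁ (fun q => ‖f q‖ₑ + ‖g q‖ₑ) p.2 := by
    intro n
    have h1 := key (L₁ / 2 / (n + 1)) (by positivity)
      (div_le_self (by positivity) (by linarith [n.cast_nonneg (α := ℝ)]))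
    rw [ae_restrict_iff' ((measurableSet_rect L₁ L₂).inter
        (measurableSet_Ioi.prod measurableSet_Ioi))] at h1
    rw [ae_restrict_iff' (measurableSet_rect L₁ L₂)]
    filter_upwards [h1] with p hp h2 h3 using hp ⟨h2, h3⟩
  filter_upwards [ae_all_iff.2 hall, ae_restrict_mem (measurableSet_rect L₁ L₂)] with p hp hpm
  have h0 : 0 < min p.1 p.2 := lt_min hpm.1.1 hpm.2.1
  obtain ⟨n, hn⟩ := exists_nat_gt (L₁ / 2 / min p.1 p.2)
  have hn' : L₁ / 2 / (n + 1) < min p.1 p.2 := by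
    rw [div_lt_iff₀ h0] at hn
    rw [div_lt_iff₀ (by positivity)]
    nlinarith
  exact hp n ⟨hn'.trans_le (min_le_left _ _), hn'.trans_le (min_le_right _ _)⟩

/-! ### Exchanging the variables -/

lemma memLp_swap {L₁ L₂ : ℝ} {f : ℝ × ℝ → ℝ} {q : ℝ≥0∞}
    (hf : MemLp f q (volume.restrict (rect L₁ L₂))) :
    MemLp (fun p => f p.swap) q (volume.restrict (rect L₂ L₁)) :=
  hf.comp_measurePreserving (measurePreserving_swap_rect L₂ L₁)

lemma setIntegral_swap {L₁ L₂ : ℝ} (f : ℝ × ℝ → ℝ) :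
    ∫ p in rect L₂ L₁, f p.swap = ∫ p in rect L₁ L₂, f p :=
  (measurePreserving_swap_rect L₂ L₁).integral_comp measurableEmbedding_swap f

lemma setLIntegral_swap {L₁ L₂ : ℝ} (f : ℝ × ℝ → ℝ≥0∞) :
    ∫⁻ p in rect L₂ L₁, f p.swap = ∫⁻ p in rect L₁ L₂, f p :=
  (measurePreserving_swap_rect L₂ L₁).lintegral_comp_emb measurableEmbedding_swap f

lemma dd_swap {φ : ℝ × ℝ → ℝ} (hφ : ContDiff ℝ ∞ φ) (e p : ℝ × ℝ) :
    dd e (fun q => φ q.swap) p = dd e.swap φ p.swap := by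
  have h1 : HasFDerivAt (fun q : ℝ × ℝ => φ q.swap)
      ((fderiv ℝ φ p.swap).comp
        ((ContinuousLinearMap.snd ℝ ℝ ℝ).prod (ContinuousLinearMap.fst ℝ ℝ ℝ))) p :=
    (differentiable_of_smooth hφ p.swap).hasFDerivAt.comp p
      (hasFDerivAt_snd.prodMk hasFDerivAt_fst)
  rw [dd, h1.fderiv]
  rfl

lemma TestOn.swap {L₁ L₂ : ℝ} {φ : ℝ × ℝ → ℝ} (h : TestOn (rect L₂ L₁) φ) :
    TestOn (rect L₁ L₂) fun p => φ p.swap := by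
  refine ⟨h.1.comp (contDiff_snd.prodMk contDiff_fst),
    h.2.1.comp_homeomorph (Homeomorph.prodComm ℝ ℝ), ?_⟩
  have h1 : tsupport (fun p : ℝ × ℝ => φ p.swap) ⊆ Prod.swap ⁻¹' tsupport φ :=
    tsupport_comp_subset_preimage φ continuous_swap
  intro p hp
  have h2 := h.2.2 (h1 hp)
  exact ⟨h2.2, h2.1⟩

lemma WD.swap {L₁ L₂ : ℝ} {e : ℝ × ℝ} {f g : ℝ × ℝ → ℝ} (h : WD L₁ L₂ e f g) :
    WD L₂ L₁ e.swap (fun p => f p.swap) (fun p => g p.swap) := by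
  intro φ hφ
  have h1 := h _ hφ.swap
  simp only [dd_swap hφ.1] at h1
  rw [← setIntegral_swap (fun p => f p * dd e.swap φ p.swap),
    ← setIntegral_swap (fun p => g p * φ p.swap)] at h1
  simpa using h1

lemma ae_swap {L₁ L₂ : ℝ} {P : ℝ × ℝ → Prop} (h : ∀ᵐ p ∂(volume.restrict (rect L₂ L₁)), P p) :
    ∀ᵐ p ∂(volume.restrict (rect L₁ L₂)), P p.swap :=
  (measurePreserving_swap_rect L₁ L₂).quasiMeasurePreserving.ae h

/-- A function with a weak derivative in the second variable is bounded, almost everywhere, in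
terms of the integrals over vertical slices. -/
lemma WD.ae_enorm_le_sliceY {L₁ L₂ : ℝ} (hL₂ : 0 < L₂) {f g : ℝ × ℝ → ℝ}
    (h : WD L₁ L₂ (0, 1) f g) (hf : MemLp f 2 (volume.restrict (rect L₁ L₂)))
    (hg : MemLp g 2 (volume.restrict (rect L₁ L₂))) :
    ∀ᵐ p ∂(volume.restrict (rect L₁ L₂)),
      ‖f p‖ₑ ≤ sobC L₂ * sliceX L₂ (fun q => ‖f q.swap‖ₑ + ‖g q.swap‖ₑ) p.1 := by
  have h1 := ae_swap ((h.swap).ae_enorm_le_sliceX hL₂ (memLp_swap hf) (memLp_swap hg))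
  filter_upwards [h1] with p hp
  simpa using hp

/-! ### Estimates of products -/

lemma sq_add_le (a b : ℝ≥0∞) : (a + b) ^ 2 ≤ 2 * (a ^ 2 + b ^ 2) := by
  have := ENNReal.rpow_add_le_mul_rpow_add_rpow a b (p := 2) (by norm_num)
  simp only [ENNReal.rpow_two] at this
  refine this.trans (le_of_eq ?_)
  norm_num

/-- Cauchy–Schwarz on each slice of length `L₁`, then Tonelli. -/
lemma lintegral_sq_slice_le {L₁ L₂ : ℝ} {f g : ℝ × ℝ → ℝ}
    (hf : MemLp f 2 (volume.restrict (rect L₁ L₂)))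
    (hg : MemLp g 2 (volume.restrict (rect L₁ L₂))) :
    ∫⁻ y in Ioo 0 L₂, sliceX L₁ (fun q => ‖f q‖ₑ + ‖g q‖ₑ) y ^ 2 ≤
      ENNReal.ofReal L₁ * (2 * (eLpNorm f 2 (volume.restrict (rect L₁ L₂)) ^ 2 +
        eLpNorm g 2 (volume.restrict (rect L₁ L₂)) ^ 2)) := by
  have hm : AEMeasurable (fun q => ‖f q‖ₑ + ‖g q‖ₑ) (volume.restrict (rect L₁ L₂)) :=
    hf.1.enorm.add hg.1.enorm
  have hm' := hm
  rw [restrict_rect_eq_prod] at hm'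
  have hs := hm'.prod_swap.aestronglyMeasurable.prodMk_left
  calc ∫⁻ y in Ioo 0 L₂, sliceX L₁ (fun q => ‖f q‖ₑ + ‖g q‖ₑ) y ^ 2
      ≤ ∫⁻ y in Ioo 0 L₂, ENNReal.ofReal L₁ * sliceX L₁ (fun q => (‖f q‖ₑ + ‖g q‖ₑ) ^ 2) y := by
        refine lintegral_mono_ae ?_
        filter_upwards [hs] with y hy
        have := sq_lintegral_mul_le (μ := volume.restrict (Ioo 0 L₁)) (K := fun _ => 1)
          (h := fun s => ‖f (s, y)‖ₑ + ‖g (s, y)‖ₑ) aemeasurable_const hy.aemeasurable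
        simpa [sliceX] using this
    _ = ENNReal.ofReal L₁ * ∫⁻ p in rect L₁ L₂, (‖f p‖ₑ + ‖g p‖ₑ) ^ 2 := by
        rw [lintegral_const_mul'' _ (aemeasurable_sliceX (hm.pow_const 2)),
          lintegral_sliceX (hm.pow_const 2)]
    _ ≤ _ := by
        gcongr
        rw [eLpNorm_two_sq, eLpNorm_two_sq, ← lintegral_add_left' (hf.1.enorm.pow_const 2),
          ← lintegral_const_mul'' _ (show AEMeasurable (fun p => ‖f p‖ₑ ^ 2 + ‖g p‖ₑ ^ 2) _ from
            (hf.1.enorm.pow_const 2).add (hg.1.enorm.pow_const 2))]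
        exact lintegral_mono fun p => sq_add_le _ _

lemma eLpNorm_swap {L₁ L₂ : ℝ} {f : ℝ × ℝ → ℝ}
    (hf : MemLp f 2 (volume.restrict (rect L₁ L₂))) :
    eLpNorm (fun p => f p.swap) 2 (volume.restrict (rect L₂ L₁)) =
      eLpNorm f 2 (volume.restrict (rect L₁ L₂)) :=
  eLpNorm_comp_measurePreserving hf.1 (measurePreserving_swap_rect L₂ L₁)

/-- The product of a function with a weak derivative in `x` and a function with a weak
derivative in `y` is square integrable. -/
lemma eLpNorm_mul_sq_le {L₁ L₂ : ℝ} (hL₁ : 0 < L₁) (hL₂ : 0 < L₂) :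
    ∃ C : ℝ≥0∞, C ≠ ⊤ ∧ ∀ f fx d dy : ℝ × ℝ → ℝ, WD L₁ L₂ (1, 0) f fx → WD L₁ L₂ (0, 1) d dy →
      MemLp f 2 (volume.restrict (rect L₁ L₂)) → MemLp fx 2 (volume.restrict (rect L₁ L₂)) →
      MemLp d 2 (volume.restrict (rect L₁ L₂)) → MemLp dy 2 (volume.restrict (rect L₁ L₂)) →
      eLpNorm (fun p => f p * d p) 2 (volume.restrict (rect L₁ L₂)) ^ 2 ≤
        C * ((eLpNorm f 2 (volume.restrict (rect L₁ L₂)) ^ 2 +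
            eLpNorm fx 2 (volume.restrict (rect L₁ L₂)) ^ 2) *
          (eLpNorm d 2 (volume.restrict (rect L₁ L₂)) ^ 2 +
            eLpNorm dy 2 (volume.restrict (rect L₁ L₂)) ^ 2)) := by
  refine ⟨(sobC L₁ ^ 2 * (ENNReal.ofReal L₁ * 2)) * (sobC L₂ ^ 2 * (ENNReal.ofReal L₂ * 2)),
    ?_, ?_⟩
  · have h := sobC_ne_top
    finiteness [h L₁, h L₂]
  intro f fx d dy hfx hdy hf2 hfx2 hd2 hdy2
  set A := sliceX L₁ (fun q => ‖f q‖ₑ + ‖fx q‖ₑ) with hA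
  set B := sliceX L₂ (fun q => ‖d q.swap‖ₑ + ‖dy q.swap‖ₑ) with hB
  have hAm : AEMeasurable A (volume.restrict (Ioo 0 L₂)) :=
    aemeasurable_sliceX (hf2.1.enorm.add hfx2.1.enorm)
  have hBm : AEMeasurable B (volume.restrict (Ioo 0 L₁)) :=
    aemeasurable_sliceX ((memLp_swap hd2).1.enorm.add (memLp_swap hdy2).1.enorm)
  have hA2 := lintegral_sq_slice_le hf2 hfx2
  have hB2 := lintegral_sq_slice_le (memLp_swap hd2) (memLp_swap hdy2)
  rw [eLpNorm_swap hd2, eLpNorm_swap hdy2] at hB2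
  rw [eLpNorm_two_sq (fun p => f p * d p)]
  -- The bound for `f` depends on `y` only and the bound for `d` on `x` only, so the integral of the
  -- product of their squares factors.
  calc ∫⁻ p in rect L₁ L₂, ‖f p * d p‖ₑ ^ 2
      ≤ ∫⁻ p in rect L₁ L₂, (sobC L₂ * B p.1) ^ 2 * (sobC L₁ * A p.2) ^ 2 := by
        refine lintegral_mono_ae ?_
        filter_upwards [hfx.ae_enorm_le_sliceX hL₁ hf2 hfx2, hdy.ae_enorm_le_sliceY hL₂ hd2 hdy2]
          with p h1 h2
        rw [enorm_mul, mul_pow, mul_comm]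
        gcongr
    _ = (∫⁻ x in Ioo 0 L₁, (sobC L₂ * B x) ^ 2) * ∫⁻ y in Ioo 0 L₂, (sobC L₁ * A y) ^ 2 := by
        rw [restrict_rect_eq_prod]
        exact lintegral_prod_mul ((hBm.const_mul _).pow_const 2) ((hAm.const_mul _).pow_const 2)
    _ = (sobC L₂ ^ 2 * ∫⁻ x in Ioo 0 L₁, B x ^ 2) * (sobC L₁ ^ 2 * ∫⁻ y in Ioo 0 L₂, A y ^ 2) := by
        simp only [mul_pow]
        rw [lintegral_const_mul'' _ (hBm.pow_const 2), lintegral_const_mul'' _ (hAm.pow_const 2)]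
    _ ≤ _ := mul_le_mul' (mul_le_mul' le_rfl hB2) (mul_le_mul' le_rfl hA2)
    _ = _ := by ring

/-- The Sobolev inequality on the rectangle, for functions with a mixed derivative. -/
lemma ae_enorm_le_of_mixed {L₁ L₂ : ℝ} (hL₁ : 0 < L₁) (hL₂ : 0 < L₂) {f fx fy fxy : ℝ × ℝ → ℝ}
    (hx : WD L₁ L₂ (1, 0) f fx) (hy : WD L₁ L₂ (0, 1) f fy) (hxy : WD L₁ L₂ (0, 1) fx fxy)
    (hf : MemLp f 2 (volume.restrict (rect L₁ L₂)))
    (hfx : MemLp fx 2 (volume.restrict (rect L₁ L₂)))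
    (hfy : MemLp fy 2 (volume.restrict (rect L₁ L₂)))
    (hfxy : MemLp fxy 2 (volume.restrict (rect L₁ L₂))) :
    ∀ᵐ p ∂(volume.restrict (rect L₁ L₂)), ‖f p‖ₑ ≤ sobC L₁ * (sobC L₂ *
      (∫⁻ q in rect L₁ L₂, ((‖f q‖ₑ + ‖fy q‖ₑ) + (‖fx q‖ₑ + ‖fxy q‖ₑ)))) := by
  have h1 := hx.ae_enorm_le_sliceX hL₁ hf hfx
  have h2 := (hy.ae_enorm_le_sliceY hL₂ hf hfy).and (hxy.ae_enorm_le_sliceY hL₂ hfx hfxy)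
  have hm1 : AEMeasurable (fun q => ‖f q‖ₑ + ‖fy q‖ₑ) (volume.restrict (rect L₁ L₂)) :=
    hf.1.enorm.add hfy.1.enorm
  have hm2 : AEMeasurable (fun q => ‖fx q‖ₑ + ‖fxy q‖ₑ) (volume.restrict (rect L₁ L₂)) :=
    hfx.1.enorm.add hfxy.1.enorm
  have hsw : ∀ {h : ℝ × ℝ → ℝ≥0∞}, AEMeasurable h (volume.restrict (rect L₁ L₂)) →
      AEMeasurable (fun q : ℝ × ℝ => h q.swap) (volume.restrict (rect L₂ L₁)) := fun hh =>
    hh.comp_quasiMeasurePreserving (measurePreserving_swap_rect L₂ L₁).quasiMeasurePreserving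
  have hm1' := hsw hm1
  have hm2' := hsw hm2
  -- The bounds by vertical slices hold almost everywhere in the rectangle. They are needed at
  -- almost every point of the horizontal line through almost every `p`, which is Fubini after
  -- exchanging the variables.
  have h3 : ∀ᵐ p ∂(volume.restrict (rect L₁ L₂)), ∀ᵐ s ∂(volume.restrict (Ioo 0 L₁)),
      ‖f (s, p.2)‖ₑ ≤ sobC L₂ * sliceX L₂ (fun q => ‖f q.swap‖ₑ + ‖fy q.swap‖ₑ) s ∧
      ‖fx (s, p.2)‖ₑ ≤ sobC L₂ * sliceX L₂ (fun q => ‖fx q.swap‖ₑ + ‖fxy q.swap‖ₑ) s := by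
    have h4 := ae_swap (L₁ := L₂) (L₂ := L₁) h2
    rw [restrict_rect_eq_prod] at h4 ⊢
    exact Measure.quasiMeasurePreserving_snd.ae (Measure.ae_ae_of_ae_prod h4)
  filter_upwards [h1, h3] with p hp1 hp3
  refine hp1.trans ?_
  gcongr
  calc sliceX L₁ (fun q => ‖f q‖ₑ + ‖fx q‖ₑ) p.2
      ≤ ∫⁻ s in Ioo 0 L₁, (sobC L₂ * sliceX L₂ (fun q => ‖f q.swap‖ₑ + ‖fy q.swap‖ₑ) s +
          sobC L₂ * sliceX L₂ (fun q => ‖fx q.swap‖ₑ + ‖fxy q.swap‖ₑ) s) := by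
        refine lintegral_mono_ae ?_
        filter_upwards [hp3] with s hs
        exact add_le_add hs.1 hs.2
    _ = _ := by
        rw [lintegral_add_left' ((aemeasurable_sliceX hm1').const_mul _),
          lintegral_const_mul'' _ (aemeasurable_sliceX hm1'),
          lintegral_const_mul'' _ (aemeasurable_sliceX hm2'), lintegral_sliceX hm1',
          lintegral_sliceX hm2', setLIntegral_swap (fun q => ‖f q‖ₑ + ‖fy q‖ₑ),
          setLIntegral_swap (fun q => ‖fx q‖ₑ + ‖fxy q‖ₑ), lintegral_add_left' hm1, mul_add]

/-- The bound of the previous lemma in terms of the norms in `L²`. -/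
lemma eLpNorm_top_le_of_mixed {L₁ L₂ : ℝ} (hL₁ : 0 < L₁) (hL₂ : 0 < L₂) :
    ∃ C : ℝ≥0∞, C ≠ ⊤ ∧ ∀ f fx fy fxy : ℝ × ℝ → ℝ, WD L₁ L₂ (1, 0) f fx →
      WD L₁ L₂ (0, 1) f fy → WD L₁ L₂ (0, 1) fx fxy →
      MemLp f 2 (volume.restrict (rect L₁ L₂)) → MemLp fx 2 (volume.restrict (rect L₁ L₂)) →
      MemLp fy 2 (volume.restrict (rect L₁ L₂)) → MemLp fxy 2 (volume.restrict (rect L₁ L₂)) →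
      eLpNorm f ⊤ (volume.restrict (rect L₁ L₂)) ≤
        C * ((eLpNorm f 2 (volume.restrict (rect L₁ L₂)) +
            eLpNorm fy 2 (volume.restrict (rect L₁ L₂))) +
          (eLpNorm fx 2 (volume.restrict (rect L₁ L₂)) +
            eLpNorm fxy 2 (volume.restrict (rect L₁ L₂)))) := by
  have hV : volume (rect L₁ L₂) ^ (1 / 2 : ℝ) ≠ ⊤ :=
    ENNReal.rpow_ne_top_of_nonneg (by norm_num) (volume_rect_ne_top L₁ L₂)
  refine ⟨sobC L₁ * (sobC L₂ * volume (rect L₁ L₂) ^ (1 / 2 : ℝ)),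
    ENNReal.mul_ne_top (sobC_ne_top _) (ENNReal.mul_ne_top (sobC_ne_top _) hV), ?_⟩
  intro f fx fy fxy hx hy hxy hf hfx hfy hfxy
  rw [eLpNorm_exponent_top]
  refine (eLpNormEssSup_le_of_ae_enorm_bound (ae_enorm_le_of_mixed hL₁ hL₂ hx hy hxy hf hfx hfy hfxy)).trans ?_
  rw [mul_assoc, mul_assoc]
  gcongr
  have hm1 : AEMeasurable (fun q => ‖f q‖ₑ + ‖fy q‖ₑ) (volume.restrict (rect L₁ L₂)) :=
    hf.1.enorm.add hfy.1.enorm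
  rw [lintegral_add_left' hm1, lintegral_add_left' hf.1.enorm, lintegral_add_left' hfx.1.enorm,
    mul_comm, add_mul, add_mul, add_mul]
  gcongr
  · exact lintegral_enorm_le_L2 hf.1
  · exact lintegral_enorm_le_L2 hfy.1
  · exact lintegral_enorm_le_L2 hfx.1
  · exact lintegral_enorm_le_L2 hfxy.1

/-! ### The Lipschitz representative -/

lemma abs_moll_le {L₁ L₂ ε M : ℝ} (hε : 0 < ε) {g : ℝ × ℝ → ℝ}
    (hM : ∀ᵐ p ∂(volume.restrict (rect L₁ L₂)), |g p| ≤ M) (hM0 : 0 ≤ M) (p : ℝ × ℝ) :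
    |moll L₁ L₂ ε g p| ≤ M := by
  have hk : Integrable fun q => ker ε (p - q) := (ker_testOn hε).integrable.comp_sub_left p
  rw [moll, cv_ext, ← Real.norm_eq_abs]
  calc ‖∫ q in rect L₁ L₂, g q * ker ε (p - q)‖ ≤ ∫ q in rect L₁ L₂, M * ker ε (p - q) := by
        refine norm_integral_le_of_norm_le (hk.const_mul _).integrableOn ?_
        filter_upwards [hM] with q hq
        rw [norm_mul, Real.norm_eq_abs, Real.norm_eq_abs, abs_of_nonneg (ker_nonneg ε _)]
        exact mul_le_mul_of_nonneg_right hq (ker_nonneg ε _)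
    _ ≤ ∫ q, M * ker ε (p - q) := setIntegral_le_integral (hk.const_mul _)
        (Eventually.of_forall fun q => mul_nonneg hM0 (ker_nonneg ε _))
    _ = M := by rw [integral_const_mul, integral_ker_sub hε, mul_one]

lemma exists_ae_bound {L₁ L₂ : ℝ} {g : ℝ × ℝ → ℝ}
    (hg : MemLp g ⊤ (volume.restrict (rect L₁ L₂))) :
    ∃ M, 0 ≤ M ∧ ∀ᵐ p ∂(volume.restrict (rect L₁ L₂)), |g p| ≤ M := by
  refine ⟨(eLpNorm g ⊤ (volume.restrict (rect L₁ L₂))).toReal, ENNReal.toReal_nonneg, ?_⟩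
  have h1 := ae_le_eLpNormEssSup (f := g) (μ := volume.restrict (rect L₁ L₂))
  filter_upwards [h1] with p hp
  rw [← eLpNorm_exponent_top] at hp
  have := ENNReal.toReal_mono hg.2.ne hp
  simpa using this

lemma norm_fderiv_le {f : ℝ × ℝ → ℝ} {M : ℝ} {p : ℝ × ℝ} (hx : |dd (1, 0) f p| ≤ M)
    (hy : |dd (0, 1) f p| ≤ M) : ‖fderiv ℝ f p‖ ≤ 2 * M := by
  have hM : 0 ≤ M := (abs_nonneg _).trans hx
  refine ContinuousLinearMap.opNorm_le_bound _ (by positivity) fun v => ?_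
  have h1 : fderiv ℝ f p v = v.1 * dd (1, 0) f p + v.2 * dd (0, 1) f p := by
    have : v = v.1 • ((1, 0) : ℝ × ℝ) + v.2 • ((0, 1) : ℝ × ℝ) := by ext <;> simp
    conv_lhs => rw [this]
    rw [map_add, map_smul, map_smul]
    rfl
  rw [h1, Real.norm_eq_abs]
  have h2 : |v.1| ≤ ‖v‖ := norm_fst_le v
  have h3 : |v.2| ≤ ‖v‖ := norm_snd_le v
  calc |v.1 * dd (1, 0) f p + v.2 * dd (0, 1) f p|
      ≤ |v.1| * |dd (1, 0) f p| + |v.2| * |dd (0, 1) f p| := by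
        rw [← abs_mul, ← abs_mul]; exact abs_add_le _ _
    _ ≤ ‖v‖ * M + ‖v‖ * M := by gcongr
    _ = 2 * M * ‖v‖ := by ring

/-- A bounded function with bounded weak gradient has a bounded Lipschitz representative. -/
lemma exists_lipschitz_ae_eq {L₁ L₂ : ℝ} {f fx fy : ℝ × ℝ → ℝ} (hx : WD L₁ L₂ (1, 0) f fx)
    (hy : WD L₁ L₂ (0, 1) f fy) (hf : MemLp f ⊤ (volume.restrict (rect L₁ L₂)))
    (hfx : MemLp fx ⊤ (volume.restrict (rect L₁ L₂)))
    (hfy : MemLp fy ⊤ (volume.restrict (rect L₁ L₂))) :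
    ∃ (g : ℝ × ℝ → ℝ) (K : NNReal) (M : ℝ), LipschitzWith K g ∧ (∀ p, |g p| ≤ M) ∧
      f =ᵐ[volume.restrict (rect L₁ L₂)] g := by
  obtain ⟨M₀, hM₀, hb₀⟩ := exists_ae_bound hf
  obtain ⟨M₁, hM₁, hb₁⟩ := exists_ae_bound hfx
  obtain ⟨M₂, hM₂, hb₂⟩ := exists_ae_bound hfy
  set ε : ℕ → ℝ := fun n => 1 / ((n : ℝ) + 1) with hε
  have hεpos : ∀ n, 0 < ε n := fun n => by positivity
  have hεt : Tendsto ε atTop (𝓝[>] 0) :=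
    tendsto_nhdsWithin_iff.2 ⟨tendsto_one_div_add_atTop_nhds_zero_nat, Eventually.of_forall hεpos⟩
  have ht := tendstoInMeasure_of_tendsto_eLpNorm (p := 2) (by norm_num)
    (fun n => (memLp_moll (L₁ := L₁) (L₂ := L₂) (hεpos n) hf.of_top).1) hf.of_top.1
    ((tendsto_moll hf.of_top).comp hεt)
  obtain ⟨ns, hns, hae⟩ := ht.exists_seq_tendsto_ae
  set S := {p | p ∈ rect L₁ L₂ ∧ |f p| ≤ M₀ ∧
    Tendsto (fun n => moll L₁ L₂ (ε (ns n)) f p) atTop (𝓝 (f p))} with hS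
  -- The factor `2` comes from `norm_fderiv_le`: the plane carries the maximum norm, so the two
  -- partial derivatives add.
  set K : NNReal := ⟨2 * max M₁ M₂, by positivity⟩ with hK
  have hLip : LipschitzOnWith K f S := by
    refine LipschitzOnWith.of_dist_le_mul fun p hp q hq => ?_
    have h0 : 0 < min (min p.1 p.2) (min q.1 q.2) :=
      lt_min (lt_min hp.1.1.1 hp.1.2.1) (lt_min hq.1.1.1 hq.1.2.1)
    refine le_of_tendsto (hp.2.2.dist hq.2.2) ?_
    filter_upwards [(hεt.comp hns.tendsto_atTop).eventually (eventually_three_mul_lt h0)] with n hn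
    simp only [Function.comp] at hn
    have hn2 := hn.2
    simp only [lt_min_iff] at hn2
    -- Both points eventually lie in this convex set, on which the gradient of the mollification is
    -- the mollified gradient and hence bounded uniformly in the scale.
    have hc : Convex ℝ (rect L₁ L₂ ∩ Ioi (3 * ε (ns n)) ×ˢ Ioi (3 * ε (ns n))) :=
      ((convex_Ioo _ _).prod (convex_Ioo _ _)).inter ((convex_Ioi _).prod (convex_Ioi _))
    have hbd := hc.norm_image_sub_le_of_norm_fderiv_le (𝕜 := ℝ)
      (f := moll L₁ L₂ (ε (ns n)) f) (C := 2 * max M₁ M₂)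
      (fun r _ => differentiable_of_smooth (contDiff_moll hn.1 hf.of_top) r)
      (fun r hr => norm_fderiv_le
        (by
          rw [hx.dd_moll hn.1 hf.of_top hr.1 hr.2.1 hr.2.2]
          exact (abs_moll_le hn.1 hb₁ hM₁ r).trans (le_max_left _ _))
        (by
          rw [hy.dd_moll hn.1 hf.of_top hr.1 hr.2.1 hr.2.2]
          exact (abs_moll_le hn.1 hb₂ hM₂ r).trans (le_max_right _ _)))
      (x := q) ⟨hq.1, hn2.2.1, hn2.2.2⟩ (y := p) ⟨hp.1, hn2.1.1, hn2.1.2⟩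
    rw [dist_eq_norm, dist_eq_norm]
    exact hbd
  -- The restriction to the set of convergence extends to a Lipschitz function on the plane.
  -- Truncation at `±M₀` keeps the Lipschitz constant and supplies the global bound.
  obtain ⟨g, hg, hfg⟩ := hLip.extend_real
  refine ⟨fun p => max (-M₀) (min (g p) M₀), K, M₀, (hg.min_const M₀).const_max _,
    fun p => abs_le.2 ⟨le_max_left _ _, max_le (by linarith) (min_le_right _ _)⟩, ?_⟩
  filter_upwards [hae, hb₀, ae_restrict_mem (measurableSet_rect L₁ L₂)] with p h1 h2 h3
  have hpS : p ∈ S := ⟨h3, h2, h1⟩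
  rw [← hfg hpS, min_eq_left (abs_le.1 h2).2, max_eq_right (abs_le.1 h2).1]

/-! ### Testing traces against Lipschitz functions -/

lemma h1Norm_le {R M K : ℝ} (hR : 0 ≤ R) {ψ : ℝ → ℝ} (hψ : IsTest1 R ψ) (hM : ∀ t, |ψ t| ≤ M)
    (hK : ∀ t, |deriv ψ t| ≤ K) : h1Norm R ψ ≤ Real.sqrt (R * (M ^ 2 + K ^ 2)) := by
  refine Real.sqrt_le_sqrt ?_
  have hi : IntegrableOn (fun t => ψ t ^ 2 + deriv ψ t ^ 2) (Ioo 0 R) := by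
    have hc : Continuous fun t => ψ t ^ 2 + deriv ψ t ^ 2 :=
      (hψ.1.continuous.pow 2).add ((hψ.1.continuous_deriv (by simp)).pow 2)
    exact (hc.integrableOn_Icc (a := 0) (b := R)).mono_set Ioo_subset_Icc_self
  calc ∫ t in Ioo 0 R, (ψ t ^ 2 + deriv ψ t ^ 2) ≤ ∫ _ in Ioo 0 R, (M ^ 2 + K ^ 2) := by
        refine setIntegral_mono hi (by simp) fun t => ?_
        have h1 := sq_le_sq' (abs_le.1 (hM t)).1 (abs_le.1 (hM t)).2
        have h2 := sq_le_sq' (abs_le.1 (hK t)).1 (abs_le.1 (hK t)).2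
        exact add_le_add h1 h2
    _ = R * (M ^ 2 + K ^ 2) := by simp [hR]

/-- Lipschitz functions with compact support may be approximated by test functions. -/
lemma exists_isTest1_approx {R M r δ : ℝ} {K : NNReal} {ψ : ℝ → ℝ} (hψ : LipschitzWith K ψ)
    (hM : ∀ t, |ψ t| ≤ M) (hs : ∀ t, ψ t ≠ 0 → r ≤ t ∧ t ≤ R - r) (hδ : 0 < δ) (hδr : δ < r) :
    ∃ ψ', IsTest1 R ψ' ∧ (∀ t, |ψ' t| ≤ M) ∧ (∀ t, |deriv ψ' t| ≤ K) ∧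
      ∀ t, |ψ' t - ψ t| ≤ K * δ := by
  have hM0 : 0 ≤ M := (abs_nonneg _).trans (hM 0)
  -- The radius `δ < r` keeps the mollified support `[r - δ, R - r + δ]` inside `(0, R)`.
  let φ : ContDiffBump (0 : ℝ) := ⟨δ / 2, δ, by positivity, by linarith⟩
  set ψ' : ℝ → ℝ := convolution (φ.normed volume) ψ (ContinuousLinearMap.lsmul ℝ ℝ) volume
    with hψ'
  have hval : ∀ x, ψ' x = ∫ t, φ.normed volume t * ψ (x - t) := fun x => by
    simp [hψ', convolution]
  have hint : ∀ x, Integrable fun t => φ.normed volume t * ψ (x - t) := fun x =>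
    ((φ.continuous_normed.mul (hψ.continuous.comp (continuous_const.sub continuous_id)))
      ).integrable_of_hasCompactSupport φ.hasCompactSupport_normed.mul_right
  have hbd : ∀ (g : ℝ → ℝ) (B : ℝ), (∀ t, |g t| ≤ B) → |∫ t, φ.normed volume t * g t| ≤ B := by
    intro g B hB
    rw [← Real.norm_eq_abs]
    calc ‖∫ t, φ.normed volume t * g t‖ ≤ ∫ t, φ.normed volume t * B := by
          refine norm_integral_le_of_norm_le (φ.integrable_normed.mul_const _)
            (Eventually.of_forall fun t => ?_)
          rw [norm_mul, Real.norm_eq_abs, Real.norm_eq_abs, abs_of_nonneg (φ.nonneg_normed t)]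
          exact mul_le_mul_of_nonneg_left (hB t) (φ.nonneg_normed t)
      _ = B := by rw [integral_mul_const, φ.integral_normed, one_mul]
  have hLip : LipschitzWith K ψ' := LipschitzWith.of_dist_le_mul fun x y => by
    rw [Real.dist_eq, hval, hval, ← integral_sub (hint x) (hint y)]
    simp only [← mul_sub]
    refine hbd (fun t => ψ (x - t) - ψ (y - t)) _ fun t => ?_
    have := hψ.dist_le_mul (x - t) (y - t)
    simpa [Real.dist_eq] using this
  have hsm : ContDiff ℝ ∞ ψ' :=
    φ.hasCompactSupport_normed.contDiff_convolution_left _ φ.contDiff_normed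
      hψ.continuous.locallyIntegrable
  have hsupp : tsupport ψ' ⊆ Icc (r - δ) (R - r + δ) := by
    refine closure_minimal (fun x hx => ?_) isClosed_Icc
    by_contra hx'
    refine hx ?_
    rw [hval]
    refine integral_eq_zero_of_ae (Eventually.of_forall fun t => ?_)
    by_contra h0
    simp only [Pi.zero_apply, mul_eq_zero, not_or] at h0
    have h1 : t ∈ Metric.ball (0 : ℝ) δ := by
      have : t ∈ Function.support (φ.normed volume) := h0.1
      rwa [φ.support_normed_eq] at this
    rw [mem_ball_zero_iff, Real.norm_eq_abs, abs_lt] at h1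
    have h2 := hs _ h0.2
    exact hx' ⟨by linarith, by linarith⟩
  refine ⟨ψ', ⟨hsm, HasCompactSupport.of_support_subset_isCompact isCompact_Icc
    ((subset_tsupport _).trans hsupp), fun x hx => ?_⟩, fun t => ?_, fun t => ?_, fun t => ?_⟩
  · have := hsupp hx
    exact ⟨by linarith [this.1], by linarith [this.2]⟩
  · rw [hval]; exact hbd _ _ fun s => hM _
  · exact norm_deriv_le_of_lipschitz hLip
  · have := φ.dist_normed_convolution_le (μ := volume) (g := ψ) (x₀ := t) (ε := K * δ)
      hψ.continuous.aestronglyMeasurable (fun x hx => (hψ.dist_le_mul x t).trans (by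
        gcongr; exact (Metric.mem_ball.1 hx).le))
    rwa [Real.dist_eq] at this

/-- A bound in `H⁻¹` is stated for smooth test functions, but the weights that occur are products of
a test function with the merely Lipschitz coefficient. Mollifying the weight keeps its sup and
Lipschitz bounds, hence its norm in `H¹`, and converges uniformly. -/
lemma abs_integral_le_of_lipschitz {R ε M r : ℝ} (hR : 0 ≤ R) (hε : 0 ≤ ε) {K : NNReal}
    {u ψ : ℝ → ℝ} (hu : IntegrableOn u (Ioo 0 R))
    (h : ∀ φ, IsTest1 R φ → |∫ t in Ioo 0 R, u t * φ t| ≤ ε * h1Norm R φ)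
    (hψ : LipschitzWith K ψ) (hM : ∀ t, |ψ t| ≤ M) (hr : 0 < r)
    (hs : ∀ t, ψ t ≠ 0 → r ≤ t ∧ t ≤ R - r) :
    |∫ t in Ioo 0 R, u t * ψ t| ≤ ε * Real.sqrt (R * (M ^ 2 + (K : ℝ) ^ 2)) := by
  set A := ∫ t in Ioo 0 R, |u t| with hA
  have ht : Tendsto (fun δ : ℝ => ε * Real.sqrt (R * (M ^ 2 + (K : ℝ) ^ 2)) + A * (K * δ))
      (𝓝[>] 0) (𝓝 (ε * Real.sqrt (R * (M ^ 2 + (K : ℝ) ^ 2)) + A * (K * 0))) :=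
    Tendsto.mono_left (Continuous.tendsto (by fun_prop) 0) nhdsWithin_le_nhds
  rw [mul_zero, mul_zero, add_zero] at ht
  refine ge_of_tendsto ht ?_
  filter_upwards [Ioo_mem_nhdsGT hr] with δ hδ
  obtain ⟨ψ', h1, h2, h3, h4⟩ := exists_isTest1_approx hψ hM hs hδ.1 hδ.2
  have hi : ∀ {g : ℝ → ℝ} {B : ℝ}, Continuous g → (∀ t, |g t| ≤ B) →
      IntegrableOn (fun t => u t * g t) (Ioo 0 R) := fun {g B} hg hB =>
    hu.mul_bdd (c := B) hg.aestronglyMeasurable (Eventually.of_forall hB)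
  have h5 : |∫ t in Ioo 0 R, u t * (ψ t - ψ' t)| ≤ A * (K * δ) := by
    rw [← Real.norm_eq_abs, hA, ← integral_mul_const]
    refine norm_integral_le_of_norm_le (hu.abs.mul_const _) (Eventually.of_forall fun t => ?_)
    rw [norm_mul, Real.norm_eq_abs, Real.norm_eq_abs, abs_sub_comm]
    exact mul_le_mul_of_nonneg_left (h4 t) (abs_nonneg _)
  have h6 : ∫ t in Ioo 0 R, u t * ψ t =
      (∫ t in Ioo 0 R, u t * ψ' t) + ∫ t in Ioo 0 R, u t * (ψ t - ψ' t) := by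
    simp only [mul_sub]
    rw [integral_sub (hi hψ.continuous hM) (hi h1.1.continuous h2)]
    ring
  rw [h6]
  refine (abs_add_le _ _).trans (add_le_add ((h ψ' h1).trans ?_) h5)
  exact mul_le_mul_of_nonneg_left (h1Norm_le hR h1 h2 h3) hε

/-! ### Cutoff functions -/

/-- A smooth function that is `0` on `(-∞, 1]` and `1` on `[2, ∞)`. -/
noncomputable def cut (x : ℝ) : ℝ := Real.smoothTransition (x - 1)

lemma contDiff_cut : ContDiff ℝ ∞ cut :=
  Real.smoothTransition.contDiff.comp (contDiff_id.sub contDiff_const)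

lemma cut_of_le {x : ℝ} (hx : x ≤ 1) : cut x = 0 :=
  Real.smoothTransition.zero_of_nonpos (by linarith)

lemma cut_of_ge {x : ℝ} (hx : 2 ≤ x) : cut x = 1 :=
  Real.smoothTransition.one_of_one_le (by linarith)

lemma cut_nonneg (x : ℝ) : 0 ≤ cut x := Real.smoothTransition.nonneg _

lemma cut_le_one (x : ℝ) : cut x ≤ 1 := Real.smoothTransition.le_one _

lemma deriv_cut_of_notMem {x : ℝ} (hx : x < 1 ∨ 2 < x) : deriv cut x = 0 := by
  rcases hx with hx | hx
  · have : cut =ᶠ[𝓝 x] fun _ => 0 := by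
      filter_upwards [Iio_mem_nhds hx] with y hy using cut_of_le hy.le
    rw [this.deriv_eq, deriv_const]
  · have : cut =ᶠ[𝓝 x] fun _ => 1 := by
      filter_upwards [Ioi_mem_nhds hx] with y hy using cut_of_ge hy.le
    rw [this.deriv_eq, deriv_const]

lemma exists_deriv_cut_bound : ∃ B, 0 ≤ B ∧ ∀ x, |deriv cut x| ≤ B := by
  obtain ⟨B, hB⟩ := (isCompact_Icc (a := (1 : ℝ)) (b := 2)).exists_bound_of_continuousOn
    (contDiff_cut.continuous_deriv (by simp)).continuousOn
  refine ⟨B, (norm_nonneg _).trans (hB 1 ⟨le_rfl, by norm_num⟩), fun x => ?_⟩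
  by_cases hx : x ∈ Icc (1 : ℝ) 2
  · exact hB x hx
  · rw [mem_Icc, not_and_or, not_le, not_le] at hx
    rw [deriv_cut_of_notMem hx, abs_zero]
    exact (norm_nonneg _).trans (hB 1 ⟨le_rfl, by norm_num⟩)

/-- The cutoff function in the first variable at scale `h`. -/
noncomputable def cutX (h : ℝ) (p : ℝ × ℝ) : ℝ := cut (p.1 / h)

/-- The cutoff function in the second variable at scale `h`. -/
noncomputable def cutY (h : ℝ) (p : ℝ × ℝ) : ℝ := cut (p.2 / h)

lemma contDiff_cutX (h : ℝ) : ContDiff ℝ ∞ (cutX h) :=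
  contDiff_cut.comp (contDiff_fst.div_const h)

lemma contDiff_cutY (h : ℝ) : ContDiff ℝ ∞ (cutY h) :=
  contDiff_cut.comp (contDiff_snd.div_const h)

lemma hasDerivAt_cut (x : ℝ) : HasDerivAt cut (deriv cut x) x :=
  (contDiff_cut.differentiable (by simp) x).hasDerivAt

lemma dd_cutX (h : ℝ) (e p : ℝ × ℝ) : dd e (cutX h) p = deriv cut (p.1 / h) * (e.1 / h) := by
  have h1 : HasFDerivAt (cutX h)
      ((deriv cut (p.1 / h)) • (h⁻¹ • ContinuousLinearMap.fst ℝ ℝ ℝ)) p := by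
    refine HasDerivAt.comp_hasFDerivAt p (hasDerivAt_cut (p.1 / h)) ?_
    simpa [div_eq_inv_mul] using
      (hasFDerivAt_fst (𝕜 := ℝ) (E := ℝ) (F := ℝ) (p := p)).const_mul h⁻¹
  rw [dd, h1.fderiv]
  simp [div_eq_inv_mul]

lemma dd_cutY (h : ℝ) (e p : ℝ × ℝ) : dd e (cutY h) p = deriv cut (p.2 / h) * (e.2 / h) := by
  have h1 : HasFDerivAt (cutY h)
      ((deriv cut (p.2 / h)) • (h⁻¹ • ContinuousLinearMap.snd ℝ ℝ ℝ)) p := by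
    refine HasDerivAt.comp_hasFDerivAt p (hasDerivAt_cut (p.2 / h)) ?_
    simpa [div_eq_inv_mul] using
      (hasFDerivAt_snd (𝕜 := ℝ) (E := ℝ) (F := ℝ) (p := p)).const_mul h⁻¹
  rw [dd, h1.fderiv]
  simp [div_eq_inv_mul]

lemma tendsto_cut_div {x : ℝ} (hx : 0 < x) : Tendsto (fun h => cut (x / h)) (𝓝[>] 0) (𝓝 1) := by
  refine tendsto_const_nhds.congr' ?_
  filter_upwards [Ioo_mem_nhdsGT (show (0 : ℝ) < x / 2 by positivity)] with h hh
  rw [cut_of_ge]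
  rw [le_div_iff₀ hh.1]
  linarith [hh.2]

/-! ### Zero traces and thin strips -/

/-- If `w` has zero trace at `s = 0`, the averages of `w` over thin strips at `s = 0`, weighted by
functions whose slices are Lipschitz with compact support, tend to `0`. -/
lemma HasTraceAtZero.tendsto_strip {S R : ℝ} (hS : 0 < S) (hR : 0 < R) {w : ℝ × ℝ → ℝ}
    (hw : MemLp w 2 (volume.restrict (rect S R)))
    (ht : HasTraceAtZero S R (fun s t => w (s, t)) 0) {ψ : ℝ × ℝ → ℝ} (hψc : Continuous ψ)
    {K : NNReal} {M r : ℝ} (hr : 0 < r) (hψM : ∀ p, |ψ p| ≤ M)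
    (hψK : ∀ s, LipschitzWith K fun t => ψ (s, t))
    (hψs : ∀ s t, s < r → ψ (s, t) ≠ 0 → r ≤ t ∧ t ≤ R - r) :
    Tendsto (fun h => ∫ p in rect S R, w p * ((deriv cut (p.1 / h) / h) * ψ p)) (𝓝[>] 0)
      (𝓝 0) := by
  obtain ⟨W, hW1, hW2, hW3⟩ := ht
  obtain ⟨B, hB0, hB⟩ := exists_deriv_cut_bound
  set H := Real.sqrt (R * (M ^ 2 + (K : ℝ) ^ 2)) with hH
  have hwi : Integrable w (volume.restrict (rect S R)) := integrable_of_L2 hw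
  have hae : ∀ᵐ s ∂(volume.restrict (Ioo 0 S)), IntegrableOn (fun t => w (s, t)) (Ioo 0 R) := by
    rw [restrict_rect_eq_prod] at hwi
    exact hwi.prod_right_ae
  rw [Metric.tendsto_nhds]
  intro η hη
  obtain ⟨ε, hε, hεη⟩ : ∃ ε > 0, 2 * B * H * ε < η := by
    have hH0 : 0 ≤ H := Real.sqrt_nonneg _
    refine ⟨η / (2 * B * H + 1), by positivity, ?_⟩
    rw [mul_div_assoc', div_lt_iff₀ (by positivity)]
    nlinarith
  obtain ⟨δ, hδ, hδW⟩ := hW2 0 ⟨le_rfl, hS.le⟩ ε hε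
  -- `deriv cut (s / h)` vanishes for `s > 2 * h`. Thus `2 * h < δ` keeps the strip where the traces
  -- are small, and `2 * h < r` where the slices of `ψ` have compact support.
  have h0 : (0 : ℝ) < min δ r / 2 := by positivity
  filter_upwards [Ioo_mem_nhdsGT h0] with h hh
  have hh0 : 0 < h := hh.1
  have hhδ : 2 * h < δ := by linarith [hh.2, min_le_left δ r]
  have hhr : 2 * h < r := by linarith [hh.2, min_le_right δ r]
  have hcd : Continuous (deriv cut) := contDiff_cut.continuous_deriv (by simp)
  have hint : Integrable (fun p : ℝ × ℝ => w p * ((deriv cut (p.1 / h) / h) * ψ p))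
      (volume.restrict (rect S R)) := by
    refine hwi.mul_bdd (c := B / h * M) ?_ (Eventually.of_forall fun p => ?_)
    · exact (((hcd.comp (continuous_fst.div_const h)).div_const h).mul hψc).aestronglyMeasurable
    · rw [norm_mul, norm_div, Real.norm_eq_abs, Real.norm_eq_abs, Real.norm_eq_abs,
        abs_of_pos hh0]
      have := hB (p.1 / h)
      have := hψM p
      gcongr
  -- The weight is at most `B / h` on a strip of width `2 * h`, so the factors `h` cancel on
  -- integration and only the smallness `ε` of the traces remains.
  have hslice : ∀ᵐ s ∂(volume.restrict (Ioo 0 S)),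
      ‖∫ t in Ioo 0 R, w (s, t) * ((deriv cut (s / h) / h) * ψ (s, t))‖ ≤
        (Iic (2 * h)).indicator (fun _ => B / h * (ε * H)) s := by
    filter_upwards [hW1, hae, ae_restrict_mem measurableSet_Ioo] with s hs hsi hsm
    have e1 : ∫ t in Ioo 0 R, w (s, t) * ((deriv cut (s / h) / h) * ψ (s, t)) =
        (deriv cut (s / h) / h) * ∫ t in Ioo 0 R, w (s, t) * ψ (s, t) := by
      rw [← integral_const_mul]
      refine integral_congr_ae (Eventually.of_forall fun t => ?_)
      simp only []
      ring
    rw [e1]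
    by_cases hsh : s ≤ 2 * h
    · rw [indicator_of_mem (show s ∈ Iic (2 * h) from hsh), norm_mul, norm_div, Real.norm_eq_abs,
        Real.norm_eq_abs, Real.norm_eq_abs, abs_of_pos hh0]
      have h1 : |∫ t in Ioo 0 R, w (s, t) * ψ (s, t)| ≤ ε * H := by
        refine abs_integral_le_of_lipschitz hR.le hε.le hsi (fun φ hφ => ?_) (hψK s)
          (fun t => hψM (s, t)) hr (fun t => hψs s t (by linarith))
        have h2 := hδW s ⟨hsm.1.le, hsm.2.le⟩
          (by rw [sub_zero, abs_of_pos hsm.1]; linarith) φ hφ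
        rw [hs φ hφ, hW3 φ hφ] at h2
        simpa using h2
      have := hB (s / h)
      gcongr
    · rw [indicator_of_notMem (show s ∉ Iic (2 * h) from hsh), deriv_cut_of_notMem]
      · simp
      · right
        rw [lt_div_iff₀ hh0]
        linarith
  rw [dist_zero_right]
  refine lt_of_le_of_lt ?_ hεη
  have e2 : ∫ p in rect S R, w p * ((deriv cut (p.1 / h) / h) * ψ p) =
      ∫ s in Ioo 0 S, ∫ t in Ioo 0 R, w (s, t) * ((deriv cut (s / h) / h) * ψ (s, t)) := by
    rw [restrict_rect_eq_prod] at hint ⊢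
    exact integral_prod _ hint
  rw [e2]
  have hi : IntegrableOn (fun _ : ℝ => B / h * (ε * H)) (Ioc 0 (2 * h)) :=
    integrable_const _
  calc ‖∫ s in Ioo 0 S, ∫ t in Ioo 0 R, w (s, t) * ((deriv cut (s / h) / h) * ψ (s, t))‖
      ≤ ∫ s in Ioo 0 S, (Iic (2 * h)).indicator (fun _ => B / h * (ε * H)) s := by
        refine norm_integral_le_of_norm_le ?_ hslice
        exact (integrable_const _).indicator measurableSet_Iic
    _ = ∫ s in Ioo 0 S ∩ Iic (2 * h), B / h * (ε * H) := setIntegral_indicator measurableSet_Iic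
    _ ≤ ∫ s in Ioc 0 (2 * h), B / h * (ε * H) := by
        refine setIntegral_mono_set hi (Eventually.of_forall fun s => ?_)
          (LE.le.eventuallyLE fun s hs => ⟨hs.1.1, hs.2⟩)
        exact show 0 ≤ B / h * (ε * H) by positivity
    _ = 2 * B * H * ε := by
        rw [setIntegral_const, Measure.real, Real.volume_Ioc, sub_zero,
          ENNReal.toReal_ofReal (by positivity), smul_eq_mul]
        field_simp

/-! ### First order equations extend by zero across edges with zero trace -/

lemma lipschitzWith_mul {α : Type*} [PseudoMetricSpace α] {f g : α → ℝ} {Kf Kg : NNReal}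
    {Mf Mg : NNReal} (hf : LipschitzWith Kf f) (hg : LipschitzWith Kg g) (hMf : ∀ x, |f x| ≤ Mf)
    (hMg : ∀ x, |g x| ≤ Mg) : LipschitzWith (Mf * Kg + Mg * Kf) fun x => f x * g x :=
  LipschitzWith.of_dist_le_mul fun x y => by
    have h1 := hf.dist_le_mul x y
    have h2 := hg.dist_le_mul x y
    rw [Real.dist_eq] at h1 h2 ⊢
    have e : f x * g x - f y * g y = f x * (g x - g y) + g y * (f x - f y) := by ring
    calc |f x * g x - f y * g y| ≤ |f x| * |g x - g y| + |g y| * |f x - f y| := by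
          rw [e, ← abs_mul, ← abs_mul]; exact abs_add_le _ _
      _ ≤ Mf * (Kg * dist x y) + Mg * (Kf * dist x y) := by
          gcongr
          · exact hMf x
          · exact hMg y
      _ = _ := by push_cast; ring

lemma TestOn.exists_lipschitz {U : Set (ℝ × ℝ)} {φ : ℝ × ℝ → ℝ} (h : TestOn U φ) :
    ∃ K, LipschitzWith K φ :=
  ⟨_, (ContDiff.lipschitzWith_of_hasCompactSupport h.2.1 h.1 (by simp)).choose_spec⟩

lemma TestOn.exists_bound {U : Set (ℝ × ℝ)} {φ : ℝ × ℝ → ℝ} (h : TestOn U φ) :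
    ∃ M : NNReal, ∀ p, |φ p| ≤ M := by
  obtain ⟨C, hC⟩ := h.2.1.exists_bound_of_continuous h.continuous
  exact ⟨⟨C, (norm_nonneg _).trans (hC 0)⟩, hC⟩

lemma TestOn.exists_margin_lowerLeft {L₁ L₂ : ℝ} {φ : ℝ × ℝ → ℝ}
    (h : TestOn (lowerLeft L₁ L₂) φ) :
    ∃ δ > 0, ∀ p, φ p ≠ 0 → p.1 ≤ L₁ - δ ∧ p.2 ≤ L₂ - δ := by
  rcases (tsupport φ).eq_empty_or_nonempty with he | hne
  · refine ⟨1, one_pos, fun p hp => ?_⟩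
    have := subset_tsupport φ hp
    rw [he] at this
    exact this.elim
  · obtain ⟨q, hq, hmin⟩ := h.2.1.isCompact.exists_isMinOn hne
      (f := fun p : ℝ × ℝ => min (L₁ - p.1) (L₂ - p.2)) (by fun_prop)
    have h0 : 0 < min (L₁ - q.1) (L₂ - q.2) :=
      lt_min (sub_pos.2 (h.2.2 hq).1) (sub_pos.2 (h.2.2 hq).2)
    refine ⟨_, h0, fun p hp => ?_⟩
    have h1 : min (L₁ - q.1) (L₂ - q.2) ≤ min (L₁ - p.1) (L₂ - p.2) :=
      hmin (subset_tsupport φ hp)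
    exact ⟨by linarith [h1.trans (min_le_left _ _)], by linarith [h1.trans (min_le_right _ _)]⟩

lemma testOn_cut_mul {L₁ L₂ h : ℝ} (hh : 0 < h) {φ : ℝ × ℝ → ℝ}
    (hφ : TestOn (lowerLeft L₁ L₂) φ) :
    TestOn (rect L₁ L₂) fun p => (cutX h p * cutY h p) * φ p := by
  have h1 := hφ.smooth_mul ((contDiff_cutX h).mul (contDiff_cutY h))
  refine ⟨h1.1, h1.2.1, fun p hp => ?_⟩
  have h2 := h1.2.2 hp
  have h3 : tsupport (fun p => (cutX h p * cutY h p) * φ p) ⊆ Ici h ×ˢ Ici h := by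
    refine closure_minimal (fun q hq => ?_) (isClosed_Ici.prod isClosed_Ici)
    have hX : cutX h q ≠ 0 := fun h0 => hq (by simp [h0])
    have hY : cutY h q ≠ 0 := fun h0 => hq (by simp [h0])
    constructor
    · by_contra hlt
      rw [mem_Ici, not_le] at hlt
      exact hX (cut_of_le ((div_le_one hh).2 hlt.le))
    · by_contra hlt
      rw [mem_Ici, not_le] at hlt
      exact hY (cut_of_le ((div_le_one hh).2 hlt.le))
  have h4 := h3 hp
  exact ⟨⟨hh.trans_le h4.1, h2.1⟩, ⟨hh.trans_le h4.2, h2.2⟩⟩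

lemma abs_cut_le_one (x : ℝ) : |cut x| ≤ 1 := by
  rw [abs_of_nonneg (cut_nonneg x)]; exact cut_le_one x

lemma abs_cut_mul_cut_le (h : ℝ) (p : ℝ × ℝ) : |cutX h p * cutY h p| ≤ 1 := by
  rw [abs_mul]
  exact mul_le_one₀ (abs_cut_le_one _) (abs_nonneg _) (abs_cut_le_one _)

lemma tendsto_integral_cutoff {L₁ L₂ : ℝ} {g : ℝ × ℝ → ℝ}
    (hg : Integrable g (volume.restrict (rect L₁ L₂))) {κ : ℝ → ℝ × ℝ → ℝ}
    (hκ : ∀ h, Continuous (κ h)) (hκ1 : ∀ h p, |κ h p| ≤ 1)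
    (hκt : ∀ p ∈ rect L₁ L₂, Tendsto (fun h => κ h p) (𝓝[>] 0) (𝓝 1)) :
    Tendsto (fun h => ∫ p in rect L₁ L₂, g p * κ h p) (𝓝[>] 0) (𝓝 (∫ p in rect L₁ L₂, g p)) := by
  refine tendsto_integral_filter_of_dominated_convergence (fun p => ‖g p‖)
    (Eventually.of_forall fun h => hg.1.mul (hκ h).aestronglyMeasurable)
    (Eventually.of_forall fun h => Eventually.of_forall fun p => ?_) hg.norm ?_
  · rw [norm_mul]
    exact mul_le_of_le_one_right (norm_nonneg _) (hκ1 h p)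
  · filter_upwards [ae_restrict_mem (measurableSet_rect L₁ L₂)] with p hp
    simpa using (hκt p hp).const_mul (g p)

lemma tendsto_cutX_mul_cutY {p : ℝ × ℝ} (h1 : 0 < p.1) (h2 : 0 < p.2) :
    Tendsto (fun h => cutX h p * cutY h p) (𝓝[>] 0) (𝓝 1) := by
  have h := (tendsto_cut_div h1).mul (tendsto_cut_div h2)
  rwa [mul_one] at h

section ZeroExtension

variable {L₁ L₂ : ℝ} {w f a b : ℝ × ℝ → ℝ} {Ka Kb Ma Mb : NNReal}

lemma memLp_mul_bdd {S : Set (ℝ × ℝ)} {u c : ℝ × ℝ → ℝ} {C : ℝ}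
    (hu : MemLp u 2 (volume.restrict S)) (hc : Continuous c) (hC : ∀ p, |c p| ≤ C) :
    MemLp (fun p => u p * c p) 2 (volume.restrict S) := by
  have h1 : MemLp c ⊤ (volume.restrict S) :=
    memLp_top_of_bound hc.aestronglyMeasurable C (Eventually.of_forall hC)
  simpa only [mul_comm] using memLp_mul_of_top hu h1

/-- The strip estimate at `x = 0` for a test function that vanishes near the corner. -/
lemma VanishesOnGam.tendsto_strip_x (hL₁ : 0 < L₁) (hL₂ : 0 < L₂)
    (hw : MemLp w 2 (volume.restrict (rect L₁ L₂))) (hv : VanishesOnGam L₁ L₂ w)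
    (ha : LipschitzWith Ka a) (hMa : ∀ p, |a p| ≤ Ma) {φ : ℝ × ℝ → ℝ}
    (hφ : TestOn (lowerLeft L₁ L₂) φ) {r : ℝ} (hr : 0 < r)
    (hφr : ∀ p : ℝ × ℝ, p.1 < r → p.2 < r → φ p = 0) :
    Tendsto (fun h => ∫ p in rect L₁ L₂, w p * ((deriv cut (p.1 / h) / h) * (a p * φ p)))
      (𝓝[>] 0) (𝓝 0) := by
  obtain ⟨δ, hδ, hm⟩ := hφ.exists_margin_lowerLeft
  obtain ⟨Kφ, hKφ⟩ := hφ.exists_lipschitz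
  obtain ⟨Mφ, hMφ⟩ := hφ.exists_bound
  have hLip := lipschitzWith_mul ha hKφ hMa hMφ
  -- Along `x = 0` the slices stay away from both ends of the edge: from `0` because `φ` vanishes
  -- near the corner, and from `L₂` because its support is compact in `lowerLeft`.
  refine hv.1.tendsto_strip hL₁ hL₂ hw (ψ := fun p => a p * φ p) hLip.continuous
    (M := Ma * Mφ) (r := min r δ)
    (K := (Ma * Kφ + Mφ * Ka) * 1) (lt_min hr hδ) (fun p => ?_) (fun s => ?_) fun s t hs h0 => ?_
  · rw [abs_mul]
    exact mul_le_mul (hMa p) (hMφ p) (abs_nonneg _) (by positivity)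
  · exact hLip.comp (LipschitzWith.prodMk_left s)
  · have hφ0 : φ (s, t) ≠ 0 := right_ne_zero_of_mul h0
    constructor
    · by_contra ht
      rw [not_le] at ht
      exact hφ0 (hφr (s, t) (hs.trans_le (min_le_left _ _)) (ht.trans_le (min_le_left _ _)))
    · have h1 := (hm _ hφ0).2
      simp only [] at h1
      linarith [min_le_right r δ]

lemma VanishesOnGam.swap (hv : VanishesOnGam L₁ L₂ w) :
    VanishesOnGam L₂ L₁ (fun p => w p.swap) := ⟨hv.2, hv.1⟩

lemma TestOn.swap_lowerLeft {φ : ℝ × ℝ → ℝ} (h : TestOn (lowerLeft L₁ L₂) φ) :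
    TestOn (lowerLeft L₂ L₁) fun p => φ p.swap := by
  refine ⟨h.1.comp (contDiff_snd.prodMk contDiff_fst),
    h.2.1.comp_homeomorph (Homeomorph.prodComm ℝ ℝ), ?_⟩
  have h1 : tsupport (fun p : ℝ × ℝ => φ p.swap) ⊆ Prod.swap ⁻¹' tsupport φ :=
    tsupport_comp_subset_preimage φ continuous_swap
  intro p hp
  have h2 := h.2.2 (h1 hp)
  exact ⟨h2.2, h2.1⟩

/-- The strip estimate at `y = 0` for a test function that vanishes near the corner. -/
lemma VanishesOnGam.tendsto_strip_y (hL₁ : 0 < L₁) (hL₂ : 0 < L₂)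
    (hw : MemLp w 2 (volume.restrict (rect L₁ L₂))) (hv : VanishesOnGam L₁ L₂ w)
    (hb : LipschitzWith Kb b) (hMb : ∀ p, |b p| ≤ Mb) {φ : ℝ × ℝ → ℝ}
    (hφ : TestOn (lowerLeft L₁ L₂) φ) {r : ℝ} (hr : 0 < r)
    (hφr : ∀ p : ℝ × ℝ, p.1 < r → p.2 < r → φ p = 0) :
    Tendsto (fun h => ∫ p in rect L₁ L₂, w p * ((deriv cut (p.2 / h) / h) * (b p * φ p)))
      (𝓝[>] 0) (𝓝 0) := by
  have hbs : LipschitzWith (Kb * 1) fun p : ℝ × ℝ => b p.swap :=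
    hb.comp (LipschitzWith.of_dist_le_mul fun p q => by
      rw [Prod.dist_eq, Prod.dist_eq, NNReal.coe_one, one_mul, max_comm]; rfl)
  have h1 := hv.swap.tendsto_strip_x hL₂ hL₁ (memLp_swap hw) hbs (fun p => hMb p.swap)
    hφ.swap_lowerLeft hr (fun p h1 h2 => hφr p.swap h2 h1)
  refine h1.congr fun h => ?_
  rw [← setIntegral_swap fun p => w p * ((deriv cut (p.2 / h) / h) * (b p * φ p))]
  rfl

/-- Test the equation with `φ` times a cutoff along each edge. The derivatives of the cutoffs give
one strip average per edge, and both vanish in the limit. Vanishing near the corner makes the slices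
of `φ` admissible for the traces and separates the two cutoffs. -/
lemma wd_extend_of_vanish_corner (hL₁ : 0 < L₁) (hL₂ : 0 < L₂)
    (hw : MemLp w 2 (volume.restrict (rect L₁ L₂))) (hf : MemLp f 2 (volume.restrict (rect L₁ L₂)))
    (hv : VanishesOnGam L₁ L₂ w) (ha : LipschitzWith Ka a) (hMa : ∀ p, |a p| ≤ Ma)
    (hb : LipschitzWith Kb b) (hMb : ∀ p, |b p| ≤ Mb)
    (h : ∀ φ, TestOn (rect L₁ L₂) φ → ∫ p in rect L₁ L₂, f p * φ p =
      -∫ p in rect L₁ L₂, w p * (a p * dd (1, 0) φ p + b p * dd (0, 1) φ p))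
    {φ : ℝ × ℝ → ℝ} (hφ : TestOn (lowerLeft L₁ L₂) φ) {r : ℝ} (hr : 0 < r)
    (hφr : ∀ p : ℝ × ℝ, p.1 < r → p.2 < r → φ p = 0) :
    ∫ p in rect L₁ L₂, f p * φ p =
      -∫ p in rect L₁ L₂, w p * (a p * dd (1, 0) φ p + b p * dd (0, 1) φ p) := by
  have hsx := hv.tendsto_strip_x hL₁ hL₂ hw ha hMa hφ hr hφr
  have hsy := hv.tendsto_strip_y hL₁ hL₂ hw hb hMb hφ hr hφr
  obtain ⟨B, hB0, hB⟩ := exists_deriv_cut_bound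
  obtain ⟨Mφ, hMφ⟩ := hφ.exists_bound
  have hcd : Continuous (deriv cut) := contDiff_cut.continuous_deriv (by simp)
  have hmw : MemLp (fun p => w p * (a p * dd (1, 0) φ p + b p * dd (0, 1) φ p)) 2
      (volume.restrict (rect L₁ L₂)) := by
    have m1 := (memLp_mul_bdd hw ha.continuous hMa).mul_test (hφ.dd (1, 0))
    have m2 := (memLp_mul_bdd hw hb.continuous hMb).mul_test (hφ.dd (0, 1))
    refine (m1.add m2).ae_eq (Eventually.of_forall fun p => ?_)
    simp only [Pi.add_apply]
    ring
  have hmf := hf.mul_test hφ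
  have t1 := tendsto_integral_cutoff (integrable_of_L2 hmf)
    (κ := fun h p => cutX h p * cutY h p)
    (fun h => ((contDiff_cutX h).mul (contDiff_cutY h)).continuous) abs_cut_mul_cut_le
    (fun p hp => tendsto_cutX_mul_cutY hp.1.1 hp.2.1)
  have t2 := tendsto_integral_cutoff (integrable_of_L2 hmw)
    (κ := fun h p => cutX h p * cutY h p)
    (fun h => ((contDiff_cutX h).mul (contDiff_cutY h)).continuous) abs_cut_mul_cut_le
    (fun p hp => tendsto_cutX_mul_cutY hp.1.1 hp.2.1)
  have t3 := (t2.add (hsx.add hsy)).neg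
  rw [add_zero, add_zero] at t3
  refine tendsto_nhds_unique (t1.congr' ?_) t3
  filter_upwards [Ioo_mem_nhdsGT (show (0 : ℝ) < r / 2 by positivity)] with k hk
  have hk0 : 0 < k := hk.1
  have hkr : 2 * k < r := by linarith [hk.2]
  have hX := contDiff_cutX k
  have hY := contDiff_cutY k
  have hψ := testOn_cut_mul hk0 hφ
  have e0 := h _ hψ
  have hi2 : Integrable (fun p => w p * (a p * dd (1, 0) φ p + b p * dd (0, 1) φ p) *
      (cutX k p * cutY k p)) (volume.restrict (rect L₁ L₂)) :=
    (integrable_of_L2 hmw).mul_bdd (c := 1) (hX.mul hY).continuous.aestronglyMeasurable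
      (Eventually.of_forall fun p => abs_cut_mul_cut_le k p)
  have hiw : ∀ {c : ℝ × ℝ → ℝ} {g : ℝ × ℝ → ℝ} {M : NNReal}, Continuous c → (∀ p, |c p| ≤ M) →
      Continuous g → Integrable (fun p => w p * ((deriv cut (g p) / k) * (c p * φ p)))
        (volume.restrict (rect L₁ L₂)) := by
    intro c g M hc hM hg
    refine (integrable_of_L2 hw).mul_bdd (c := B / k * (M * Mφ)) ?_ (Eventually.of_forall fun p => ?_)
    · exact (((hcd.comp hg).div_const k).mul (hc.mul hφ.continuous)).aestronglyMeasurable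
    · rw [norm_mul, norm_div, norm_mul, Real.norm_eq_abs, Real.norm_eq_abs, Real.norm_eq_abs,
        Real.norm_eq_abs, abs_of_pos hk0]
      have := hB (g p)
      have := hM p
      have := hMφ p
      gcongr
  have hi3 := hiw (g := fun p => p.1 / k) ha.continuous hMa (continuous_fst.div_const k)
  have hi4 := hiw (g := fun p => p.2 / k) hb.continuous hMb (continuous_snd.div_const k)
  have hi34 : Integrable (fun p => w p * ((deriv cut (p.1 / k) / k) * (a p * φ p)) +
      w p * ((deriv cut (p.2 / k) / k) * (b p * φ p))) (volume.restrict (rect L₁ L₂)) := hi3.add hi4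
  rw [← integral_add hi3 hi4, ← integral_add hi2 hi34]
  refine Eq.trans ?_ (e0.trans (congrArg Neg.neg ?_))
  · refine integral_congr_ae (Eventually.of_forall fun p => ?_)
    ring
  · refine setIntegral_congr_fun (measurableSet_rect L₁ L₂) fun p hp => ?_
    have hdX := differentiable_of_smooth hX p
    have hdY := differentiable_of_smooth hY p
    have hdXY := differentiable_of_smooth (hX.mul hY) p
    have hdφ := differentiable_of_smooth hφ.1 p
    rw [dd_mul hdXY hdφ, dd_mul hdXY hdφ, dd_mul hdX hdY, dd_mul hdX hdY, dd_cutX, dd_cutY,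
      dd_cutX, dd_cutY]
    -- Where the derivative is nonzero, `p.1 ≤ 2 * k < r`; so either `φ` vanishes or `p.2 ≥ r > 2 *
    -- k` and the other cutoff equals `1`.
    have c1 : deriv cut (p.1 / k) * cutY k p * φ p = deriv cut (p.1 / k) * φ p := by
      by_cases h1 : 2 < p.1 / k
      · rw [deriv_cut_of_notMem (Or.inr h1)]; ring
      · rw [not_lt, div_le_iff₀ hk0] at h1
        by_cases h2 : p.2 < r
        · rw [hφr p (by linarith) h2]; ring
        · rw [show cutY k p = 1 from cut_of_ge (by rw [le_div_iff₀ hk0]; linarith)]; ring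
    have c2 : deriv cut (p.2 / k) * cutX k p * φ p = deriv cut (p.2 / k) * φ p := by
      by_cases h1 : 2 < p.2 / k
      · rw [deriv_cut_of_notMem (Or.inr h1)]; ring
      · rw [not_lt, div_le_iff₀ hk0] at h1
        by_cases h2 : p.1 < r
        · rw [hφr p h2 (by linarith)]; ring
        · rw [show cutX k p = 1 from cut_of_ge (by rw [le_div_iff₀ hk0]; linarith)]; ring
    simp only [zero_div, mul_zero, add_zero, zero_add, zero_mul]
    linear_combination (w p * a p / k) * c1 + (w p * b p / k) * c2

/-- On a square of side `2 * k` a function bounded by `C / k` has norm at most `2 * C` in `L²`,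
while the norm of `w` there tends to zero by absolute continuity. The scaling is that of dimension
two, and no trace is needed at the corner. -/
lemma tendsto_integral_corner {g : ℝ → ℝ × ℝ → ℝ}
    (hw : MemLp w 2 (volume.restrict (rect L₁ L₂))) {C : ℝ}
    (hgc : ∀ k, Continuous (g k)) (hg : ∀ k, 0 < k → ∀ p, |g k p| ≤ C / k)
    (hg0 : ∀ k, 0 < k → ∀ p : ℝ × ℝ, 2 * k < p.1 ∨ 2 * k < p.2 → g k p = 0) :
    Tendsto (fun k => ∫ p in rect L₁ L₂, w p * g k p) (𝓝[>] 0) (𝓝 0) := by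
  set μ := volume.restrict (rect L₁ L₂) with hμ
  set Q : ℝ → Set (ℝ × ℝ) := fun k => Iic (2 * k) ×ˢ Iic (2 * k) with hQ
  have hQm : ∀ k, MeasurableSet (Q k) := fun k => measurableSet_Iic.prod measurableSet_Iic
  have hQv : ∀ k, 0 < k → μ (Q k) ≤ ENNReal.ofReal (2 * k) ^ 2 := by
    intro k hk
    rw [hμ, Measure.restrict_apply (hQm k)]
    calc volume (Q k ∩ rect L₁ L₂) ≤ volume (Ioc 0 (2 * k) ×ˢ Ioc 0 (2 * k) : Set (ℝ × ℝ)) := by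
          refine measure_mono fun p hp => ?_
          exact ⟨⟨hp.2.1.1, hp.1.1⟩, ⟨hp.2.2.1, hp.1.2⟩⟩
      _ = _ := by
          rw [Measure.volume_eq_prod, Measure.prod_prod, Real.volume_Ioc, sub_zero, sq]
  have hμQ : Tendsto (fun k => μ (Q k)) (𝓝[>] 0) (𝓝 0) := by
    have h1 : Tendsto (fun k : ℝ => ENNReal.ofReal (2 * k) ^ 2) (𝓝[>] 0) (𝓝 0) := by
      have h2 : Tendsto (fun k : ℝ => ENNReal.ofReal (2 * k) ^ 2) (𝓝 0)
          (𝓝 (ENNReal.ofReal (2 * 0) ^ 2)) :=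
        ((ENNReal.continuous_pow 2).comp
          (ENNReal.continuous_ofReal.comp (continuous_const_mul 2))).tendsto 0
      simpa using h2.mono_left nhdsWithin_le_nhds
    refine tendsto_of_tendsto_of_tendsto_of_le_of_le' tendsto_const_nhds h1
      (Eventually.of_forall fun _ => zero_le) ?_
    filter_upwards [self_mem_nhdsWithin] with k hk using hQv k hk
  have hw2 : ∫⁻ p, ‖w p‖ₑ ^ 2 ∂μ ≠ ⊤ := by
    rw [← eLpNorm_two_sq]
    exact (ENNReal.pow_lt_top hw.2).ne
  have hwQ := tendsto_setLIntegral_zero hw2 hμQ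
  have hlim : Tendsto (fun k => ENNReal.ofReal (2 * C) * (∫⁻ p in Q k, ‖w p‖ₑ ^ 2 ∂μ) ^ (1 / 2 : ℝ))
      (𝓝[>] 0) (𝓝 0) := by
    have h1 := (ENNReal.continuous_rpow_const (y := (1 / 2 : ℝ))).tendsto 0 |>.comp hwQ
    rw [ENNReal.zero_rpow_of_pos (by norm_num)] at h1
    have h2 := ENNReal.Tendsto.const_mul (a := ENNReal.ofReal (2 * C)) h1
      (Or.inr ENNReal.ofReal_ne_top)
    rwa [mul_zero] at h2
  rw [tendsto_zero_iff_enorm_tendsto_zero]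
  refine tendsto_of_tendsto_of_tendsto_of_le_of_le' tendsto_const_nhds hlim
    (Eventually.of_forall fun _ => zero_le) ?_
  filter_upwards [self_mem_nhdsWithin] with k hk
  have hk : 0 < k := hk
  have e1 : ∫ p, w p * g k p ∂μ = ∫ p in Q k, w p * g k p ∂μ := by
    refine (setIntegral_eq_integral_of_forall_compl_eq_zero fun p hp => ?_).symm
    rw [hg0 k hk p, mul_zero]
    simp only [hQ, mem_prod, mem_Iic, not_and_or, not_le] at hp
    exact hp
  have hwk : AEStronglyMeasurable w (μ.restrict (Q k)) := hw.1.mono_measure Measure.restrict_le_self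
  have e2 : eLpNorm w 2 (μ.restrict (Q k)) = (∫⁻ p in Q k, ‖w p‖ₑ ^ 2 ∂μ) ^ (1 / 2 : ℝ) := by
    rw [← eLpNorm_two_sq, ← ENNReal.rpow_natCast, ← ENNReal.rpow_mul]
    simp
  have e3 : eLpNorm (g k) 2 (μ.restrict (Q k)) ≤ ENNReal.ofReal (2 * C) := by
    refine (eLpNorm_le_of_ae_bound (C := C / k) (Eventually.of_forall (hg k hk))).trans ?_
    rw [Measure.restrict_apply_univ]
    calc μ (Q k) ^ ((2 : ℝ≥0∞).toReal)⁻¹ * ENNReal.ofReal (C / k)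
        ≤ (ENNReal.ofReal (2 * k) ^ 2) ^ ((2 : ℝ≥0∞).toReal)⁻¹ * ENNReal.ofReal (C / k) := by
          gcongr; exact hQv k hk
      _ = ENNReal.ofReal (2 * C) := by
          rw [← ENNReal.rpow_natCast, ← ENNReal.rpow_mul]
          simp only [Nat.cast_ofNat, ENNReal.toReal_ofNat]
          rw [mul_inv_cancel₀ (by norm_num), ENNReal.rpow_one,
            ← ENNReal.ofReal_mul (by positivity)]
          congr 1
          field_simp
  rw [e1]
  calc ‖∫ p in Q k, w p * g k p ∂μ‖ₑ ≤ ∫⁻ p in Q k, ‖w p * g k p‖ₑ ∂μ :=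
        enorm_integral_le_lintegral_enorm _
    _ ≤ eLpNorm w 2 (μ.restrict (Q k)) * eLpNorm (g k) 2 (μ.restrict (Q k)) :=
        eLpNorm_one_mul_le hwk (hgc k).aestronglyMeasurable
    _ ≤ _ := by rw [e2, mul_comm]; gcongr

/-- A first order equation for a function with zero traces on `Γ` may be tested against functions
that do not vanish near `Γ`. -/
lemma wd_extend (hL₁ : 0 < L₁) (hL₂ : 0 < L₂)
    (hw : MemLp w 2 (volume.restrict (rect L₁ L₂))) (hf : MemLp f 2 (volume.restrict (rect L₁ L₂)))
    (hv : VanishesOnGam L₁ L₂ w) (ha : LipschitzWith Ka a) (hMa : ∀ p, |a p| ≤ Ma)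
    (hb : LipschitzWith Kb b) (hMb : ∀ p, |b p| ≤ Mb)
    (h : ∀ φ, TestOn (rect L₁ L₂) φ → ∫ p in rect L₁ L₂, f p * φ p =
      -∫ p in rect L₁ L₂, w p * (a p * dd (1, 0) φ p + b p * dd (0, 1) φ p))
    {φ : ℝ × ℝ → ℝ} (hφ : TestOn (lowerLeft L₁ L₂) φ) :
    ∫ p in rect L₁ L₂, f p * φ p =
      -∫ p in rect L₁ L₂, w p * (a p * dd (1, 0) φ p + b p * dd (0, 1) φ p) := by
  obtain ⟨B, hB0, hB⟩ := exists_deriv_cut_bound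
  obtain ⟨Mφ, hMφ⟩ := hφ.exists_bound
  have hcd : Continuous (deriv cut) := contDiff_cut.continuous_deriv (by simp)
  -- This cutoff vanishes where both coordinates are at most `k` and equals `1` where one of them is
  -- at least `2 * k`. Each term of its gradient carries the complement of the other cutoff, so the
  -- gradient lives in the corner square only.
  set κ : ℝ → ℝ × ℝ → ℝ := fun k p => 1 - (1 - cutX k p) * (1 - cutY k p) with hκ
  have hκs : ∀ k, ContDiff ℝ ∞ (κ k) := fun k =>
    contDiff_const.sub ((contDiff_const.sub (contDiff_cutX k)).mul
      (contDiff_const.sub (contDiff_cutY k)))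
  have hκ1 : ∀ k p, |κ k p| ≤ 1 := fun k p => by
    have h1 := cut_nonneg (p.1 / k)
    have h2 := cut_nonneg (p.2 / k)
    have h3 := cut_le_one (p.1 / k)
    have h4 := cut_le_one (p.2 / k)
    simp only [hκ, cutX, cutY]
    rw [abs_le]
    constructor <;> nlinarith
  have hκt : ∀ p ∈ rect L₁ L₂, Tendsto (fun k => κ k p) (𝓝[>] 0) (𝓝 1) := fun p hp => by
    have h1 := tendsto_cut_div hp.1.1
    have h2 := tendsto_cut_div hp.2.1
    simpa [hκ, cutX, cutY] using
      ((h1.const_sub 1).mul (h2.const_sub 1)).const_sub 1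
  have hκd : ∀ k e p, dd e (κ k) p =
      deriv cut (p.1 / k) * (e.1 / k) * (1 - cutY k p) +
        deriv cut (p.2 / k) * (e.2 / k) * (1 - cutX k p) := by
    intro k e p
    have hX : HasFDerivAt (cutX k) (fderiv ℝ (cutX k) p) p :=
      (differentiable_of_smooth (contDiff_cutX k) p).hasFDerivAt
    have hY : HasFDerivAt (cutY k) (fderiv ℝ (cutY k) p) p :=
      (differentiable_of_smooth (contDiff_cutY k) p).hasFDerivAt
    have h1 := ((hX.const_sub 1).mul (hY.const_sub 1)).const_sub 1
    have h2 : dd e (κ k) p =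
        (-((1 - cutX k p) • -fderiv ℝ (cutY k) p + (1 - cutY k p) • -fderiv ℝ (cutX k) p)) e :=
      congrArg (fun A : ℝ × ℝ →L[ℝ] ℝ => A e) h1.fderiv
    rw [← dd_cutX, ← dd_cutY, h2]
    simp [dd]
    ring
  have hmw : MemLp (fun p => w p * (a p * dd (1, 0) φ p + b p * dd (0, 1) φ p)) 2
      (volume.restrict (rect L₁ L₂)) := by
    have m1 := (memLp_mul_bdd hw ha.continuous hMa).mul_test (hφ.dd (1, 0))
    have m2 := (memLp_mul_bdd hw hb.continuous hMb).mul_test (hφ.dd (0, 1))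
    refine (m1.add m2).ae_eq (Eventually.of_forall fun p => ?_)
    simp only [Pi.add_apply]
    ring
  have t1 := tendsto_integral_cutoff (integrable_of_L2 (hf.mul_test hφ)) (κ := κ)
    (fun k => (hκs k).continuous) hκ1 hκt
  have t2 := tendsto_integral_cutoff (integrable_of_L2 hmw) (κ := κ)
    (fun k => (hκs k).continuous) hκ1 hκt
  set g : ℝ → ℝ × ℝ → ℝ := fun k p => (a p * dd (1, 0) (κ k) p + b p * dd (0, 1) (κ k) p) * φ p
    with hg
  have hgc : ∀ k, Continuous (g k) := fun k =>
    ((ha.continuous.mul (contDiff_dd (hκs k) _).continuous).add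
      (hb.continuous.mul (contDiff_dd (hκs k) _).continuous)).mul hφ.continuous
  have habs : ∀ x : ℝ, |1 - cut x| ≤ 1 := fun x => by
    rw [abs_le]
    constructor <;> linarith [cut_nonneg x, cut_le_one x]
  have hgb : ∀ k, 0 < k → ∀ p, |g k p| ≤ ((Ma + Mb) * B * Mφ) / k := by
    intro k hk p
    have hx : |dd (1, 0) (κ k) p| ≤ B / k := by
      rw [hκd]
      simp only [zero_div, mul_zero, zero_mul, add_zero]
      rw [abs_mul, abs_mul, abs_of_pos (show 0 < 1 / k by positivity)]
      calc |deriv cut (p.1 / k)| * (1 / k) * |1 - cutY k p| ≤ B * (1 / k) * 1 := by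
            gcongr
            · exact hB _
            · exact habs _
        _ = B / k := by ring
    have hy : |dd (0, 1) (κ k) p| ≤ B / k := by
      rw [hκd]
      simp only [zero_div, mul_zero, zero_mul, zero_add]
      rw [abs_mul, abs_mul, abs_of_pos (show 0 < 1 / k by positivity)]
      calc |deriv cut (p.2 / k)| * (1 / k) * |1 - cutX k p| ≤ B * (1 / k) * 1 := by
            gcongr
            · exact hB _
            · exact habs _
        _ = B / k := by ring
    calc |g k p| ≤ (|a p| * |dd (1, 0) (κ k) p| + |b p| * |dd (0, 1) (κ k) p|) * |φ p| := by
          simp only [hg]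
          rw [abs_mul, ← abs_mul (a p), ← abs_mul (b p)]
          exact mul_le_mul_of_nonneg_right (abs_add_le _ _) (abs_nonneg _)
      _ ≤ (Ma * (B / k) + Mb * (B / k)) * Mφ := by
          have := hMa p
          have := hMb p
          have := hMφ p
          gcongr
      _ = _ := by ring
  have hg0 : ∀ k, 0 < k → ∀ p : ℝ × ℝ, 2 * k < p.1 ∨ 2 * k < p.2 → g k p = 0 := by
    intro k hk p hp
    have h0 : ∀ e, dd e (κ k) p = 0 := by
      intro e
      rw [hκd]
      rcases hp with hp | hp
      · have h1 : 2 < p.1 / k := by rw [lt_div_iff₀ hk]; exact hp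
        rw [deriv_cut_of_notMem (Or.inr h1), show cutX k p = 1 from cut_of_ge h1.le]
        ring
      · have h1 : 2 < p.2 / k := by rw [lt_div_iff₀ hk]; exact hp
        rw [deriv_cut_of_notMem (Or.inr h1), show cutY k p = 1 from cut_of_ge h1.le]
        ring
    simp only [hg, h0]
    ring
  have t3 := tendsto_integral_corner hw hgc hgb hg0
  have t4 := (t2.add t3).neg
  rw [add_zero] at t4
  refine tendsto_nhds_unique (t1.congr' ?_) t4
  filter_upwards [self_mem_nhdsWithin] with k hk
  have hk : 0 < k := hk
  have h1 := wd_extend_of_vanish_corner hL₁ hL₂ hw hf hv ha hMa hb hMb h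
    (hφ.smooth_mul (hκs k)) hk (fun p hp1 hp2 => by
      simp only [hκ]
      rw [show cutX k p = 0 from cut_of_le ((div_le_one hk).2 hp1.le),
        show cutY k p = 0 from cut_of_le ((div_le_one hk).2 hp2.le)]
      ring)
  have hi1 : Integrable (fun p => w p * (a p * dd (1, 0) φ p + b p * dd (0, 1) φ p) * κ k p)
      (volume.restrict (rect L₁ L₂)) :=
    (integrable_of_L2 hmw).mul_bdd (c := 1) (hκs k).continuous.aestronglyMeasurable
      (Eventually.of_forall fun p => hκ1 k p)
  have hi2 : Integrable (fun p => w p * g k p) (volume.restrict (rect L₁ L₂)) :=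
    (integrable_of_L2 hw).mul_bdd (hgc k).aestronglyMeasurable
      (Eventually.of_forall fun p => hgb k hk p)
  rw [← integral_add hi1 hi2]
  refine Eq.trans ?_ (h1.trans (congrArg Neg.neg ?_))
  · refine integral_congr_ae (Eventually.of_forall fun p => ?_)
    simp only []
    ring
  · refine integral_congr_ae (Eventually.of_forall fun p => ?_)
    simp only [hg]
    have hdκ := differentiable_of_smooth (hκs k) p
    have hdφ := differentiable_of_smooth hφ.1 p
    rw [dd_mul hdκ hdφ, dd_mul hdκ hdφ]
    ring

end ZeroExtension

/-! ### Density of test functions -/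

/-- A smooth cutoff of the rectangle. -/
noncomputable def cutRect (L₁ L₂ h : ℝ) (p : ℝ × ℝ) : ℝ :=
  cut (p.1 / h) * cut (p.2 / h) * (cut ((L₁ - p.1) / h) * cut ((L₂ - p.2) / h))

lemma testOn_cutRect_mul {L₁ L₂ h : ℝ} (hh : 0 < h) {g : ℝ × ℝ → ℝ} (hg : ContDiff ℝ ∞ g) :
    TestOn (rect L₁ L₂) fun p => cutRect L₁ L₂ h p * g p := by
  have hc : ContDiff ℝ ∞ (cutRect L₁ L₂ h) :=
    ((contDiff_cut.comp (contDiff_fst.div_const h)).mul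
      (contDiff_cut.comp (contDiff_snd.div_const h))).mul
      ((contDiff_cut.comp ((contDiff_const.sub contDiff_fst).div_const h)).mul
      (contDiff_cut.comp ((contDiff_const.sub contDiff_snd).div_const h)))
  have h1 : Function.support (fun p => cutRect L₁ L₂ h p * g p) ⊆
      Icc h (L₁ - h) ×ˢ Icc h (L₂ - h) := by
    intro p hp
    have h2 := left_ne_zero_of_mul hp
    have hx : ∀ x : ℝ, cut (x / h) ≠ 0 → h ≤ x := fun x hx => by
      by_contra hlt
      exact hx (cut_of_le ((div_le_one hh).2 (not_le.1 hlt).le))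
    have e1 := hx _ (left_ne_zero_of_mul (left_ne_zero_of_mul h2))
    have e2 := hx _ (right_ne_zero_of_mul (left_ne_zero_of_mul h2))
    have e3 := hx _ (left_ne_zero_of_mul (right_ne_zero_of_mul h2))
    have e4 := hx _ (right_ne_zero_of_mul (right_ne_zero_of_mul h2))
    exact ⟨⟨e1, by linarith⟩, ⟨e2, by linarith⟩⟩
  refine ⟨hc.mul hg, HasCompactSupport.of_support_subset_isCompact
    (isCompact_Icc.prod isCompact_Icc) h1, fun p hp => ?_⟩
  have h3 := closure_minimal h1 (isClosed_Icc.prod isClosed_Icc) hp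
  obtain ⟨⟨a1, a2⟩, a3, a4⟩ := h3
  exact ⟨⟨by linarith, by linarith⟩, ⟨by linarith, by linarith⟩⟩

lemma abs_one_sub_cutRect_le (L₁ L₂ h : ℝ) (p : ℝ × ℝ) : |1 - cutRect L₁ L₂ h p| ≤ 1 := by
  have h0 : 0 ≤ cutRect L₁ L₂ h p :=
    mul_nonneg (mul_nonneg (cut_nonneg _) (cut_nonneg _)) (mul_nonneg (cut_nonneg _) (cut_nonneg _))
  have h1 : cutRect L₁ L₂ h p ≤ 1 :=
    mul_le_one₀ (mul_le_one₀ (cut_le_one _) (cut_nonneg _) (cut_le_one _))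
      (mul_nonneg (cut_nonneg _) (cut_nonneg _))
      (mul_le_one₀ (cut_le_one _) (cut_nonneg _) (cut_le_one _))
  rw [abs_le]
  constructor <;> linarith

/-- Approximate by a smooth function on the plane and multiply by `cutRect`; the part cut off is
small by dominated convergence. This reduces the Friedrichs lemma to test functions. -/
lemma exists_testOn_eLpNorm_sub_le {L₁ L₂ : ℝ} {u : ℝ × ℝ → ℝ}
    (hu : MemLp u 2 (volume.restrict (rect L₁ L₂))) {η : ℝ≥0∞} (hη : η ≠ 0) :
    ∃ φ, TestOn (rect L₁ L₂) φ ∧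
      eLpNorm (fun p => u p - φ p) 2 (volume.restrict (rect L₁ L₂)) ≤ η := by
  set μ := volume.restrict (rect L₁ L₂) with hμ
  obtain ⟨r, hr0, hr⟩ : ∃ r : ℝ, 0 < r ∧ ENNReal.ofReal r ≤ η / 2 := by
    obtain ⟨r, hr0, hr⟩ := ENNReal.lt_iff_exists_real_btwn.1
      (show (0 : ℝ≥0∞) < η / 2 from ENNReal.half_pos hη)
    exact ⟨r, ENNReal.ofReal_pos.1 hr.1, hr.2.le⟩
  obtain ⟨g, hgc, hgs, hgu⟩ := hu.exist_eLpNorm_sub_le (by norm_num) (by norm_num) hr0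
  have hg2 : MemLp g 2 μ := memLp_of_continuous hgs.continuous 2
  have hlim : Tendsto (fun h => ∫⁻ p, ‖(1 - cutRect L₁ L₂ h p) * g p‖ₑ ^ 2 ∂μ) (𝓝[>] 0) (𝓝 0) := by
    have h1 : Tendsto (fun h => ∫⁻ p, ‖(1 - cutRect L₁ L₂ h p) * g p‖ₑ ^ 2 ∂μ) (𝓝[>] 0)
        (𝓝 (∫⁻ _, 0 ∂μ)) := by
      refine tendsto_lintegral_filter_of_dominated_convergence (fun p => ‖g p‖ₑ ^ 2) ?_ ?_ ?_ ?_
      · filter_upwards [self_mem_nhdsWithin] with h hh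
        have hc := (testOn_cutRect_mul (L₁ := L₁) (L₂ := L₂) (show (0 : ℝ) < h from hh)
          (contDiff_const (c := (1 : ℝ)))).continuous
        simp only [mul_one] at hc
        exact (((continuous_const.sub hc).mul hgs.continuous).enorm.measurable).pow_const 2
      · refine Eventually.of_forall fun h => Eventually.of_forall fun p => ?_
        gcongr
        rw [enorm_mul]
        refine mul_le_of_le_one_left' ?_
        rw [Real.enorm_eq_ofReal_abs]
        exact ENNReal.ofReal_le_one.2 (abs_one_sub_cutRect_le _ _ _ _)
      · rw [← eLpNorm_two_sq]
        exact (ENNReal.pow_lt_top hg2.2).ne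
      · filter_upwards [ae_restrict_mem (measurableSet_rect L₁ L₂)] with p hp
        have t1 := ((tendsto_cut_div hp.1.1).mul (tendsto_cut_div hp.2.1)).mul
          ((tendsto_cut_div (sub_pos.2 hp.1.2)).mul (tendsto_cut_div (sub_pos.2 hp.2.2)))
        have t2 := (ENNReal.continuous_pow 2).tendsto _ |>.comp
          ((t1.const_sub 1).mul_const (g p)).enorm
        simpa [cutRect, Function.comp_def] using t2
    simpa using h1
  have hη2 : (η / 2) ^ 2 ≠ 0 := pow_ne_zero _ (ENNReal.half_pos hη).ne'
  obtain ⟨h, hh1, hh⟩ := ((hlim.eventually (gt_mem_nhds (pos_iff_ne_zero.2 hη2))).and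
    self_mem_nhdsWithin).exists
  have hh : 0 < h := hh
  have ht := testOn_cutRect_mul (L₁ := L₁) (L₂ := L₂) hh hgs
  refine ⟨_, ht, ?_⟩
  rw [← eLpNorm_two_sq] at hh1
  have h3 : eLpNorm (fun p => (1 - cutRect L₁ L₂ h p) * g p) 2 μ ≤ η / 2 :=
    ((ENNReal.pow_right_strictMono two_ne_zero).lt_iff_lt.1 hh1).le
  have e : (fun p => u p - cutRect L₁ L₂ h p * g p) =
      (u - g) + fun p => (1 - cutRect L₁ L₂ h p) * g p := by
    funext p
    simp only [Pi.add_apply, Pi.sub_apply]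
    ring
  have hm : MemLp (fun p => (1 - cutRect L₁ L₂ h p) * g p) 2 μ := by
    refine (hg2.sub (ht.memLp 2 _)).ae_eq (Eventually.of_forall fun p => ?_)
    simp only [Pi.sub_apply]
    ring
  rw [e]
  calc _ ≤ eLpNorm (u - g) 2 μ + eLpNorm (fun p => (1 - cutRect L₁ L₂ h p) * g p) 2 μ :=
        eLpNorm_add_le (hu.1.sub hg2.1) hm.1 (by norm_num)
    _ ≤ η / 2 + η / 2 := add_le_add (hgu.trans hr) h3
    _ = η := ENNReal.add_halves η

/-! ### The commutator of mollification and transport -/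

section Friedrichs

variable {L₁ L₂ : ℝ} {Λ l : ℝ × ℝ → ℝ} {K M : NNReal}

/-- The commutator of the mollification and the transport operator. -/
noncomputable def comm (L₁ L₂ : ℝ) (Λ l : ℝ × ℝ → ℝ) (ε : ℝ) (u : ℝ × ℝ → ℝ) (p : ℝ × ℝ) : ℝ :=
  (Λ p * dd (1, 0) (moll L₁ L₂ ε u) p - dd (1, 0) (moll L₁ L₂ ε fun q => Λ q * u q) p) +
    moll L₁ L₂ ε (fun q => l q * u q) p

lemma memLp_bdd_mul {S : Set (ℝ × ℝ)} {u c : ℝ × ℝ → ℝ} {C : ℝ}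
    (hu : MemLp u 2 (volume.restrict S)) (hc : Continuous c) (hC : ∀ p, |c p| ≤ C) :
    MemLp (fun p => c p * u p) 2 (volume.restrict S) := by
  simpa only [mul_comm] using memLp_mul_bdd hu hc hC

lemma moll_sub {ε : ℝ} (hε : 0 < ε) {u v : ℝ × ℝ → ℝ}
    (hu : MemLp u 2 (volume.restrict (rect L₁ L₂))) (hv : MemLp v 2 (volume.restrict (rect L₁ L₂))) :
    moll L₁ L₂ ε (fun q => u q - v q) = fun p => moll L₁ L₂ ε u p - moll L₁ L₂ ε v p := by
  funext p
  rw [moll, moll, moll, ← cv_sub (locallyIntegrable_ext hu) (locallyIntegrable_ext hv)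
    (ker_testOn hε)]
  congr 1
  funext q
  by_cases hq : q ∈ rect L₁ L₂ <;> simp [ext, hq]

lemma dd_moll_sub {ε : ℝ} (hε : 0 < ε) {u v : ℝ × ℝ → ℝ}
    (hu : MemLp u 2 (volume.restrict (rect L₁ L₂))) (hv : MemLp v 2 (volume.restrict (rect L₁ L₂)))
    (e p : ℝ × ℝ) : dd e (moll L₁ L₂ ε (fun q => u q - v q)) p =
      dd e (moll L₁ L₂ ε u) p - dd e (moll L₁ L₂ ε v) p := by
  rw [moll_sub hε hu hv, dd, dd, dd,
    fderiv_fun_sub (differentiable_of_smooth (contDiff_moll hε hu) p)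
      (differentiable_of_smooth (contDiff_moll hε hv) p)]
  simp

lemma comm_sub {ε : ℝ} (hε : 0 < ε) (hΛ : Continuous Λ) (hM : ∀ p, |Λ p| ≤ M)
    (hl : MemLp l ⊤ (volume.restrict (rect L₁ L₂))) {u v : ℝ × ℝ → ℝ}
    (hu : MemLp u 2 (volume.restrict (rect L₁ L₂))) (hv : MemLp v 2 (volume.restrict (rect L₁ L₂)))
    (p : ℝ × ℝ) : comm L₁ L₂ Λ l ε (fun q => u q - v q) p =
      comm L₁ L₂ Λ l ε u p - comm L₁ L₂ Λ l ε v p := by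
  simp only [comm, mul_sub]
  rw [dd_moll_sub hε hu hv, dd_moll_sub hε (memLp_bdd_mul hu hΛ hM) (memLp_bdd_mul hv hΛ hM),
    moll_sub hε (memLp_mul_of_top hu hl) (memLp_mul_of_top hv hl)]
  ring

lemma continuous_dd_moll {ε : ℝ} (hε : 0 < ε) {u : ℝ × ℝ → ℝ}
    (hu : MemLp u 2 (volume.restrict (rect L₁ L₂))) (e : ℝ × ℝ) :
    Continuous (dd e (moll L₁ L₂ ε u)) := (contDiff_dd (contDiff_moll hε hu) e).continuous

lemma continuous_comm {ε : ℝ} (hε : 0 < ε) (hΛ : Continuous Λ) (hM : ∀ p, |Λ p| ≤ M)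
    (hl : MemLp l ⊤ (volume.restrict (rect L₁ L₂))) {u : ℝ × ℝ → ℝ}
    (hu : MemLp u 2 (volume.restrict (rect L₁ L₂))) : Continuous (comm L₁ L₂ Λ l ε u) :=
  ((hΛ.mul (continuous_dd_moll hε hu _)).sub
    (continuous_dd_moll hε (memLp_bdd_mul hu hΛ hM) _)).add
    (contDiff_moll hε (memLp_mul_of_top hu hl)).continuous

/-- The integrand is `(Λ p - Λ q) * dd (1, 0) (ker ε) (p - q)` times the extended `u q`, and the
first factor is at most `K * (3 * ε)` on the support of the kernel. -/
lemma enorm_commutator_le {ε : ℝ} (hε : 0 < ε) (hΛ : LipschitzWith K Λ) (hM : ∀ p, |Λ p| ≤ M)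
    {u : ℝ × ℝ → ℝ} (hu : MemLp u 2 (volume.restrict (rect L₁ L₂))) (p : ℝ × ℝ) :
    ‖Λ p * dd (1, 0) (moll L₁ L₂ ε u) p - dd (1, 0) (moll L₁ L₂ ε fun q => Λ q * u q) p‖ₑ ≤
      ∫⁻ q, ‖(K * (3 * ε)) * dd (1, 0) (ker ε) (p - q)‖ₑ * ‖ext L₁ L₂ u q‖ₑ := by
  have hΛu := memLp_bdd_mul hu hΛ.continuous hM
  have hk := (ker_testOn hε).dd (1, 0)
  rw [moll, moll, dd_cv (locallyIntegrable_ext hu) (ker_testOn hε),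
    dd_cv (locallyIntegrable_ext hΛu) (ker_testOn hε), cv, cv, ← integral_const_mul,
    ← integral_sub ((integrable_cv (locallyIntegrable_ext hu) hk p).const_mul _)
      (integrable_cv (locallyIntegrable_ext hΛu) hk p)]
  refine (enorm_integral_le_lintegral_enorm _).trans (lintegral_mono fun q => ?_)
  rw [← enorm_mul]
  refine enorm_le_iff_norm_le.2 ?_
  have e : Λ p * (ext L₁ L₂ u q * dd (1, 0) (ker ε) (p - q)) -
      ext L₁ L₂ (fun q => Λ q * u q) q * dd (1, 0) (ker ε) (p - q) =
      (Λ p - Λ q) * (dd (1, 0) (ker ε) (p - q) * ext L₁ L₂ u q) := by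
    by_cases hq : q ∈ rect L₁ L₂ <;> simp [ext, hq]
    ring
  rw [e, mul_assoc, norm_mul, norm_mul (K * (3 * ε) : ℝ)]
  by_cases h0 : dd (1, 0) (ker ε) (p - q) = 0
  · simp [h0]
  · have h1 := dist_le_of_ker_ne_zero hε
      (tsupport_dd_subset (1, 0) (ker ε) (subset_tsupport _ h0))
    have h2 := hΛ.dist_le_mul p q
    rw [Real.dist_eq] at h2
    refine mul_le_mul_of_nonneg_right ?_ (norm_nonneg _)
    rw [Real.norm_eq_abs, Real.norm_eq_abs, abs_of_nonneg (a := (K * (3 * ε) : ℝ)) (by positivity)]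
    exact h2.trans (by gcongr)

/-- The commutators are bounded on `L²`, uniformly in the scale. -/
lemma exists_eLpNorm_comm_le (hΛ : LipschitzWith K Λ) (hM : ∀ p, |Λ p| ≤ M)
    (hl : MemLp l ⊤ (volume.restrict (rect L₁ L₂))) :
    ∃ C : ℝ≥0∞, C ≠ ⊤ ∧ ∀ ε, 0 < ε → ∀ u, MemLp u 2 (volume.restrict (rect L₁ L₂)) →
      eLpNorm (comm L₁ L₂ Λ l ε u) 2 (volume.restrict (rect L₁ L₂)) ≤
        C * eLpNorm u 2 (volume.restrict (rect L₁ L₂)) := by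
  set μ := volume.restrict (rect L₁ L₂) with hμ
  have hext : ∀ u, eLpNorm (ext L₁ L₂ u) 2 volume = eLpNorm u 2 μ := fun u =>
    eLpNorm_indicator_eq_eLpNorm_restrict (measurableSet_rect L₁ L₂)
  -- In the first summand the gain `3 * K * ε` meets the loss `ε⁻¹ * ∫ |∂_x rho|` of the
  -- differentiated kernel. The second summand bounds the mollification of `l * u`.
  refine ⟨ENNReal.ofReal (3 * K * ∫ p, |dd (1, 0) rho p|) + eLpNorm l ⊤ μ,
    ENNReal.add_ne_top.2 ⟨ENNReal.ofReal_ne_top, hl.2.ne⟩, fun ε hε u hu => ?_⟩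
  have h1 : eLpNorm (fun p => Λ p * dd (1, 0) (moll L₁ L₂ ε u) p -
      dd (1, 0) (moll L₁ L₂ ε fun q => Λ q * u q) p) 2 μ ≤
      ENNReal.ofReal (3 * K * ∫ p, |dd (1, 0) rho p|) * eLpNorm u 2 μ := by
    rw [← hext u]
    refine eLpNorm_le_of_young (k := fun x => (K * (3 * ε)) * dd (1, 0) (ker ε) x)
      (continuous_const.mul ((ker_testOn hε).dd (1, 0)).continuous).measurable (memLp_ext hu).1 ?_
      (Eventually.of_forall fun p => enorm_commutator_le hε hΛ hM hu p)
    simp only [enorm_mul (K * (3 * ε) : ℝ)]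
    rw [lintegral_const_mul' _ _ enorm_ne_top, lintegral_dd_ker hε,
      Real.enorm_eq_ofReal_abs, abs_of_nonneg (by positivity),
      ← ENNReal.ofReal_mul (by positivity)]
    refine ENNReal.ofReal_le_ofReal (le_of_eq ?_)
    field_simp
  have h2 : eLpNorm (moll L₁ L₂ ε fun q => l q * u q) 2 μ ≤ eLpNorm l ⊤ μ * eLpNorm u 2 μ := by
    refine (eLpNorm_mono_measure _ Measure.restrict_le_self).trans ?_
    refine (eLpNorm_cv_ker_le hε (memLp_ext (memLp_mul_of_top hu hl)).1).trans ?_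
    rw [hext]
    have h3 : eLpNorm (l • u) 2 μ ≤ eLpNorm l ⊤ μ * eLpNorm u 2 μ :=
      eLpNorm_smul_le_mul_eLpNorm (p := ⊤) (q := 2) (r := 2) hu.1 hl.1
    exact h3
  rw [add_mul]
  refine (eLpNorm_add_le ?_ ?_ (by norm_num)).trans (add_le_add h1 h2)
  · exact ((hΛ.continuous.mul (continuous_dd_moll hε hu _)).sub
      (continuous_dd_moll hε (memLp_bdd_mul hu hΛ.continuous hM) _)).aestronglyMeasurable
  · exact (contDiff_moll hε (memLp_mul_of_top hu hl)).continuous.aestronglyMeasurable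

/-- A test function vanishes near the whole boundary, so its zero extension may be differentiated
freely. Since `∂_x(Λ φ) = l φ + Λ φ_x`, the last term of `comm` cancels the part with `l`, and what
remains is a difference of two mollifications with the common limit `Λ φ_x`. -/
lemma comm_test {ε : ℝ} (hε : 0 < ε) (hΛ : Continuous Λ) (hM : ∀ p, |Λ p| ≤ M)
    (hl : MemLp l ⊤ (volume.restrict (rect L₁ L₂))) (hx : WD L₁ L₂ (1, 0) Λ l) {φ : ℝ × ℝ → ℝ}
    (hφ : TestOn (rect L₁ L₂) φ) (p : ℝ × ℝ) :
    comm L₁ L₂ Λ l ε φ p = Λ p * moll L₁ L₂ ε (dd (1, 0) φ) p -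
      moll L₁ L₂ ε (fun q => Λ q * dd (1, 0) φ q) p := by
  have hφ2 := hφ.memLp 2 (rect L₁ L₂)
  have hdφ2 := (hφ.dd (1, 0)).memLp 2 (rect L₁ L₂)
  have hp : TestOn univ fun q => ker ε (p - q) := testOn_ker_sub hε (subset_univ _)
  have e1 : dd (1, 0) (moll L₁ L₂ ε φ) p = moll L₁ L₂ ε (dd (1, 0) φ) p := by
    refine dd_moll_eq hε hφ2 (fun ψ hψ => ?_) hp
    have h1 := integral_mul_dd hψ.1 hφ (1, 0)
    simp only [mul_comm (φ _), mul_comm (dd (1, 0) φ _)]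
    linarith
  have e2 : dd (1, 0) (moll L₁ L₂ ε fun q => Λ q * φ q) p =
      moll L₁ L₂ ε (fun q => l q * φ q - (-(Λ q * dd (1, 0) φ q))) p := by
    refine dd_moll_eq hε (memLp_bdd_mul hφ2 hΛ hM) (fun ψ hψ => ?_) hp
    have h1 := hx _ (hφ.smooth_mul hψ.1)
    have i1 : Integrable (fun q => Λ q * φ q * dd (1, 0) ψ q) (volume.restrict (rect L₁ L₂)) :=
      integrable_mul_of_L2 (memLp_bdd_mul hφ2 hΛ hM) ((hψ.dd _).memLp 2 _)
    have i2 : Integrable (fun q => Λ q * dd (1, 0) φ q * ψ q) (volume.restrict (rect L₁ L₂)) :=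
      integrable_mul_of_L2 (memLp_bdd_mul hdφ2 hΛ hM) (hψ.memLp 2 _)
    have i3 : Integrable (fun q => l q * φ q * ψ q) (volume.restrict (rect L₁ L₂)) :=
      integrable_mul_of_L2 (memLp_mul_of_top hφ2 hl) (hψ.memLp 2 _)
    have h2 : ∫ q in rect L₁ L₂, Λ q * dd (1, 0) (fun q => ψ q * φ q) q =
        (∫ q in rect L₁ L₂, Λ q * φ q * dd (1, 0) ψ q) +
          ∫ q in rect L₁ L₂, Λ q * dd (1, 0) φ q * ψ q := by
      rw [← integral_add i1 i2]
      refine integral_congr_ae (Eventually.of_forall fun q => ?_)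
      beta_reduce
      rw [dd_mul (differentiable_of_smooth hψ.1 q) (differentiable_of_smooth hφ.1 q)]
      ring
    have h3 : ∫ q in rect L₁ L₂, (l q * φ q - (-(Λ q * dd (1, 0) φ q))) * ψ q =
        (∫ q in rect L₁ L₂, l q * φ q * ψ q) + ∫ q in rect L₁ L₂, Λ q * dd (1, 0) φ q * ψ q := by
      rw [← integral_add i3 i2]
      refine integral_congr_ae (Eventually.of_forall fun q => ?_)
      ring
    have h4 : ∫ q in rect L₁ L₂, l q * (ψ q * φ q) = ∫ q in rect L₁ L₂, l q * φ q * ψ q :=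
      integral_congr_ae (Eventually.of_forall fun q => by ring)
    rw [h2, h4] at h1
    rw [h3]
    linarith
  have hneg : MemLp (fun q => -(Λ q * dd (1, 0) φ q)) 2 (volume.restrict (rect L₁ L₂)) :=
    (memLp_bdd_mul hdφ2 hΛ hM).neg
  have e3 : moll L₁ L₂ ε (fun q => -(Λ q * dd (1, 0) φ q)) p =
      -moll L₁ L₂ ε (fun q => Λ q * dd (1, 0) φ q) p := by
    rw [moll, moll, cv_ext, cv_ext, ← integral_neg]
    simp only [neg_mul]
  rw [comm, e1, e2, moll_sub hε (memLp_mul_of_top hφ2 hl) hneg]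
  simp only [e3]
  ring

lemma tendsto_comm_test (hΛ : Continuous Λ) (hM : ∀ p, |Λ p| ≤ M)
    (hl : MemLp l ⊤ (volume.restrict (rect L₁ L₂))) (hx : WD L₁ L₂ (1, 0) Λ l) {φ : ℝ × ℝ → ℝ}
    (hφ : TestOn (rect L₁ L₂) φ) :
    Tendsto (fun ε => eLpNorm (comm L₁ L₂ Λ l ε φ) 2 (volume.restrict (rect L₁ L₂))) (𝓝[>] 0)
      (𝓝 0) := by
  set μ := volume.restrict (rect L₁ L₂) with hμ
  have hd2 : MemLp (dd (1, 0) φ) 2 μ := (hφ.dd (1, 0)).memLp 2 (rect L₁ L₂)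
  have hΛd := memLp_bdd_mul hd2 hΛ hM
  have t : Tendsto (fun ε =>
      ENNReal.ofReal M * eLpNorm (fun p => moll L₁ L₂ ε (dd (1, 0) φ) p - dd (1, 0) φ p) 2 μ +
      eLpNorm (fun p => moll L₁ L₂ ε (fun q => Λ q * dd (1, 0) φ q) p - Λ p * dd (1, 0) φ p) 2 μ)
      (𝓝[>] 0) (𝓝 0) := by
    have h := (ENNReal.Tendsto.const_mul (a := ENNReal.ofReal M) (tendsto_moll hd2)
      (Or.inr ENNReal.ofReal_ne_top)).add (tendsto_moll hΛd)
    rwa [mul_zero, add_zero] at h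
  refine tendsto_of_tendsto_of_tendsto_of_le_of_le' tendsto_const_nhds t
    (Eventually.of_forall fun _ => zero_le) ?_
  filter_upwards [self_mem_nhdsWithin] with ε hε
  have hε : 0 < ε := hε
  have e : comm L₁ L₂ Λ l ε φ =
      (fun p => Λ p * (moll L₁ L₂ ε (dd (1, 0) φ) p - dd (1, 0) φ p)) -
        fun p => moll L₁ L₂ ε (fun q => Λ q * dd (1, 0) φ q) p - Λ p * dd (1, 0) φ p := by
    funext p
    rw [comm_test hε hΛ hM hl hx hφ]
    simp only [Pi.sub_apply]
    ring
  have hs : MemLp (fun p => moll L₁ L₂ ε (dd (1, 0) φ) p - dd (1, 0) φ p) 2 μ :=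
    (memLp_moll hε hd2).sub hd2
  rw [e]
  refine (eLpNorm_sub_le (memLp_bdd_mul hs hΛ hM).1 ((memLp_moll hε hΛd).sub hΛd).1
    (by norm_num)).trans (add_le_add ?_ le_rfl)
  refine eLpNorm_le_mul_eLpNorm_of_ae_le_mul (Eventually.of_forall fun p => ?_) 2
  rw [norm_mul]
  exact mul_le_mul_of_nonneg_right (hM p) (norm_nonneg _)

/-- The Friedrichs lemma. -/
lemma tendsto_comm (hΛ : LipschitzWith K Λ) (hM : ∀ p, |Λ p| ≤ M)
    (hl : MemLp l ⊤ (volume.restrict (rect L₁ L₂))) (hx : WD L₁ L₂ (1, 0) Λ l) {u : ℝ × ℝ → ℝ}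
    (hu : MemLp u 2 (volume.restrict (rect L₁ L₂))) :
    Tendsto (fun ε => eLpNorm (comm L₁ L₂ Λ l ε u) 2 (volume.restrict (rect L₁ L₂))) (𝓝[>] 0)
      (𝓝 0) := by
  obtain ⟨C, hC, hb⟩ := exists_eLpNorm_comm_le hΛ hM hl
  rw [ENNReal.tendsto_nhds_zero]
  intro η hη
  have hη2 : η / 2 ≠ 0 := (ENNReal.half_pos hη.ne').ne'
  -- The tolerance is nonzero because `C ≠ ⊤`; for `C = 0` it is `⊤`, and the bound by `η / 2` below
  -- still holds.
  obtain ⟨φ, hφ, hφu⟩ := exists_testOn_eLpNorm_sub_le hu (η := η / 2 / C)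
    (ENNReal.div_ne_zero.2 ⟨hη2, hC⟩)
  have hφ2 := hφ.memLp 2 (rect L₁ L₂)
  have ht := ENNReal.tendsto_nhds_zero.1 (tendsto_comm_test hΛ.continuous hM hl hx hφ) (η / 2)
    (pos_iff_ne_zero.2 hη2)
  filter_upwards [ht, self_mem_nhdsWithin] with ε h1 hε
  have hε : 0 < ε := hε
  have e : comm L₁ L₂ Λ l ε u =
      comm L₁ L₂ Λ l ε (fun q => u q - φ q) + comm L₁ L₂ Λ l ε φ := by
    funext p
    rw [Pi.add_apply, comm_sub hε hΛ.continuous hM hl hu hφ2, sub_add_cancel]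
  rw [e]
  calc _ ≤ eLpNorm (comm L₁ L₂ Λ l ε (fun q => u q - φ q)) 2 _ +
        eLpNorm (comm L₁ L₂ Λ l ε φ) 2 _ :=
        eLpNorm_add_le (continuous_comm hε hΛ.continuous hM hl (hu.sub hφ2)).aestronglyMeasurable
          (continuous_comm hε hΛ.continuous hM hl hφ2).aestronglyMeasurable (by norm_num)
    _ ≤ C * (η / 2 / C) + η / 2 :=
        add_le_add ((hb ε hε _ (hu.sub hφ2)).trans (mul_le_mul_right hφu C)) h1
    _ ≤ η / 2 + η / 2 := by gcongr; exact ENNReal.mul_div_le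
    _ = η := ENNReal.add_halves η

/-- On the rectangle, the commutator is the transport of the mollification minus the mollification
of the transport. -/
lemma comm_eq_of_WT (hL₁ : 0 < L₁) (hL₂ : 0 < L₂) (hΛ : LipschitzWith K Λ) (hM : ∀ p, |Λ p| ≤ M)
    (hl : MemLp l ⊤ (volume.restrict (rect L₁ L₂))) {w f : ℝ × ℝ → ℝ}
    (hw : MemLp w 2 (volume.restrict (rect L₁ L₂))) (hf : MemLp f 2 (volume.restrict (rect L₁ L₂)))
    (hv : VanishesOnGam L₁ L₂ w) (hT : WT L₁ L₂ Λ l w f) {ε : ℝ} (hε : 0 < ε) {p : ℝ × ℝ}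
    (hp : p ∈ rect L₁ L₂) :
    comm L₁ L₂ Λ l ε w p = Λ p * dd (1, 0) (moll L₁ L₂ ε w) p + dd (0, 1) (moll L₁ L₂ ε w) p -
      moll L₁ L₂ ε f p := by
  have hlw := memLp_mul_of_top hw hl
  have hΛw := memLp_bdd_mul hw hΛ.continuous hM
  -- The equation is put in divergence form, `∂_x(Λ w) + ∂_y w = f + l w`, as `wd_extend` requires.
  have hf' : MemLp (fun q => f q + l q * w q) 2 (volume.restrict (rect L₁ L₂)) := hf.add hlw
  have h0 : ∀ φ, TestOn (rect L₁ L₂) φ → ∫ q in rect L₁ L₂, (f q + l q * w q) * φ q =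
      -∫ q in rect L₁ L₂, w q * (Λ q * dd (1, 0) φ q + 1 * dd (0, 1) φ q) := by
    intro φ hφ
    have h1 := hT φ hφ
    have i1 : Integrable (fun q => f q * φ q) (volume.restrict (rect L₁ L₂)) :=
      integrable_of_L2 (hf.mul_test hφ)
    have i2 : Integrable (fun q => l q * w q * φ q) (volume.restrict (rect L₁ L₂)) :=
      integrable_of_L2 (hlw.mul_test hφ)
    have i3 : Integrable (fun q => Λ q * w q * dd (1, 0) φ q) (volume.restrict (rect L₁ L₂)) :=
      integrable_of_L2 (hΛw.mul_test (hφ.dd _))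
    have i4 : Integrable (fun q => w q * dd (0, 1) φ q) (volume.restrict (rect L₁ L₂)) :=
      integrable_of_L2 (hw.mul_test (hφ.dd _))
    have e1 : ∫ q in rect L₁ L₂, (f q + l q * w q) * φ q =
        (∫ q in rect L₁ L₂, f q * φ q) + ∫ q in rect L₁ L₂, l q * w q * φ q := by
      rw [← integral_add i1 i2]
      simp only [add_mul]
    have e2 : ∫ q in rect L₁ L₂, w q * (l q * φ q + Λ q * dd (1, 0) φ q) =
        (∫ q in rect L₁ L₂, l q * w q * φ q) + ∫ q in rect L₁ L₂, Λ q * w q * dd (1, 0) φ q := by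
      rw [← integral_add i2 i3]
      exact integral_congr_ae (Eventually.of_forall fun q => by ring)
    have e3 : ∫ q in rect L₁ L₂, w q * (Λ q * dd (1, 0) φ q + 1 * dd (0, 1) φ q) =
        (∫ q in rect L₁ L₂, Λ q * w q * dd (1, 0) φ q) + ∫ q in rect L₁ L₂, w q * dd (0, 1) φ q := by
      rw [← integral_add i3 i4]
      exact integral_congr_ae (Eventually.of_forall fun q => by ring)
    rw [e1, e3, h1, e2]
    ring
  have hk := testOn_ker_sub_lowerLeft hε hp
  have h1 := wd_extend (a := Λ) (b := fun _ => 1) (Kb := 0) (Mb := 1) hL₁ hL₂ hw hf' hv hΛ hM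
    (LipschitzWith.const 1) (by simp) h0 hk
  have e4 : moll L₁ L₂ ε f p + moll L₁ L₂ ε (fun q => l q * w q) p =
      ∫ q in rect L₁ L₂, (f q + l q * w q) * ker ε (p - q) := by
    rw [moll, moll, cv_ext, cv_ext,
      ← integral_add (integrable_of_L2 (hf.mul_test hk)) (integrable_of_L2 (hlw.mul_test hk))]
    simp only [add_mul]
  have e5 : dd (1, 0) (moll L₁ L₂ ε fun q => Λ q * w q) p + dd (0, 1) (moll L₁ L₂ ε w) p =
      -∫ q in rect L₁ L₂, w q * (Λ q * dd (1, 0) (fun q => ker ε (p - q)) q +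
        1 * dd (0, 1) (fun q => ker ε (p - q)) q) := by
    rw [moll, moll, dd_cv (locallyIntegrable_ext hΛw) (ker_testOn hε),
      dd_cv (locallyIntegrable_ext hw) (ker_testOn hε), cv_ext, cv_ext]
    have i1 := (integrable_of_L2 (hΛw.mul_test (hk.dd (1, 0)))).neg
    have i2 := (integrable_of_L2 (hw.mul_test (hk.dd (0, 1)))).neg
    rw [← integral_neg]
    refine (integral_add ?_ ?_).symm.trans (integral_congr_ae (Eventually.of_forall fun q => ?_))
    · refine i1.congr (Eventually.of_forall fun q => ?_)
      simp only [Pi.neg_apply]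
      rw [dd_const_sub_comp (ker_contDiff ε)]
      ring
    · refine i2.congr (Eventually.of_forall fun q => ?_)
      simp only [Pi.neg_apply]
      rw [dd_const_sub_comp (ker_contDiff ε)]
      ring
    · beta_reduce
      rw [dd_const_sub_comp (ker_contDiff ε), dd_const_sub_comp (ker_contDiff ε)]
      ring
  rw [← e4, ← e5] at h1
  rw [comm]
  linarith

/-- The transport of the mollifications converges. -/
lemma tendsto_transport_moll (hL₁ : 0 < L₁) (hL₂ : 0 < L₂) (hΛ : LipschitzWith K Λ)
    (hM : ∀ p, |Λ p| ≤ M) (hl : MemLp l ⊤ (volume.restrict (rect L₁ L₂)))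
    (hx : WD L₁ L₂ (1, 0) Λ l) {w f : ℝ × ℝ → ℝ}
    (hw : MemLp w 2 (volume.restrict (rect L₁ L₂))) (hf : MemLp f 2 (volume.restrict (rect L₁ L₂)))
    (hv : VanishesOnGam L₁ L₂ w) (hT : WT L₁ L₂ Λ l w f) :
    Tendsto (fun ε => eLpNorm (fun p => Λ p * dd (1, 0) (moll L₁ L₂ ε w) p +
      dd (0, 1) (moll L₁ L₂ ε w) p - f p) 2 (volume.restrict (rect L₁ L₂))) (𝓝[>] 0) (𝓝 0) := by
  have t := (tendsto_comm hΛ hM hl hx hw).add (tendsto_moll hf)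
  rw [add_zero] at t
  refine tendsto_of_tendsto_of_tendsto_of_le_of_le' tendsto_const_nhds t
    (Eventually.of_forall fun _ => zero_le) ?_
  filter_upwards [self_mem_nhdsWithin] with ε hε
  have hε : 0 < ε := hε
  refine le_trans (le_of_eq (eLpNorm_congr_ae ?_)) (eLpNorm_add_le
    (continuous_comm hε hΛ.continuous hM hl hw).aestronglyMeasurable
    ((memLp_moll hε hf).sub hf).1 (by norm_num))
  filter_upwards [ae_restrict_mem (measurableSet_rect L₁ L₂)] with p hp
  simp only [Pi.add_apply]
  rw [comm_eq_of_WT hL₁ hL₂ hΛ hM hl hw hf hv hT hε hp]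
  ring

/-- Mollification commutes with weak derivatives of functions with zero traces. -/
lemma dd_moll_of_vanishes (hL₁ : 0 < L₁) (hL₂ : 0 < L₂) {w g : ℝ × ℝ → ℝ} {e : ℝ × ℝ}
    (hw : MemLp w 2 (volume.restrict (rect L₁ L₂))) (hg : MemLp g 2 (volume.restrict (rect L₁ L₂)))
    (hv : VanishesOnGam L₁ L₂ w) (h : WD L₁ L₂ e w g) {ε : ℝ} (hε : 0 < ε) {p : ℝ × ℝ}
    (hp : p ∈ rect L₁ L₂) : dd e (moll L₁ L₂ ε w) p = moll L₁ L₂ ε g p := by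
  have hd : ∀ φ : ℝ × ℝ → ℝ, ∀ q, e.1 * dd (1, 0) φ q + e.2 * dd (0, 1) φ q = dd e φ q := by
    intro φ q
    simp only [dd]
    rw [← smul_eq_mul, ← smul_eq_mul, ← map_smul, ← map_smul, ← map_add]
    simp
  refine dd_moll_eq hε hw (U := lowerLeft L₁ L₂) (fun φ hφ => ?_) (testOn_ker_sub_lowerLeft hε hp)
  -- A derivative in the direction `e` is a first order equation whose constant coefficients are the
  -- components of `e`.
  have h1 := wd_extend (a := fun _ => e.1) (b := fun _ => e.2) (Ka := 0) (Kb := 0)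
    (Ma := ‖e.1‖₊) (Mb := ‖e.2‖₊) hL₁ hL₂ hw hg hv (LipschitzWith.const _) (by simp)
    (LipschitzWith.const _) (by simp) (fun φ hφ => ?_) hφ
  · simp only [hd] at h1
    linarith
  · simp only [hd]
    linarith [h φ hφ]

end Friedrichs

/-! ### Traces of continuous functions -/

lemma IsTest1.integrable {R : ℝ} {ψ : ℝ → ℝ} (h : IsTest1 R ψ) : Integrable ψ :=
  h.1.continuous.integrable_of_hasCompactSupport h.2.1

/-- Cauchy–Schwarz, obtained by integrating `(|ψ t| - A / R) ^ 2 ≥ 0` with `A` the integral on the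
left. -/
lemma integral_abs_le_h1Norm {R : ℝ} (hR : 0 < R) {ψ : ℝ → ℝ} (h : IsTest1 R ψ) :
    ∫ t in Ioo 0 R, |ψ t| ≤ √R * h1Norm R ψ := by
  have hc := h.1.continuous
  have hd : Continuous (deriv ψ) := h.1.continuous_deriv (by simp)
  have i1 : IntegrableOn (fun t => |ψ t|) (Ioo 0 R) := h.integrable.abs.integrableOn
  have hcs : ∀ {f : ℝ → ℝ}, Continuous f → IntegrableOn f (Ioo 0 R) := fun hf =>
    (hf.continuousOn.integrableOn_compact isCompact_Icc).mono_set Ioo_subset_Icc_self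
  have i2 : IntegrableOn (fun t => ψ t ^ 2) (Ioo 0 R) := hcs (hc.pow 2)
  have i3 : IntegrableOn (fun t => ψ t ^ 2 + deriv ψ t ^ 2) (Ioo 0 R) :=
    hcs ((hc.pow 2).add (hd.pow 2))
  set A := ∫ t in Ioo 0 R, |ψ t| with hA
  have h1 : ∫ t in Ioo 0 R, (2 * (A / R) * |ψ t| - (A / R) ^ 2) ≤
      ∫ t in Ioo 0 R, (ψ t ^ 2 + deriv ψ t ^ 2) := by
    refine setIntegral_mono ((i1.const_mul _).sub (integrable_const _)) i3 fun t => ?_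
    nlinarith [sq_nonneg (|ψ t| - A / R), sq_abs (ψ t), sq_nonneg (deriv ψ t)]
  have h2 : ∫ t in Ioo 0 R, (2 * (A / R) * |ψ t| - (A / R) ^ 2) = A ^ 2 / R := by
    rw [integral_sub (i1.const_mul _) (integrable_const _), integral_const_mul, setIntegral_const,
      Measure.real, Real.volume_Ioo, sub_zero, ENNReal.toReal_ofReal hR.le, ← hA, smul_eq_mul]
    field_simp
    ring
  rw [h2, div_le_iff₀ hR] at h1
  have h0 : 0 ≤ A := integral_nonneg fun t => abs_nonneg _
  rw [h1Norm, ← Real.sqrt_mul hR.le]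
  exact Real.le_sqrt_of_sq_le (by linarith)

/-- Pairing with the slices of `V` defines the curve for every `s`. Uniform continuity of `V` on the
closed rectangle gives continuity in `H⁻¹`, since `H¹_0` controls the norm in `L¹`. -/
lemma hasTraceAtZero_of_continuous {S R : ℝ} (hR : 0 < R) {u : ℝ → ℝ → ℝ} {V : ℝ × ℝ → ℝ}
    (hV : Continuous V) (hu : ∀ᵐ p ∂(volume.restrict (rect S R)), u p.1 p.2 = V p)
    (h0 : ∀ t, V (0, t) = 0) : HasTraceAtZero S R u 0 := by
  refine ⟨fun s ψ => ∫ t in Ioo 0 R, V (s, t) * ψ t, ?_, ?_, ?_⟩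
  · rw [restrict_rect_eq_prod] at hu
    filter_upwards [Measure.ae_ae_of_ae_prod hu] with s hs ψ _
    refine integral_congr_ae ?_
    filter_upwards [hs] with t ht
    rw [ht]
  · intro s₀ hs₀ ε hε
    have huc := (isCompact_closedRect S R).uniformContinuousOn_of_continuous hV.continuousOn
    obtain ⟨δ, hδ, hd⟩ := Metric.uniformContinuousOn_iff.1 huc (ε / √R)
      (div_pos hε (Real.sqrt_pos.2 hR))
    refine ⟨δ, hδ, fun s hs hss ψ hψ => ?_⟩
    have hi : ∀ s, IntegrableOn (fun t => V (s, t) * ψ t) (Ioo 0 R) := fun s =>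
      (((hV.comp (Continuous.prodMk_right s)).mul
        hψ.1.continuous).continuousOn.integrableOn_compact isCompact_Icc).mono_set Ioo_subset_Icc_self
    rw [← integral_sub (hi s) (hi s₀)]
    calc |∫ t in Ioo 0 R, (V (s, t) * ψ t - V (s₀, t) * ψ t)|
        ≤ ∫ t in Ioo 0 R, ε / √R * |ψ t| := by
          rw [← Real.norm_eq_abs]
          refine norm_integral_le_of_norm_le (hψ.integrable.abs.integrableOn.const_mul _) ?_
          filter_upwards [ae_restrict_mem measurableSet_Ioo] with t ht
          rw [← sub_mul, norm_mul]
          refine mul_le_mul_of_nonneg_right ?_ (norm_nonneg _)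
          have h1 := hd (s, t) ⟨hs, ht.1.le, ht.2.le⟩ (s₀, t) ⟨hs₀, ht.1.le, ht.2.le⟩
            (by rw [Prod.dist_eq, dist_self, max_eq_left dist_nonneg]; exact hss)
          exact h1.le
      _ ≤ ε / √R * (√R * h1Norm R ψ) := by
          rw [integral_const_mul]
          gcongr
          exact integral_abs_le_h1Norm hR hψ
      _ = ε * h1Norm R ψ := by
          have := Real.sqrt_pos.2 hR
          field_simp
  · intro ψ _
    simp [h0]

lemma vanishesOnGam_of_continuous {L₁ L₂ : ℝ} (hL₁ : 0 < L₁) (hL₂ : 0 < L₂) {u V : ℝ × ℝ → ℝ}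
    (hV : Continuous V) (hu : u =ᵐ[volume.restrict (rect L₁ L₂)] V)
    (h0 : ∀ p : ℝ × ℝ, p.1 = 0 ∨ p.2 = 0 → V p = 0) : VanishesOnGam L₁ L₂ u :=
  ⟨hasTraceAtZero_of_continuous hL₂ hV hu fun _ => h0 _ (Or.inl rfl),
    hasTraceAtZero_of_continuous (V := fun p => V p.swap) hL₁ (hV.comp continuous_swap) (ae_swap hu)
      fun _ => h0 _ (Or.inr rfl)⟩

/-! ### The operator `T` -/

section Operator

variable {L₁ L₂ : ℝ} {lam lam' l l' u u' f f' : ℝ × ℝ → ℝ}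

lemma WT.congr (h : WT L₁ L₂ lam l u f) (h1 : lam =ᵐ[volume.restrict (rect L₁ L₂)] lam')
    (h2 : l =ᵐ[volume.restrict (rect L₁ L₂)] l') (h3 : u =ᵐ[volume.restrict (rect L₁ L₂)] u')
    (h4 : f =ᵐ[volume.restrict (rect L₁ L₂)] f') : WT L₁ L₂ lam' l' u' f' := by
  intro φ hφ
  rw [← setIntegral_congr_of_ae h4, h φ hφ, setIntegral_congr_of_ae h3, setIntegral_congr_of_ae h3]
  congr 2
  refine integral_congr_ae ?_
  filter_upwards [h1, h2] with p e1 e2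
  rw [e1, e2]

lemma IsT.wt (h : IsT L₁ L₂ lam u f) : WT L₁ L₂ lam (weakDeriv L₁ L₂ 1 0 lam) u f :=
  fun φ hφ => h.2.2 φ hφ

lemma WT.isT (h : WT L₁ L₂ lam (weakDeriv L₁ L₂ 1 0 lam) u f)
    (hu : LocallyIntegrableOn u (rect L₁ L₂)) (hf : LocallyIntegrableOn f (rect L₁ L₂)) :
    IsT L₁ L₂ lam u f := ⟨hu, hf, fun φ hφ => h φ hφ⟩

lemma IsT.opT_ae_eq (h : IsT L₁ L₂ lam u f) :
    opT L₁ L₂ lam u =ᵐ[volume.restrict (rect L₁ L₂)] f := by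
  have h' : ∃ g, IsT L₁ L₂ lam u g := ⟨f, h⟩
  rw [opT, dif_pos h']
  exact ae_eq_of_forall_test h'.choose_spec.2.1 h.2.1 fun φ hφ =>
    (h'.choose_spec.2.2 φ hφ).trans (h.2.2 φ hφ).symm

lemma WT.sub (h : WT L₁ L₂ lam l u f) (h' : WT L₁ L₂ lam l u' f')
    (hlam : MemLp lam ⊤ (volume.restrict (rect L₁ L₂)))
    (hl : MemLp l ⊤ (volume.restrict (rect L₁ L₂)))
    (hu : MemLp u 2 (volume.restrict (rect L₁ L₂)))
    (hu' : MemLp u' 2 (volume.restrict (rect L₁ L₂)))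
    (hf : MemLp f 2 (volume.restrict (rect L₁ L₂)))
    (hf' : MemLp f' 2 (volume.restrict (rect L₁ L₂))) :
    WT L₁ L₂ lam l (fun p => u p - u' p) (fun p => f p - f' p) := by
  intro φ hφ
  have hc : MemLp (fun p => l p * φ p + lam p * dd (1, 0) φ p) 2 (volume.restrict (rect L₁ L₂)) :=
    (hl.of_top.mul_test hφ).add (hlam.of_top.mul_test (hφ.dd (1, 0)))
  have e : ∀ {v v' c : ℝ × ℝ → ℝ}, MemLp v 2 (volume.restrict (rect L₁ L₂)) →
      MemLp v' 2 (volume.restrict (rect L₁ L₂)) → MemLp c 2 (volume.restrict (rect L₁ L₂)) →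
      ∫ p in rect L₁ L₂, (v p - v' p) * c p =
        (∫ p in rect L₁ L₂, v p * c p) - ∫ p in rect L₁ L₂, v' p * c p := by
    intro v v' c hv hv' hc
    rw [← integral_sub (integrable_mul_of_L2 hv hc) (integrable_mul_of_L2 hv' hc)]
    simp only [sub_mul]
  rw [e hf hf' (hφ.memLp 2 _), e hu hu' hc, e hu hu' ((hφ.dd _).memLp 2 _), h φ hφ, h' φ hφ]
  ring

end Operator

lemma HasWeakDeriv.sub {L₁ L₂ : ℝ} {a b : ℕ} {u v g k : ℝ × ℝ → ℝ}
    (h : HasWeakDeriv L₁ L₂ a b u g) (h' : HasWeakDeriv L₁ L₂ a b v k)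
    (hu : MemLp u 2 (volume.restrict (rect L₁ L₂))) (hv : MemLp v 2 (volume.restrict (rect L₁ L₂)))
    (hg : MemLp g 2 (volume.restrict (rect L₁ L₂)))
    (hk : MemLp k 2 (volume.restrict (rect L₁ L₂))) :
    HasWeakDeriv L₁ L₂ a b (fun p => u p - v p) (fun p => g p - k p) := by
  refine ⟨h.1.sub h'.1, h.2.1.sub h'.2.1, fun φ hφ => ?_⟩
  have hd : ∀ (n : ℕ) (e : ℝ × ℝ) (ψ : ℝ × ℝ → ℝ), TestOn (rect L₁ L₂) ψ →
      TestOn (rect L₁ L₂) ((dd e)^[n] ψ) := by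
    intro n e ψ hψ
    induction n with
    | zero => exact hψ
    | succ n ih => rw [Function.iterate_succ_apply']; exact ih.dd e
  have hp : TestOn (rect L₁ L₂) (partialD a b φ) := hd a (1, 0) _ (hd b (0, 1) _ hφ)
  have e : ∀ {w w' ψ : ℝ × ℝ → ℝ}, MemLp w 2 (volume.restrict (rect L₁ L₂)) →
      MemLp w' 2 (volume.restrict (rect L₁ L₂)) → TestOn (rect L₁ L₂) ψ →
      ∫ p in rect L₁ L₂, (w p - w' p) * ψ p =
        (∫ p in rect L₁ L₂, w p * ψ p) - ∫ p in rect L₁ L₂, w' p * ψ p := by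
    intro w w' ψ hw hw' hψ
    rw [← integral_sub (integrable_of_L2 (hw.mul_test hψ)) (integrable_of_L2 (hw'.mul_test hψ))]
    simp only [sub_mul]
  rw [e hu hv hp, e hg hk hφ, h.2.2 φ hφ, h'.2.2 φ hφ]
  ring

/-- `hNorm` uses chosen weak derivatives, but any representatives have the same norms, so explicit
ones may be used. -/
lemma tendsto_hNorm {ι : Type*} {F : Filter ι} {L₁ L₂ : ℝ} {m : ℕ} {u : ι → ℝ × ℝ → ℝ}
    {D : ι → ℕ → ℕ → ℝ × ℝ → ℝ}
    (hD : ∀ᶠ i in F, ∀ a b, a + b ≤ m → HasWeakDeriv L₁ L₂ a b (u i) (D i a b))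
    (h : ∀ a b, a + b ≤ m →
      Tendsto (fun i => eLpNorm (D i a b) 2 (volume.restrict (rect L₁ L₂))) F (𝓝 0)) :
    Tendsto (fun i => hNorm L₁ L₂ m (u i)) F (𝓝 0) := by
  have h1 : Tendsto (fun i => (∑ α ∈ (Finset.range (m + 1) ×ˢ Finset.range (m + 1)).filter
      (fun α => α.1 + α.2 ≤ m),
      (eLpNorm (D i α.1 α.2) 2 (volume.restrict (rect L₁ L₂))) ^ 2) ^ (1 / 2 : ℝ)) F (𝓝 0) := by
    have h2 : Tendsto (fun i => ∑ α ∈ (Finset.range (m + 1) ×ˢ Finset.range (m + 1)).filter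
        (fun α => α.1 + α.2 ≤ m),
        (eLpNorm (D i α.1 α.2) 2 (volume.restrict (rect L₁ L₂))) ^ 2) F
        (𝓝 (∑ α ∈ (Finset.range (m + 1) ×ˢ Finset.range (m + 1)).filter
        (fun α => α.1 + α.2 ≤ m), 0)) := by
      refine tendsto_finsetSum _ fun α hα => ?_
      have h3 := ((ENNReal.continuous_pow 2).tendsto 0).comp (h α.1 α.2 (Finset.mem_filter.1 hα).2)
      simpa [Function.comp_def] using h3
    rw [Finset.sum_const_zero] at h2
    have h4 := ((ENNReal.continuous_rpow_const (y := (1 / 2 : ℝ))).tendsto 0).comp h2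
    rwa [ENNReal.zero_rpow_of_pos (by norm_num)] at h4
  refine h1.congr' (hD.mono fun i hi => ?_)
  simp only [hNorm]
  congr 1
  refine Finset.sum_congr rfl fun α hα => ?_
  rw [eLpNorm_congr_ae (hi α.1 α.2 (Finset.mem_filter.1 hα).2).ae_eq_weakDeriv]

/-! ### The coefficient and its products with jets -/

lemma WD.congr {L₁ L₂ : ℝ} {e : ℝ × ℝ} {u v g k : ℝ × ℝ → ℝ} (h : WD L₁ L₂ e u g)
    (huv : u =ᵐ[volume.restrict (rect L₁ L₂)] v) (hgk : g =ᵐ[volume.restrict (rect L₁ L₂)] k) :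
    WD L₁ L₂ e v k := fun φ hφ => by
  rw [← setIntegral_congr_of_ae huv, ← setIntegral_congr_of_ae hgk]; exact h φ hφ

lemma IsJet.congr {L₁ L₂ : ℝ} {N : ℕ} {D E : ℕ → ℕ → ℝ × ℝ → ℝ} (h : IsJet L₁ L₂ N D)
    (hDE : ∀ a b, a + b ≤ N → D a b =ᵐ[volume.restrict (rect L₁ L₂)] E a b) : IsJet L₁ L₂ N E :=
  ⟨fun a b hab => (h.memLp a b hab).ae_eq (hDE a b hab),
    fun a b hab => (h.wd_x a b hab).congr (hDE a b hab.le) (hDE _ _ (by omega)),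
    fun a b hab => (h.wd_y a b hab).congr (hDE a b hab.le) (hDE _ _ (by omega))⟩

/-- The derivatives of a coefficient that acts on functions of order `m`. -/
structure IsCoeff (L₁ L₂ : ℝ) (m N : ℕ) (Λ : ℕ → ℕ → ℝ × ℝ → ℝ) : Prop where
  jet : IsJet L₁ L₂ N Λ
  one_le : 1 ≤ N
  le : m ≤ N
  order : m ≤ 1 ∨ 3 ≤ N
  top : ∀ a b, a + b ≤ 1 → MemLp (Λ a b) ⊤ (volume.restrict (rect L₁ L₂))

/-- The Sobolev inequality used here involves the mixed derivative in `x` and `y`; hence the two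
orders to spare. -/
lemma IsJet.memLp_top {L₁ L₂ : ℝ} (hL₁ : 0 < L₁) (hL₂ : 0 < L₂) {N : ℕ} {D : ℕ → ℕ → ℝ × ℝ → ℝ}
    (h : IsJet L₁ L₂ N D) {a b : ℕ} (hab : a + b + 2 ≤ N) :
    MemLp (D a b) ⊤ (volume.restrict (rect L₁ L₂)) := by
  obtain ⟨C, hC, hb⟩ := eLpNorm_top_le_of_mixed hL₁ hL₂
  have m1 := h.memLp a b (by omega)
  have m2 := h.memLp (a + 1) b (by omega)
  have m3 := h.memLp a (b + 1) (by omega)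
  have m4 := h.memLp (a + 1) (b + 1) (by omega)
  refine ⟨m1.1, (hb _ _ _ _ (h.wd_x a b (by omega)) (h.wd_y a b (by omega))
    (h.wd_y (a + 1) b (by omega)) m1 m2 m3 m4).trans_lt ?_⟩
  exact ENNReal.mul_lt_top hC.lt_top
    (ENNReal.add_lt_top.2 ⟨ENNReal.add_lt_top.2 ⟨m1.2, m3.2⟩, ENNReal.add_lt_top.2 ⟨m2.2, m4.2⟩⟩)

/-- The two regimes of the positive condition become one: `N = 1` with the gradient bounded by
assumption, or `N = max 3 m` with the gradient in `H²`, hence bounded. In both, `lam` has a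
Lipschitz representative. -/
lemma exists_isCoeff {L₁ L₂ : ℝ} (hL₁ : 0 < L₁) (hL₂ : 0 < L₂) {m : ℕ} {lam : ℝ × ℝ → ℝ}
    (hlam : PositiveCondition L₁ L₂ m lam) :
    ∃ (N : ℕ) (Λ : ℕ → ℕ → ℝ × ℝ → ℝ) (K M : NNReal), IsCoeff L₁ L₂ m N Λ ∧
      LipschitzWith K (Λ 0 0) ∧ (∀ p, |Λ 0 0 p| ≤ M) ∧
      lam =ᵐ[volume.restrict (rect L₁ L₂)] Λ 0 0 ∧ weakDeriv L₁ L₂ 1 0 lam = Λ 1 0 := by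
  obtain ⟨⟨c₀, c₁, hc₀, hc₁, hb⟩, hm1, hm2⟩ := hlam
  obtain ⟨N, hN1, hmN, hord, hjet, htop⟩ : ∃ N, 1 ≤ N ∧ m ≤ N ∧ (m ≤ 1 ∨ 3 ≤ N) ∧
      MemH L₁ L₂ N lam ∧ ∀ a b, a + b = 1 →
        MemLp (weakDeriv L₁ L₂ a b lam) ⊤ (volume.restrict (rect L₁ L₂)) := by
    rcases le_or_gt m 1 with hm | hm
    · refine ⟨1, le_rfl, hm, Or.inl hm, fun a b hab => ?_, fun a b hab => ?_⟩
      · rcases Nat.lt_or_ge (a + b) 1 with h0 | h1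
        · obtain ⟨rfl, rfl⟩ : a = 0 ∧ b = 0 := by omega
          obtain ⟨g, hg, -⟩ := hm1 hm 1 0 rfl
          refine ⟨lam, hasWeakDeriv_zero hg.1, MemLp.of_bound hg.1.aestronglyMeasurable c₁ ?_⟩
          filter_upwards [hb] with p hp
          rw [Real.norm_eq_abs, abs_le]
          constructor <;> linarith [hp.1, hp.2]
        · obtain ⟨g, hg, hg2⟩ := hm1 hm a b (by omega)
          exact ⟨g, hg, hg2.of_top⟩
      · obtain ⟨g, hg, hg2⟩ := hm1 hm a b hab
        exact hg2.ae_eq hg.ae_eq_weakDeriv.symm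
    · refine ⟨max 3 m, by simp, le_max_right _ _, Or.inr (le_max_left _ _), hm2 hm,
        fun a b hab => ?_⟩
      have h3 : 3 ≤ max 3 m := le_max_left _ _
      exact (hm2 hm).isJet.memLp_top hL₁ hL₂ (by omega)
  have hJ := hjet.isJet
  have h0 : weakDeriv L₁ L₂ 0 0 lam =ᵐ[volume.restrict (rect L₁ L₂)] lam := hjet.ae_eq_self
  have htop0 : MemLp (weakDeriv L₁ L₂ 0 0 lam) ⊤ (volume.restrict (rect L₁ L₂)) := by
    refine memLp_top_of_bound (hJ.memLp 0 0 (by omega)).1 c₁ ?_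
    filter_upwards [hb, h0] with p hp hp0
    rw [hp0, Real.norm_eq_abs, abs_le]
    constructor <;> linarith [hp.1, hp.2]
  obtain ⟨g, K, M, hgK, hgM, hg⟩ := exists_lipschitz_ae_eq (hJ.wd_x 0 0 (by omega))
    (hJ.wd_y 0 0 (by omega)) htop0 (htop 1 0 rfl) (htop 0 1 rfl)
  -- Only the entry of order zero is replaced by the Lipschitz representative. The entry at `(1, 0)`
  -- must remain the chosen `weakDeriv`, because `IsT` is written with it.
  set Λ : ℕ → ℕ → ℝ × ℝ → ℝ := fun a b => if a = 0 ∧ b = 0 then g else weakDeriv L₁ L₂ a b lam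
    with hΛ
  have hΛ0 : Λ 0 0 = g := by simp [hΛ]
  have hΛ1 : ∀ a b, ¬(a = 0 ∧ b = 0) → Λ a b = weakDeriv L₁ L₂ a b lam := fun a b hab => by
    simp only [hΛ, if_neg hab]
  have hΛe : ∀ a b, weakDeriv L₁ L₂ a b lam =ᵐ[volume.restrict (rect L₁ L₂)] Λ a b := by
    intro a b
    by_cases hab : a = 0 ∧ b = 0
    · obtain ⟨rfl, rfl⟩ := hab
      rwa [hΛ0]
    · rw [hΛ1 a b hab]
  refine ⟨N, Λ, K, M.toNNReal, ⟨hJ.congr fun a b _ => hΛe a b, hN1, hmN, hord, fun a b hab => ?_⟩,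
    hΛ0 ▸ hgK, fun p => ?_, h0.symm.trans (hΛe 0 0), (hΛ1 1 0 (by simp)).symm⟩
  · rcases Nat.lt_or_ge (a + b) 1 with h | h
    · obtain ⟨rfl, rfl⟩ : a = 0 ∧ b = 0 := by omega
      exact htop0.ae_eq (hΛe 0 0)
    · exact (htop a b (by omega)).ae_eq (hΛe a b)
  · rw [hΛ0]
    exact (hgM p).trans (Real.le_coe_toNNReal M)

/-- The sum of the norms of the members of a jet. -/
noncomputable def jetNorm (L₁ L₂ : ℝ) (m : ℕ) (D : ℕ → ℕ → ℝ × ℝ → ℝ) : ℝ≥0∞ :=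
  ∑ α ∈ (Finset.range (m + 1) ×ˢ Finset.range (m + 1)).filter (fun α => α.1 + α.2 ≤ m),
    eLpNorm (D α.1 α.2) 2 (volume.restrict (rect L₁ L₂))

lemma le_jetNorm {L₁ L₂ : ℝ} {m : ℕ} (D : ℕ → ℕ → ℝ × ℝ → ℝ) {a b : ℕ} (hab : a + b ≤ m) :
    eLpNorm (D a b) 2 (volume.restrict (rect L₁ L₂)) ≤ jetNorm L₁ L₂ m D := by
  have h : (a, b) ∈ (Finset.range (m + 1) ×ˢ Finset.range (m + 1)).filter
      (fun α => α.1 + α.2 ≤ m) := by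
    simp only [Finset.mem_filter, Finset.mem_product, Finset.mem_range]
    omega
  have h1 := Finset.single_le_sum (f := fun α : ℕ × ℕ =>
    eLpNorm (D α.1 α.2) 2 (volume.restrict (rect L₁ L₂))) (fun _ _ => zero_le) h
  rw [jetNorm]
  exact h1

lemma IsJet.jetNorm_ne_top {L₁ L₂ : ℝ} {m : ℕ} {D : ℕ → ℕ → ℝ × ℝ → ℝ} (h : IsJet L₁ L₂ m D) :
    jetNorm L₁ L₂ m D ≠ ⊤ :=
  ENNReal.sum_ne_top.2 fun _ hα => (h.memLp _ _ (Finset.mem_filter.1 hα).2).2.ne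

lemma tendsto_jetNorm {ι : Type*} {F : Filter ι} {L₁ L₂ : ℝ} {m : ℕ}
    {D : ι → ℕ → ℕ → ℝ × ℝ → ℝ} (h : ∀ a b, a + b ≤ m →
      Tendsto (fun i => eLpNorm (D i a b) 2 (volume.restrict (rect L₁ L₂))) F (𝓝 0)) :
    Tendsto (fun i => jetNorm L₁ L₂ m (D i)) F (𝓝 0) := by
  have h2 := tendsto_finsetSum ((Finset.range (m + 1) ×ˢ Finset.range (m + 1)).filter
      (fun α => α.1 + α.2 ≤ m)) fun α hα => h α.1 α.2 (Finset.mem_filter.1 hα).2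
  rwa [Finset.sum_const_zero] at h2

section Products

variable {L₁ L₂ : ℝ} {m N : ℕ} {Λ : ℕ → ℕ → ℝ × ℝ → ℝ}

/-- The two orders add up to at most `m + 1`, so the more derivatives fall on the coefficient, the
fewer fall on `D`. Either one factor is bounded, or each factor has one derivative to spare. -/
lemma exists_eLpNorm_mul_le (hL₁ : 0 < L₁) (hL₂ : 0 < L₂) (hΛ : IsCoeff L₁ L₂ m N Λ)
    {t : (ℕ × ℕ) × (ℕ × ℕ)} (ht : GoodTerm m t) : ∃ C : ℝ≥0∞, C ≠ ⊤ ∧ ∀ D, IsJet L₁ L₂ m D →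
      eLpNorm (fun p => Λ t.1.1 t.1.2 p * D t.2.1 t.2.2 p) 2 (volume.restrict (rect L₁ L₂)) ^ 2 ≤
        C * jetNorm L₁ L₂ m D ^ 2 := by
  set μ := volume.restrict (rect L₁ L₂) with hμ
  obtain ⟨⟨a, b⟩, c, d⟩ := t
  obtain ⟨ht1, ht2, ht3⟩ := ht
  simp only at ht1 ht2 ht3 ⊢
  have hmul : ∀ {f g : ℝ × ℝ → ℝ} {p q : ℝ≥0∞} [ENNReal.HolderTriple p q 2],
      AEStronglyMeasurable f μ → AEStronglyMeasurable g μ →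
      eLpNorm (fun x => f x * g x) 2 μ ≤ eLpNorm f p μ * eLpNorm g q μ := by
    intro f g p q _ hf hg
    have h := eLpNorm_smul_le_mul_eLpNorm (p := p) (q := q) (r := 2) hg hf
    exact h
  have hord := hΛ.order
  have hmN := hΛ.le
  -- The coefficient is differentiated at most once and is bounded.
  rcases Nat.lt_or_ge (a + b) 2 with h1 | h1
  · have hl := hΛ.top a b (by omega)
    refine ⟨eLpNorm (Λ a b) ⊤ μ ^ 2, ENNReal.pow_ne_top hl.2.ne, fun D hD => ?_⟩
    rw [← mul_pow]
    gcongr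
    exact (hmul hl.1 (hD.memLp c d (by omega)).1).trans
      (mul_le_mul_right (le_jetNorm D (by omega)) _)
  -- Here `2 ≤ a + b < N`, so `c + d ≤ m - 1`. The coefficient can be differentiated once more in
  -- `x` and the other factor once more in `y`, as the anisotropic estimate requires.
  rcases Nat.lt_or_ge (a + b) N with h2 | h2
  · obtain ⟨C, hC, hb⟩ := eLpNorm_mul_sq_le hL₁ hL₂
    have m1 := hΛ.jet.memLp a b h2.le
    have m2 := hΛ.jet.memLp (a + 1) b (by omega)
    refine ⟨C * (eLpNorm (Λ a b) 2 μ ^ 2 + eLpNorm (Λ (a + 1) b) 2 μ ^ 2) * 2,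
      ENNReal.mul_ne_top (ENNReal.mul_ne_top hC (ENNReal.add_ne_top.2
        ⟨ENNReal.pow_ne_top m1.2.ne, ENNReal.pow_ne_top m2.2.ne⟩)) (by norm_num), fun D hD => ?_⟩
    refine (hb _ _ _ _ (hΛ.jet.wd_x a b h2) (hD.wd_y c d (by omega)) m1 m2
      (hD.memLp c d (by omega)) (hD.memLp c (d + 1) (by omega))).trans ?_
    rw [mul_assoc C, mul_assoc C, mul_assoc _ (2 : ℝ≥0∞), two_mul]
    gcongr
    · exact le_jetNorm D (by omega)
    · exact le_jetNorm D (by omega)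
  -- Now `a + b = N = m`, which forces `m ≥ 3` and `c + d = 1`. The factor from `D` then has two
  -- derivatives to spare and is bounded.
  · obtain ⟨C, hC, hb⟩ := eLpNorm_top_le_of_mixed hL₁ hL₂
    have m1 := hΛ.jet.memLp a b (by omega)
    refine ⟨(eLpNorm (Λ a b) 2 μ * (C * ((1 + 1) + (1 + 1)))) ^ 2,
      ENNReal.pow_ne_top (ENNReal.mul_ne_top m1.2.ne (ENNReal.mul_ne_top hC (by norm_num))),
      fun D hD => ?_⟩
    rw [← mul_pow]
    gcongr
    have m2 := hD.memLp c d (by omega)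
    refine (hmul (p := 2) (q := ⊤) m1.1 m2.1).trans ?_
    rw [mul_assoc, mul_assoc C, add_mul, add_mul, one_mul]
    gcongr
    refine (hb _ _ _ _ (hD.wd_x c d (by omega)) (hD.wd_y c d (by omega))
      (hD.wd_y (c + 1) d (by omega)) m2 (hD.memLp _ _ (by omega)) (hD.memLp _ _ (by omega))
      (hD.memLp _ _ (by omega))).trans ?_
    gcongr <;> exact le_jetNorm D (by omega)

lemma GoodTerm.mono {n : ℕ} {t : (ℕ × ℕ) × (ℕ × ℕ)} (h : GoodTerm n t) (hn : n ≤ m) :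
    GoodTerm m t := ⟨h.1, h.2.1, h.2.2.trans (by omega)⟩

lemma memLp_coeff_mul (hL₁ : 0 < L₁) (hL₂ : 0 < L₂) (hΛ : IsCoeff L₁ L₂ m N Λ)
    {t : (ℕ × ℕ) × (ℕ × ℕ)} (ht : GoodTerm m t) {D : ℕ → ℕ → ℝ × ℝ → ℝ} (hD : IsJet L₁ L₂ m D) :
    MemLp (fun p => Λ t.1.1 t.1.2 p * D t.2.1 t.2.2 p) 2 (volume.restrict (rect L₁ L₂)) := by
  obtain ⟨C, hC, hb⟩ := exists_eLpNorm_mul_le hL₁ hL₂ hΛ ht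
  have h1 := goodTerm_le le_rfl hΛ.le ht
  refine ⟨(hΛ.jet.memLp _ _ h1.1).1.mul (hD.memLp _ _ h1.2).1, ?_⟩
  have h2 := (hb D hD).trans_lt
    (ENNReal.mul_lt_top hC.lt_top (ENNReal.pow_lt_top hD.jetNorm_ne_top.lt_top))
  by_contra h3
  rw [not_lt, top_le_iff] at h3
  rw [h3] at h2
  simp at h2

lemma tendsto_coeff_mul (hL₁ : 0 < L₁) (hL₂ : 0 < L₂) (hΛ : IsCoeff L₁ L₂ m N Λ)
    {t : (ℕ × ℕ) × (ℕ × ℕ)} (ht : GoodTerm m t) {ι : Type*} {F : Filter ι}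
    {D : ι → ℕ → ℕ → ℝ × ℝ → ℝ} (hD : ∀ᶠ i in F, IsJet L₁ L₂ m (D i))
    (h : Tendsto (fun i => jetNorm L₁ L₂ m (D i)) F (𝓝 0)) :
    Tendsto (fun i => eLpNorm (fun p => Λ t.1.1 t.1.2 p * D i t.2.1 t.2.2 p) 2
      (volume.restrict (rect L₁ L₂))) F (𝓝 0) := by
  obtain ⟨C, hC, hb⟩ := exists_eLpNorm_mul_le hL₁ hL₂ hΛ ht
  have h1 : Tendsto (fun i => (C * jetNorm L₁ L₂ m (D i) ^ 2) ^ (1 / 2 : ℝ)) F (𝓝 0) := by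
    have h2 := ((ENNReal.continuous_pow 2).tendsto 0).comp h
    have h3 := ENNReal.Tendsto.const_mul (a := C) h2 (Or.inr hC)
    rw [zero_pow two_ne_zero, mul_zero] at h3
    have h4 := ((ENNReal.continuous_rpow_const (y := (1 / 2 : ℝ))).tendsto 0).comp h3
    rwa [ENNReal.zero_rpow_of_pos (by norm_num)] at h4
  refine tendsto_of_tendsto_of_tendsto_of_le_of_le' tendsto_const_nhds h1
    (Eventually.of_forall fun _ => zero_le) (hD.mono fun i hi => ?_)
  have h2 := ENNReal.rpow_le_rpow (hb _ hi) (show (0 : ℝ) ≤ 1 / 2 by norm_num)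
  rwa [← ENNReal.rpow_natCast, ← ENNReal.rpow_mul, show ((2 : ℕ) : ℝ) * (1 / 2) = 1 by norm_num,
    ENNReal.rpow_one] at h2

lemma tendsto_sumTerms (hL₁ : 0 < L₁) (hL₂ : 0 < L₂) (hΛ : IsCoeff L₁ L₂ m N Λ)
    {l : List ((ℕ × ℕ) × (ℕ × ℕ))} (hl : ∀ t ∈ l, GoodTerm m t) {ι : Type*} {F : Filter ι}
    {D : ι → ℕ → ℕ → ℝ × ℝ → ℝ} (hD : ∀ᶠ i in F, IsJet L₁ L₂ m (D i))
    (h : Tendsto (fun i => jetNorm L₁ L₂ m (D i)) F (𝓝 0)) :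
    Tendsto (fun i => eLpNorm (sumTerms Λ (D i) l) 2 (volume.restrict (rect L₁ L₂))) F (𝓝 0) := by
  induction l with
  | nil => simpa [sumTerms] using tendsto_const_nhds
  | cons t l ih =>
    have h1 := (tendsto_coeff_mul hL₁ hL₂ hΛ (hl t (by simp)) hD h).add
      (ih fun s hs => hl s (by simp [hs]))
    rw [add_zero] at h1
    refine tendsto_of_tendsto_of_tendsto_of_le_of_le' tendsto_const_nhds h1
      (Eventually.of_forall fun _ => zero_le) (hD.mono fun i hi => ?_)
    exact eLpNorm_add_le (memLp_coeff_mul hL₁ hL₂ hΛ (hl t (by simp)) hi).1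
      (memLp_sumTerms fun s hs => memLp_coeff_mul hL₁ hL₂ hΛ (hl s (by simp [hs])) hi).1
      (by norm_num)

lemma sumTerms_sub (Λ U V : ℕ → ℕ → ℝ × ℝ → ℝ) (l : List ((ℕ × ℕ) × (ℕ × ℕ))) (p : ℝ × ℝ) :
    sumTerms Λ (fun a b q => U a b q - V a b q) l p = sumTerms Λ U l p - sumTerms Λ V l p := by
  induction l with
  | nil => simp [sumTerms]
  | cons t l ih =>
    simp only [sumTerms, ih]
    ring

end Products

/-! ### Mollifications of the elements of `X^m_Γ` -/

section Mollification

variable {L₁ L₂ : ℝ} {m N : ℕ} {Λ U : ℕ → ℕ → ℝ × ℝ → ℝ} {ε : ℝ}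

/-- Zero traces make mollification commute with each derivative up to `Γ`, not only in the interior,
so the mollified family is again a family of derivatives. -/
lemma isJet_moll (hL₁ : 0 < L₁) (hL₂ : 0 < L₂) (hU : IsJet L₁ L₂ m U)
    (hv : ∀ a b, a + b ≤ m → VanishesOnGam L₁ L₂ (U a b)) (hε : 0 < ε) :
    IsJet L₁ L₂ m fun a b => moll L₁ L₂ ε (U a b) := by
  have h : ∀ {e : ℝ × ℝ} {a b a' b' : ℕ}, a + b ≤ m → a' + b' ≤ m →
      WD L₁ L₂ e (U a b) (U a' b') →
      WD L₁ L₂ e (moll L₁ L₂ ε (U a b)) (moll L₁ L₂ ε (U a' b')) := by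
    intro e a b a' b' hab hab' hw
    refine (WD_of_smooth (contDiff_moll hε (hU.memLp a b hab)) e).congr (ae_eq_refl _) ?_
    filter_upwards [ae_restrict_mem (measurableSet_rect L₁ L₂)] with p hp
    exact dd_moll_of_vanishes hL₁ hL₂ (hU.memLp a b hab) (hU.memLp a' b' hab') (hv a b hab) hw hε hp
  exact ⟨fun a b hab => memLp_moll hε (hU.memLp a b hab),
    fun a b hab => h hab.le (by omega) (hU.wd_x a b hab),
    fun a b hab => h hab.le (by omega) (hU.wd_y a b hab)⟩

lemma moll_mem_VGam (hε : 0 < ε) {u : ℝ × ℝ → ℝ} (hu : MemLp u 2 (volume.restrict (rect L₁ L₂))) :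
    moll L₁ L₂ ε u ∈ VGam L₁ L₂ := by
  refine ⟨(contDiff_moll hε hu).contDiffOn, {p | p.1 < ε} ∪ {p | p.2 < ε},
    (isOpen_lt continuous_fst continuous_const).union
      (isOpen_lt continuous_snd continuous_const), fun p hp => ?_, fun p hp => ?_⟩
  · rcases hp.2 with h | h
    · exact Or.inl (h.trans_lt hε)
    · exact Or.inr (h.trans_lt hε)
  · exact moll_eq_zero hε u (hp.1.imp (fun h => le_of_lt h) fun h => le_of_lt h)

/-- The derivatives of `T` of the mollifications, without the commutators. -/
noncomputable def mollT (L₁ L₂ : ℝ) (Λ U : ℕ → ℕ → ℝ × ℝ → ℝ) (ε : ℝ) (a b : ℕ) : ℝ × ℝ → ℝ :=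
  fun p => Λ 0 0 p * dd (1, 0) (moll L₁ L₂ ε (U a b)) p + dd (0, 1) (moll L₁ L₂ ε (U a b)) p

lemma memLp_mollT (hΛ : IsCoeff L₁ L₂ m N Λ) (hU : IsJet L₁ L₂ m U) (hε : 0 < ε) {a b : ℕ}
    (hab : a + b ≤ m) : MemLp (mollT L₁ L₂ Λ U ε a b) 2 (volume.restrict (rect L₁ L₂)) :=
  (memLp_mul_of_top (memLp_of_continuous (continuous_dd_moll hε (hU.memLp a b hab) _) 2)
    (hΛ.top 0 0 (by simp))).add
    (memLp_of_continuous (continuous_dd_moll hε (hU.memLp a b hab) _) 2)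

lemma wt_mollT (hΛ : IsCoeff L₁ L₂ m N Λ) (hU : IsJet L₁ L₂ m U) (hε : 0 < ε) {a b : ℕ}
    (hab : a + b ≤ m) :
    WT L₁ L₂ (Λ 0 0) (Λ 1 0) (moll L₁ L₂ ε (U a b)) (mollT L₁ L₂ Λ U ε a b) := by
  have hs := contDiff_moll hε (hU.memLp a b hab)
  exact WT_of_wd (hΛ.top 0 0 (by simp)) (hΛ.top 1 0 (by simp)) (hΛ.jet.wd_x 0 0 hΛ.one_le)
    (memLp_moll hε (hU.memLp a b hab))
    (memLp_of_continuous (continuous_dd_moll hε (hU.memLp a b hab) _) 2)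
    (memLp_of_continuous (continuous_dd_moll hε (hU.memLp a b hab) _) 2)
    (WD_of_smooth hs _) (WD_of_smooth hs _)

lemma memLp_sumTerms_terms (hL₁ : 0 < L₁) (hL₂ : 0 < L₂) (hΛ : IsCoeff L₁ L₂ m N Λ)
    (hU : IsJet L₁ L₂ m U) {a b : ℕ} (hab : a + b ≤ m) :
    MemLp (sumTerms Λ U (terms a b)) 2 (volume.restrict (rect L₁ L₂)) :=
  memLp_sumTerms fun t ht => memLp_coeff_mul hL₁ hL₂ hΛ ((goodTerm_terms a b t ht).mono hab) hU

/-- The derivatives of `T` of the mollifications. -/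
noncomputable def mollTJet (L₁ L₂ : ℝ) (Λ U : ℕ → ℕ → ℝ × ℝ → ℝ) (ε : ℝ) (a b : ℕ) : ℝ × ℝ → ℝ :=
  fun p => mollT L₁ L₂ Λ U ε a b p +
    sumTerms Λ (fun a b => moll L₁ L₂ ε (U a b)) (terms a b) p

lemma hasWeakDeriv_mollTJet (hL₁ : 0 < L₁) (hL₂ : 0 < L₂) (hΛ : IsCoeff L₁ L₂ m N Λ)
    (hU : IsJet L₁ L₂ m U) (hv : ∀ a b, a + b ≤ m → VanishesOnGam L₁ L₂ (U a b)) (hε : 0 < ε)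
    {a b : ℕ} (hab : a + b ≤ m) :
    HasWeakDeriv L₁ L₂ a b (mollT L₁ L₂ Λ U ε 0 0) (mollTJet L₁ L₂ Λ U ε a b) :=
  hasWeakDeriv_of_wt hΛ.jet (isJet_moll hL₁ hL₂ hU hv hε) hΛ.one_le hΛ.le hΛ.top
    (fun _ _ h => wt_mollT hΛ hU hε h) (fun _ _ h => memLp_mollT hΛ hU hε h)
    (fun _ _ h => memLp_sumTerms_terms hL₁ hL₂ hΛ (isJet_moll hL₁ hL₂ hU hv hε) h) a b hab

lemma memLp_mollTJet (hL₁ : 0 < L₁) (hL₂ : 0 < L₂) (hΛ : IsCoeff L₁ L₂ m N Λ)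
    (hU : IsJet L₁ L₂ m U) (hv : ∀ a b, a + b ≤ m → VanishesOnGam L₁ L₂ (U a b)) (hε : 0 < ε)
    {a b : ℕ} (hab : a + b ≤ m) :
    MemLp (mollTJet L₁ L₂ Λ U ε a b) 2 (volume.restrict (rect L₁ L₂)) :=
  (memLp_mollT hΛ hU hε hab).add
    (memLp_sumTerms_terms hL₁ hL₂ hΛ (isJet_moll hL₁ hL₂ hU hv hε) hab)

/-- The same Leibniz expansion is applied to `U` and to its mollification. The transport parts
converge by the Friedrichs lemma, which asks for no derivative of `U a b` and so includes the order
`m`. The remaining sums are linear in the jet, and the product estimates carry the convergence of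
jets over to them. -/
lemma tendsto_mollTJet (hL₁ : 0 < L₁) (hL₂ : 0 < L₂) (hΛ : IsCoeff L₁ L₂ m N Λ) {K M : NNReal}
    (hK : LipschitzWith K (Λ 0 0)) (hM : ∀ p, |Λ 0 0 p| ≤ M) (hU : IsJet L₁ L₂ m U)
    (hv : ∀ a b, a + b ≤ m → VanishesOnGam L₁ L₂ (U a b)) {G : ℕ → ℕ → ℝ × ℝ → ℝ}
    (hG : IsJet L₁ L₂ m G) (hT : WT L₁ L₂ (Λ 0 0) (Λ 1 0) (U 0 0) (G 0 0)) {a b : ℕ}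
    (hab : a + b ≤ m) :
    Tendsto (fun ε => eLpNorm (fun p => G a b p - mollTJet L₁ L₂ Λ U ε a b p) 2
      (volume.restrict (rect L₁ L₂))) (𝓝[>] 0) (𝓝 0) := by
  have hS := memLp_sumTerms_terms hL₁ hL₂ hΛ hU hab
  have hf : MemLp (fun p => G a b p - sumTerms Λ U (terms a b) p) 2
      (volume.restrict (rect L₁ L₂)) := (hG.memLp a b hab).sub hS
  have t1 := tendsto_transport_moll hL₁ hL₂ hK hM (hΛ.top 1 0 (by simp))
    (hΛ.jet.wd_x 0 0 hΛ.one_le) (hU.memLp a b hab) hf (hv a b hab)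
    (wt_of_jet hΛ.jet hU hΛ.one_le hΛ.le hΛ.top hG hT a b hab)
  have hJ : ∀ᶠ ε in 𝓝[>] (0 : ℝ),
      IsJet L₁ L₂ m fun a b p => moll L₁ L₂ ε (U a b) p - U a b p := by
    filter_upwards [self_mem_nhdsWithin] with ε hε
    exact (isJet_moll hL₁ hL₂ hU hv hε).sub hU
  have t2 := tendsto_sumTerms hL₁ hL₂ hΛ
    (fun t ht => (goodTerm_terms a b t ht).mono hab) hJ
    (tendsto_jetNorm fun a b hab => tendsto_moll (hU.memLp a b hab))
  have t3 := t1.add t2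
  rw [add_zero] at t3
  refine tendsto_of_tendsto_of_tendsto_of_le_of_le' tendsto_const_nhds t3
    (Eventually.of_forall fun _ => zero_le) ?_
  filter_upwards [self_mem_nhdsWithin, hJ] with ε hε hJε
  have hε : 0 < ε := hε
  have e : (fun p => G a b p - mollTJet L₁ L₂ Λ U ε a b p) =
      -((fun p => Λ 0 0 p * dd (1, 0) (moll L₁ L₂ ε (U a b)) p +
        dd (0, 1) (moll L₁ L₂ ε (U a b)) p - (G a b p - sumTerms Λ U (terms a b) p)) +
      sumTerms Λ (fun a b p => moll L₁ L₂ ε (U a b) p - U a b p) (terms a b)) := by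
    funext p
    simp only [Pi.neg_apply, Pi.add_apply, sumTerms_sub, mollTJet, mollT]
    ring
  rw [e, eLpNorm_neg]
  exact eLpNorm_add_le ((memLp_mollT hΛ hU hε hab).sub hf).1
    (memLp_sumTerms_terms hL₁ hL₂ hΛ hJε hab).1 (by norm_num)

end Mollification

/-- The derivatives of the mollification agree on `Ω` with mollified derivatives, which are
continuous and vanish on `Γ`; this gives the trace conditions. The transport is in `H^m` by the
Leibniz expansion and the product estimates. -/
lemma moll_mem_XGam {L₁ L₂ : ℝ} (hL₁ : 0 < L₁) (hL₂ : 0 < L₂) {m N : ℕ}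
    {Λ U : ℕ → ℕ → ℝ × ℝ → ℝ} {lam : ℝ × ℝ → ℝ} (hΛ : IsCoeff L₁ L₂ m N Λ)
    (hlam : lam =ᵐ[volume.restrict (rect L₁ L₂)] Λ 0 0) (hlam1 : weakDeriv L₁ L₂ 1 0 lam = Λ 1 0)
    (hU : IsJet L₁ L₂ m U) (hv : ∀ a b, a + b ≤ m → VanishesOnGam L₁ L₂ (U a b)) {ε : ℝ}
    (hε : 0 < ε) : moll L₁ L₂ ε (U 0 0) ∈ XGam L₁ L₂ m lam := by
  have hJ := isJet_moll hL₁ hL₂ hU hv hε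
  refine ⟨fun a b hab => ⟨_, hJ.hasWeakDeriv hab, hJ.memLp a b hab⟩,
    ⟨mollT L₁ L₂ Λ U ε 0 0, WT.isT ?_ (locallyIntegrableOn_of_L2 (hJ.memLp 0 0 (by simp)))
      (locallyIntegrableOn_of_L2 (memLp_mollT hΛ hU hε (by simp))), fun a b hab =>
      ⟨_, hasWeakDeriv_mollTJet hL₁ hL₂ hΛ hU hv hε hab,
        memLp_mollTJet hL₁ hL₂ hΛ hU hv hε hab⟩⟩, fun a b hab => ?_⟩
  · rw [hlam1]
    exact (wt_mollT hΛ hU hε (by simp)).congr hlam.symm (ae_eq_refl _) (ae_eq_refl _) (ae_eq_refl _)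
  · refine vanishesOnGam_of_continuous hL₁ hL₂ (contDiff_moll hε (hU.memLp a b hab)).continuous
      (hJ.hasWeakDeriv hab).ae_eq_weakDeriv fun p hp => moll_eq_zero hε _ ?_
    exact hp.imp (fun h => h.le.trans hε.le) fun h => h.le.trans hε.le

lemma tendsto_xNorm_sub_moll {L₁ L₂ : ℝ} (hL₁ : 0 < L₁) (hL₂ : 0 < L₂) {m N : ℕ}
    {Λ : ℕ → ℕ → ℝ × ℝ → ℝ} {lam θ : ℝ × ℝ → ℝ} {K M : NNReal} (hΛ : IsCoeff L₁ L₂ m N Λ)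
    (hK : LipschitzWith K (Λ 0 0)) (hM : ∀ p, |Λ 0 0 p| ≤ M)
    (hlam : lam =ᵐ[volume.restrict (rect L₁ L₂)] Λ 0 0) (hlam1 : weakDeriv L₁ L₂ 1 0 lam = Λ 1 0)
    (hθ : θ ∈ XGam L₁ L₂ m lam) :
    Tendsto (fun ε => xNorm L₁ L₂ m lam (θ - moll L₁ L₂ ε (weakDeriv L₁ L₂ 0 0 θ))) (𝓝[>] 0)
      (𝓝 0) := by
  obtain ⟨hθH, ⟨g, hg, hgH⟩, hv⟩ := hθ
  have hU := hθH.isJet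
  have hG := hgH.isJet
  have hU0 := hθH.ae_eq_self
  have hG0 := hgH.ae_eq_self
  -- The jets start with `weakDeriv L₁ L₂ 0 0`, which agrees with the given function only almost
  -- everywhere; the transport equation is moved to these representatives and to the Lipschitz
  -- coefficient.
  have hT : WT L₁ L₂ (Λ 0 0) (Λ 1 0) (weakDeriv L₁ L₂ 0 0 θ) (weakDeriv L₁ L₂ 0 0 g) := by
    have h := hg.wt
    rw [hlam1] at h
    exact h.congr hlam (ae_eq_refl _) hU0.symm hG0.symm
  set U : ℕ → ℕ → ℝ × ℝ → ℝ := fun a b => weakDeriv L₁ L₂ a b θ with hUdef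
  set G : ℕ → ℕ → ℝ × ℝ → ℝ := fun a b => weakDeriv L₁ L₂ a b g with hGdef
  have t1 : Tendsto (fun ε => hNorm L₁ L₂ m (θ - moll L₁ L₂ ε (U 0 0))) (𝓝[>] 0) (𝓝 0) := by
    refine tendsto_hNorm (D := fun ε a b p => U a b p - moll L₁ L₂ ε (U a b) p) ?_ fun a b hab => ?_
    · filter_upwards [self_mem_nhdsWithin] with ε hε a b hab
      refine ((hU.sub (isJet_moll hL₁ hL₂ hU hv hε)).hasWeakDeriv hab).congr ?_ (ae_eq_refl _)
      filter_upwards [hU0] with p hp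
      rw [Pi.sub_apply, ← hp]
    · refine (tendsto_moll (hU.memLp a b hab)).congr fun ε => ?_
      rw [← eLpNorm_neg]
      congr 1
      funext p
      simp
  have t2 : Tendsto (fun ε => hNorm L₁ L₂ m (opT L₁ L₂ lam (θ - moll L₁ L₂ ε (U 0 0))))
      (𝓝[>] 0) (𝓝 0) := by
    refine tendsto_hNorm (D := fun ε a b p => G a b p - mollTJet L₁ L₂ Λ U ε a b p) ?_
      fun a b hab => tendsto_mollTJet hL₁ hL₂ hΛ hK hM hU hv hG hT hab
    filter_upwards [self_mem_nhdsWithin] with ε hε a b hab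
    have hε : 0 < ε := hε
    have hm0 : MemLp (moll L₁ L₂ ε (U 0 0)) 2 (volume.restrict (rect L₁ L₂)) :=
      memLp_moll hε (hU.memLp 0 0 (by simp))
    have hF0 := memLp_mollT (a := 0) (b := 0) hΛ hU hε (by simp)
    have hsub : (fun p => U 0 0 p - moll L₁ L₂ ε (U 0 0) p)
        =ᵐ[volume.restrict (rect L₁ L₂)] θ - moll L₁ L₂ ε (U 0 0) := by
      filter_upwards [hU0] with p hp
      rw [Pi.sub_apply, ← hp]
    have hw := hT.sub (wt_mollT (a := 0) (b := 0) hΛ hU hε (by simp)) (hΛ.top 0 0 (by simp))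
      (hΛ.top 1 0 (by simp)) (hU.memLp 0 0 (by simp)) hm0 (hG.memLp 0 0 (by simp)) hF0
    have hw' := hw.congr hlam.symm (ae_eq_refl _) hsub (ae_eq_refl _)
    rw [← hlam1] at hw'
    have hF : MemLp (fun p => G 0 0 p - mollT L₁ L₂ Λ U ε 0 0 p) 2
        (volume.restrict (rect L₁ L₂)) := (hG.memLp 0 0 (by simp)).sub hF0
    have hI : IsT L₁ L₂ lam (θ - moll L₁ L₂ ε (U 0 0))
        (fun p => G 0 0 p - mollT L₁ L₂ Λ U ε 0 0 p) :=
      hw'.isT (locallyIntegrableOn_congr hsub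
        (locallyIntegrableOn_of_L2 ((hU.memLp 0 0 (by simp)).sub hm0)))
        (locallyIntegrableOn_of_L2 hF)
    exact ((hG.hasWeakDeriv hab).sub (hasWeakDeriv_mollTJet hL₁ hL₂ hΛ hU hv hε hab)
      (hG.memLp 0 0 (by simp)) hF0 (hG.memLp a b hab)
      (memLp_mollTJet hL₁ hL₂ hΛ hU hv hε hab)).congr hI.opT_ae_eq.symm (ae_eq_refl _)
  have h2 := (((ENNReal.continuous_pow 2).tendsto 0).comp t1).add
    (((ENNReal.continuous_pow 2).tendsto 0).comp t2)
  rw [zero_pow two_ne_zero, add_zero] at h2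
  have h4 := ((ENNReal.continuous_rpow_const (y := (1 / 2 : ℝ))).tendsto 0).comp h2
  rw [ENNReal.zero_rpow_of_pos (by norm_num)] at h4
  exact h4

end RectDensity

theorem mainTheorem5 (L₁ L₂ : ℝ) (hL₁ : 0 < L₁) (hL₂ : 0 < L₂) (m : ℕ) (lam : ℝ × ℝ → ℝ)
    (hlam : RectDensity.PositiveCondition L₁ L₂ m lam) :
    ∀ θ ∈ RectDensity.XGam L₁ L₂ m lam, ∀ ε : ENNReal, 0 < ε →
      ∃ v ∈ RectDensity.VGam L₁ L₂ ∩ RectDensity.XGam L₁ L₂ m lam,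
        RectDensity.xNorm L₁ L₂ m lam (θ - v) < ε := by
  intro θ hθ ε hε
  obtain ⟨N, Λ, K, M, hΛ, hK, hM, hlam0, hlam1⟩ := RectDensity.exists_isCoeff hL₁ hL₂ hlam
  have ht := RectDensity.tendsto_xNorm_sub_moll hL₁ hL₂ hΛ hK hM hlam0 hlam1 hθ
  obtain ⟨η, hη, hη0⟩ := ((ht.eventually (gt_mem_nhds hε)).and self_mem_nhdsWithin).exists
  have hU := hθ.1.isJet
  exact ⟨_, ⟨RectDensity.moll_mem_VGam hη0 (hU.memLp 0 0 (by simp)),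
    RectDensity.moll_mem_XGam hL₁ hL₂ hΛ hlam0 hlam1 hU hθ.2.2 hη0⟩, hη⟩
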